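/- Call a set of points in the plane in general position if no three of its points are collinear. Two straight line segments cross if their intersection is a single point different from their endpoints. For a finite set $S$ of points in general position in the plane, let $\overline{\operatorname{cr}}(S)$ be the number of (unordered) pairs of segments joining two points of $S$ that cross. Theorem. Let $S$ be a set of $n$ points in general position in the plane, let $p\in S$, and let $C$ be a set of $\Theta(n)$ "candidate" points such that $S\cup C$ is in general position and $C\cap S=\emptyset$. Then all the values $\overline{\operatorname{cr}}\bigl((S\setminus\{p\})\cup\{q\}\bigr)$, $q\in C$, can be computed in $O(n^2)$ time on a real RAM. That is, there is a single real RAM program such that for all constants $0<\alpha$, $0<\beta$ there is a constant $K$ with the following property: whenever $S$, $C$, $p$ are as above with $\alpha n\le |C|\le \beta n$, the program, given the coordinates of the points of $S$ and of $C$, each listed in an arbitrary order, and the index of $p$ in the list of $S$, halts after at most $Kn^2$ steps and outputs, for every $q\in C$, the number $\overline{\operatorname{cr}}\bigl((S\setminus\{p\})\cup\{q\}\bigr)$. Here a real RAM is a random access machine storing natural numbers (with addition, truncated subtraction and comparison, used for counters and addresses) and real numbers (with exact addition, subtraction, multiplication, division and comparison, and conversion from natural to real numbers but no rounding); its programs contain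 no constants other than natural numbers, and each elementary operation takes one step. -/

import Mathlib

/-! ## Crossings of point sets in the plane -/

/-- Points of the plane. -/
abbrev Point : Type := ℝ × ℝ

/-- A set of points is in general position if no three of its points are collinear. -/
def InGeneralPosition (P : Set Point) : Prop :=
  ∀ a ∈ P, ∀ b ∈ P, ∀ c ∈ P, a ≠ b → a ≠ c → b ≠ c → ¬ Collinear ℝ ({a, b, c} : Set Point)

/-- An edge is given by the set of its two endpoints, and drawn as the segment joining them, which is
the convex hull of that set. Two edges cross if the segments meet in exactly one point and this point
is different from their endpoints. -/
def Crosses (e f : Finset Point) : Prop :=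
  ∃ x : Point, convexHull ℝ (e : Set Point) ∩ convexHull ℝ (f : Set Point) = {x} ∧ x ∉ e ∧ x ∉ f

theorem crosses_symm : Std.Symm Crosses where
  symm := by
    rintro e f ⟨x, hx, he, hf⟩
    exact ⟨x, by rw [Set.inter_comm]; exact hx, hf, he⟩

open Classical in
/-- The number of crossings of `S`: the number of unordered pairs of edges of the complete
graph drawn with straight line segments on the vertex set `S` that cross. -/
noncomputable def crossingNumber (S : Finset Point) : ℕ :=
  ((S.powersetCard 2).sym2.filter
    (fun pair => pair ∈ Sym2.fromRel crosses_symm)).card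

/-! ## The real RAM

A random access machine with two kinds of data: natural numbers (counters, indices, pointers), with
addition, truncated subtraction and comparison, and real numbers, with exact addition, subtraction,
multiplication, division and comparison. There is no rounding and no other way to turn a real number
into a natural number, and the only constants of a program are natural numbers. Every variable
and array is named by a number written in the program, so that a program has only finitely many of
them; the cells of an array are addressed by computed natural numbers. -/

namespace RealRAM

/-- A memory configuration: variables and arrays of natural numbers and of real numbers. -/
structure State where
  natVar : ℕ → ℕ
  realVar : ℕ → ℝ
  natArr : ℕ → ℕ → ℕ
  realArr : ℕ → ℕ → ℝ

/-- Expressions with values in the natural numbers. -/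
inductive NatExpr where
  | const (k : ℕ)
  | var (x : ℕ)
  | get (a : ℕ) (i : NatExpr)
  | add (e₁ e₂ : NatExpr)
  | sub (e₁ e₂ : NatExpr)

/-- Expressions with values in the real numbers. -/
inductive RealExpr where
  | ofNat (e : NatExpr)
  | var (x : ℕ)
  | get (a : ℕ) (i : NatExpr)
  | add (e₁ e₂ : RealExpr)
  | sub (e₁ e₂ : RealExpr)
  | mul (e₁ e₂ : RealExpr)
  | div (e₁ e₂ : RealExpr)

/-- Conditions. -/
inductive Cond where
  | natLt (e₁ e₂ : NatExpr)
  | natEq (e₁ e₂ : NatExpr)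
  | realLt (e₁ e₂ : RealExpr)
  | realEq (e₁ e₂ : RealExpr)
  | not (b : Cond)
  | and (b₁ b₂ : Cond)
  | or (b₁ b₂ : Cond)

/-- Programs. -/
inductive Program where
  | skip
  | setNat (x : ℕ) (e : NatExpr)
  | setReal (x : ℕ) (e : RealExpr)
  | storeNat (a : ℕ) (i e : NatExpr)
  | storeReal (a : ℕ) (i : NatExpr) (e : RealExpr)
  | seq (c₁ c₂ : Program)
  | cond (b : Cond) (c₁ c₂ : Program)
  | loop (b : Cond) (c : Program)

def NatExpr.eval (s : State) : NatExpr → ℕ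
  | const k => k
  | var x => s.natVar x
  | get a i => s.natArr a (i.eval s)
  | add e₁ e₂ => e₁.eval s + e₂.eval s
  | sub e₁ e₂ => e₁.eval s - e₂.eval s

/-- Division by zero gives zero. -/
noncomputable def RealExpr.eval (s : State) : RealExpr → ℝ
  | ofNat e => (e.eval s : ℝ)
  | var x => s.realVar x
  | get a i => s.realArr a (i.eval s)
  | add e₁ e₂ => e₁.eval s + e₂.eval s
  | sub e₁ e₂ => e₁.eval s - e₂.eval s
  | mul e₁ e₂ => e₁.eval s * e₂.eval s
  | div e₁ e₂ => e₁.eval s / e₂.eval s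

def Cond.Holds (s : State) : Cond → Prop
  | natLt e₁ e₂ => e₁.eval s < e₂.eval s
  | natEq e₁ e₂ => e₁.eval s = e₂.eval s
  | realLt e₁ e₂ => e₁.eval s < e₂.eval s
  | realEq e₁ e₂ => e₁.eval s = e₂.eval s
  | not b => ¬ b.Holds s
  | and b₁ b₂ => b₁.Holds s ∧ b₂.Holds s
  | or b₁ b₂ => b₁.Holds s ∨ b₂.Holds s

/-- The number of steps for the evaluation of an expression: one for each constant, each access to
a variable or an array cell, and each operation. -/
def NatExpr.cost : NatExpr → ℕ
  | const _ => 1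
  | var _ => 1
  | get _ i => i.cost + 1
  | add e₁ e₂ => e₁.cost + e₂.cost + 1
  | sub e₁ e₂ => e₁.cost + e₂.cost + 1

def RealExpr.cost : RealExpr → ℕ
  | ofNat e => e.cost + 1
  | var _ => 1
  | get _ i => i.cost + 1
  | add e₁ e₂ => e₁.cost + e₂.cost + 1
  | sub e₁ e₂ => e₁.cost + e₂.cost + 1
  | mul e₁ e₂ => e₁.cost + e₂.cost + 1
  | div e₁ e₂ => e₁.cost + e₂.cost + 1

def Cond.cost : Cond → ℕ
  | natLt e₁ e₂ => e₁.cost + e₂.cost + 1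
  | natEq e₁ e₂ => e₁.cost + e₂.cost + 1
  | realLt e₁ e₂ => e₁.cost + e₂.cost + 1
  | realEq e₁ e₂ => e₁.cost + e₂.cost + 1
  | not b => b.cost + 1
  | and b₁ b₂ => b₁.cost + b₂.cost + 1
  | or b₁ b₂ => b₁.cost + b₂.cost + 1

def State.setNat (s : State) (x v : ℕ) : State :=
  { s with natVar := Function.update s.natVar x v }

def State.setReal (s : State) (x : ℕ) (v : ℝ) : State :=
  { s with realVar := Function.update s.realVar x v }

def State.storeNat (s : State) (a i v : ℕ) : State :=
  { s with natArr := Function.update s.natArr a (Function.update (s.natArr a) i v) }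

def State.storeReal (s : State) (a i : ℕ) (v : ℝ) : State :=
  { s with realArr := Function.update s.realArr a (Function.update (s.realArr a) i v) }

/-- `Exec c s t s'`: the program `c`, started in the configuration `s`, halts after exactly `t`
steps in the configuration `s'`. Each assignment and each branching, including every test made by a
loop, takes one step in addition to the evaluation of its expressions. -/
inductive Exec : Program → State → ℕ → State → Prop
  | skip (s : State) : Exec .skip s 1 s
  | setNat (x : ℕ) (e : NatExpr) (s : State) :
      Exec (.setNat x e) s (e.cost + 1) (s.setNat x (e.eval s))
  | setReal (x : ℕ) (e : RealExpr) (s : State) :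
      Exec (.setReal x e) s (e.cost + 1) (s.setReal x (e.eval s))
  | storeNat (a : ℕ) (i e : NatExpr) (s : State) :
      Exec (.storeNat a i e) s (i.cost + e.cost + 1) (s.storeNat a (i.eval s) (e.eval s))
  | storeReal (a : ℕ) (i : NatExpr) (e : RealExpr) (s : State) :
      Exec (.storeReal a i e) s (i.cost + e.cost + 1) (s.storeReal a (i.eval s) (e.eval s))
  | seq {c₁ c₂ : Program} {s s₁ s₂ : State} {t₁ t₂ : ℕ} :
      Exec c₁ s t₁ s₁ → Exec c₂ s₁ t₂ s₂ → Exec (.seq c₁ c₂) s (t₁ + t₂) s₂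
  | condTrue {b : Cond} {c₁ c₂ : Program} {s s₁ : State} {t : ℕ} :
      b.Holds s → Exec c₁ s t s₁ → Exec (.cond b c₁ c₂) s (b.cost + 1 + t) s₁
  | condFalse {b : Cond} {c₁ c₂ : Program} {s s₁ : State} {t : ℕ} :
      ¬ b.Holds s → Exec c₂ s t s₁ → Exec (.cond b c₁ c₂) s (b.cost + 1 + t) s₁
  | loopDone {b : Cond} {c : Program} {s : State} :
      ¬ b.Holds s → Exec (.loop b c) s (b.cost + 1) s
  | loopStep {b : Cond} {c : Program} {s s₁ s₂ : State} {t₁ t₂ : ℕ} :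
      b.Holds s → Exec c s t₁ s₁ → Exec (.loop b c) s₁ t₂ s₂ →
      Exec (.loop b c) s (b.cost + 1 + t₁ + t₂) s₂

/-- The array of real numbers that holds `v 0, …, v (n - 1)`, followed by zeros. -/
def arrayOf {n : ℕ} (v : Fin n → ℝ) (i : ℕ) : ℝ :=
  if h : i < n then v ⟨i, h⟩ else 0

/-- The initial configuration for the input that consists of the points `s 0, …, s (n - 1)`, the
candidates `c 0, …, c (m - 1)` and the index `k` of a point `s k`: variables `0`, `1`, `2`
hold `n`, `m`, `k`, the real arrays `0`, `1` hold the coordinates of the points, the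
real arrays `2`, `3` those of the candidates, and all other cells hold zero. -/
def State.input {n m : ℕ} (s : Fin n → Point) (c : Fin m → Point) (k : Fin n) : State where
  natVar
    | 0 => n
    | 1 => m
    | 2 => k
    | _ => 0
  realVar _ := 0
  natArr _ _ := 0
  realArr
    | 0 => arrayOf (fun i => (s i).1)
    | 1 => arrayOf (fun i => (s i).2)
    | 2 => arrayOf (fun j => (c j).1)
    | 3 => arrayOf (fun j => (c j).2)
    | _ => fun _ => 0

end RealRAM

/-! Four points in general position can be split into two pairs in three ways, which gives six
ordered choices of a line through one pair and the opposite pair. In convex position exactly two of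
these lines separate the opposite pair (the diagonals), and there is one crossing. Otherwise three
lines separate (those through the inner point), and there is no crossing. Hence separations plus
crossings always equal 3 (`sum_sepInd`). Summing over all quadruples expresses the crossing number
through the sum, over ordered pairs `(a, b)`, of the product of the numbers of points on the two
sides of the line `a b` (`crossingNumber_formula`).

Let `T` be the set without the removed point. Adding `q` to `T` increases this sum by two terms
(`sum_counts_insert`). One is the number of points of `T` opposite to `q`, summed over the lines
spanned by `T`. The other is twice the sum of the products over the lines through `q`. For a fixed
centre `x` everything needed comes from one rotation of a line about `x`, with constant work per
point passed. Prefix sums of (points below minus points above) give the opposite counts for all `q`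
at once (`opposite_eq_of_lt`, `opposite_eq_of_gt`).

The rotation needs the slope order of all points about every `x`. Sorting each of these orders by
comparisons would cost an extra logarithm, so they are all read off one line arrangement. The
points, sorted lexicographically, are dualised to lines of increasing slope (`exists_arrangement`),
and the order of the crossings on line `x` is the slope order about the point `x`. The lines are
inserted by increasing slope. The new line `k` starts below all earlier ones and crosses each of
them upwards. The next line to be crossed is found by walking around the part of the current cell's
boundary to the left of `k`: leftwards along the floor, then rightwards along the ceiling up to the
line that meets `k` first. Each line keeps its crossings in a doubly linked sorted list.

The walk along line `k` takes at most `4 * k` moves. This is the zone theorem, in the form that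
every earlier line is charged at most once on a floor (`FloorCharged.floor`) and at most once on a
ceiling (`CeilingCharged.ceiling`). `WalkInv` turns these charges into a decreasing budget.
Inserting all lines is therefore quadratic, and so are the counting sort and the rotations.

The program never sees a slope or the shear used in the duality. It compares points
lexicographically and tests orientations (`Dual.x_lt_iff`). Its loop-free blocks are verified by
weakest preconditions (`Runs.of_wp`), its loops by invariants with a budget (`Runs.loop`,
`Runs.forLoop`). -/

namespace RealRAM

/-! ### A program logic with step bounds -/

@[simp] theorem State.natVar_setNat (s : State) (x v y : ℕ) :
    (s.setNat x v).natVar y = if y = x then v else s.natVar y := by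
  simp [State.setNat, Function.update_apply]
@[simp] theorem State.realVar_setNat (s : State) (x v : ℕ) :
    (s.setNat x v).realVar = s.realVar := rfl
@[simp] theorem State.natArr_setNat (s : State) (x v : ℕ) :
    (s.setNat x v).natArr = s.natArr := rfl
@[simp] theorem State.realArr_setNat (s : State) (x v : ℕ) :
    (s.setNat x v).realArr = s.realArr := rfl
@[simp] theorem State.natVar_setReal (s : State) (x : ℕ) (v : ℝ) :
    (s.setReal x v).natVar = s.natVar := rfl
@[simp] theorem State.realVar_setReal (s : State) (x : ℕ) (v : ℝ) (y : ℕ) :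
    (s.setReal x v).realVar y = if y = x then v else s.realVar y := by
  simp [State.setReal, Function.update_apply]
@[simp] theorem State.natArr_setReal (s : State) (x : ℕ) (v : ℝ) :
    (s.setReal x v).natArr = s.natArr := rfl
@[simp] theorem State.realArr_setReal (s : State) (x : ℕ) (v : ℝ) :
    (s.setReal x v).realArr = s.realArr := rfl
@[simp] theorem State.natVar_storeNat (s : State) (a i v : ℕ) :
    (s.storeNat a i v).natVar = s.natVar := rfl
@[simp] theorem State.realVar_storeNat (s : State) (a i v : ℕ) :
    (s.storeNat a i v).realVar = s.realVar := rfl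
@[simp] theorem State.natArr_storeNat (s : State) (a i v b j : ℕ) :
    (s.storeNat a i v).natArr b j = if b = a ∧ j = i then v else s.natArr b j := by
  by_cases h : b = a
  · subst h; simp [State.storeNat, Function.update_apply]
  · simp [State.storeNat, h]
@[simp] theorem State.realArr_storeNat (s : State) (a i v : ℕ) :
    (s.storeNat a i v).realArr = s.realArr := rfl
@[simp] theorem State.natVar_storeReal (s : State) (a i : ℕ) (v : ℝ) :
    (s.storeReal a i v).natVar = s.natVar := rfl
@[simp] theorem State.realVar_storeReal (s : State) (a i : ℕ) (v : ℝ) :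
    (s.storeReal a i v).realVar = s.realVar := rfl
@[simp] theorem State.natArr_storeReal (s : State) (a i : ℕ) (v : ℝ) :
    (s.storeReal a i v).natArr = s.natArr := rfl
@[simp] theorem State.realArr_storeReal (s : State) (a i : ℕ) (v : ℝ) (b j : ℕ) :
    (s.storeReal a i v).realArr b j = if b = a ∧ j = i then v else s.realArr b j := by
  by_cases h : b = a
  · subst h; simp [State.storeReal, Function.update_apply]
  · simp [State.storeReal, h]

/-- The program `c`, started in `s`, halts within `T` steps in a configuration satisfying `Q`. -/
def Runs (c : Program) (s : State) (T : ℕ) (Q : State → Prop) : Prop :=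
  ∃ t s', Exec c s t s' ∧ t ≤ T ∧ Q s'

theorem Runs.mono {c : Program} {s : State} {T T' : ℕ} {Q Q' : State → Prop}
    (h : Runs c s T Q) (hT : T ≤ T') (hQ : ∀ s', Q s' → Q' s') : Runs c s T' Q' := by
  obtain ⟨t, s', he, ht, hq⟩ := h
  exact ⟨t, s', he, ht.trans hT, hQ _ hq⟩

theorem Runs.seq {c₁ c₂ : Program} {s : State} {T₁ T₂ : ℕ} {Q R : State → Prop}
    (h₁ : Runs c₁ s T₁ R) (h₂ : ∀ s', R s' → Runs c₂ s' T₂ Q) :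
    Runs (.seq c₁ c₂) s (T₁ + T₂) Q := by
  obtain ⟨t, s', he, ht, hr⟩ := h₁
  obtain ⟨t', s'', he', ht', hq⟩ := h₂ s' hr
  exact ⟨_, _, .seq he he', Nat.add_le_add ht ht', hq⟩

/-- A loop whose body decreases a budget. -/
theorem Runs.loop {b : Cond} {c : Program} {T : ℕ} (I : ℕ → State → Prop)
    (step : ∀ r s, I r s → b.Holds s → Runs c s T (fun s' => ∃ r' < r, I r' s'))
    (r : ℕ) (s : State) (h : I r s) :
    Runs (.loop b c) s ((b.cost + 1 + T) * r + (b.cost + 1))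
      (fun s' => ¬ b.Holds s' ∧ ∃ r', I r' s') := by
  induction r using Nat.strong_induction_on generalizing s with
  | _ r ih =>
    by_cases hb : b.Holds s
    · obtain ⟨t, s', he, ht, r', hr, hI⟩ := step r s h hb
      obtain ⟨t', s'', he', ht', hq⟩ := ih r' hr s' hI
      refine ⟨_, _, .loopStep hb he he', ?_, hq⟩
      have := Nat.mul_le_mul_left (b.cost + 1 + T) (Nat.succ_le_of_lt hr)
      rw [Nat.mul_succ] at this
      omega
    · exact ⟨_, _, .loopDone hb, Nat.le_add_left _ _, hb, r, h⟩

/-- A program without loops. -/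
def Program.Flat : Program → Prop
  | .seq c₁ c₂ => c₁.Flat ∧ c₂.Flat
  | .cond _ c₁ c₂ => c₁.Flat ∧ c₂.Flat
  | .loop _ _ => False
  | _ => True

/-- An upper bound for the number of steps of a program without loops. -/
def Program.maxCost : Program → ℕ
  | .skip => 1
  | .setNat _ e => e.cost + 1
  | .setReal _ e => e.cost + 1
  | .storeNat _ i e => i.cost + e.cost + 1
  | .storeReal _ i e => i.cost + e.cost + 1
  | .seq c₁ c₂ => c₁.maxCost + c₂.maxCost
  | .cond b c₁ c₂ => b.cost + 1 + (c₁.maxCost + c₂.maxCost)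
  | .loop _ _ => 0

/-- The weakest precondition of a program without loops. -/
def Program.wp : Program → (State → Prop) → State → Prop
  | .skip, Q, s => Q s
  | .setNat x e, Q, s => Q (s.setNat x (e.eval s))
  | .setReal x e, Q, s => Q (s.setReal x (e.eval s))
  | .storeNat a i e, Q, s => Q (s.storeNat a (i.eval s) (e.eval s))
  | .storeReal a i e, Q, s => Q (s.storeReal a (i.eval s) (e.eval s))
  | .seq c₁ c₂, Q, s => c₁.wp (c₂.wp Q) s
  | .cond b c₁ c₂, Q, s => (b.Holds s → c₁.wp Q s) ∧ (¬ b.Holds s → c₂.wp Q s)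
  | .loop _ _, _, _ => False

/-- The step bound of a loop-free block depends only on its text, so for such blocks only the effect
on the memory has to be verified. -/
theorem Runs.of_wp {c : Program} (hc : c.Flat) {s : State} {Q : State → Prop} (h : c.wp Q s) :
    Runs c s c.maxCost Q := by
  induction c generalizing s Q with
  | skip => exact ⟨_, _, .skip s, le_rfl, h⟩
  | setNat x e => exact ⟨_, _, .setNat x e s, le_rfl, h⟩
  | setReal x e => exact ⟨_, _, .setReal x e s, le_rfl, h⟩
  | storeNat a i e => exact ⟨_, _, .storeNat a i e s, le_rfl, h⟩
  | storeReal a i e => exact ⟨_, _, .storeReal a i e s, le_rfl, h⟩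
  | seq c₁ c₂ ih₁ ih₂ => exact (ih₁ hc.1 h).seq fun s' h' => ih₂ hc.2 h'
  | cond b c₁ c₂ ih₁ ih₂ =>
    by_cases hb : b.Holds s
    · obtain ⟨t, s', he, ht, hq⟩ := ih₁ hc.1 (h.1 hb)
      exact ⟨_, _, .condTrue hb he, by simp only [Program.maxCost]; omega, hq⟩
    · obtain ⟨t, s', he, ht, hq⟩ := ih₂ hc.2 (h.2 hb)
      exact ⟨_, _, .condFalse hb he, by simp only [Program.maxCost]; omega, hq⟩
  | loop b c => exact hc.elim

end RealRAM

/-! ### Orientation determinants and crossing segments -/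

/-- Twice the signed area of a triangle. -/
def det (a b c : Point) : ℝ := (b.1 - a.1) * (c.2 - a.2) - (b.2 - a.2) * (c.1 - a.1)

theorem det_swap (a b c : Point) : det b a c = -det a b c := by unfold det; ring

theorem det_self_left (a b : Point) : det a b a = 0 := by unfold det; ring

theorem det_self_right (a b : Point) : det a b b = 0 := by unfold det; ring

theorem det_self (a b : Point) : det a a b = 0 := by unfold det; ring

theorem collinear_of_det_eq_zero {a b c : Point} (hab : a ≠ b) (h : det a b c = 0) :
    Collinear ℝ ({a, b, c} : Set Point) := by
  rw [collinear_iff_of_mem (p₀ := a) (by simp)]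
  refine ⟨b - a, ?_⟩
  obtain ⟨a1, a2⟩ := a
  obtain ⟨b1, b2⟩ := b
  obtain ⟨c1, c2⟩ := c
  simp only [det] at h
  intro p hp
  simp only [Set.mem_insert_iff, Set.mem_singleton_iff] at hp
  rcases hp with rfl | rfl | rfl
  · exact ⟨0, by simp⟩
  · exact ⟨1, by simp⟩
  · by_cases h1 : b1 - a1 = 0
    · have h2 : b2 - a2 ≠ 0 := by
        intro h2
        exact hab (Prod.ext (by simp only; linarith) (by simp only; linarith))
      refine ⟨(c2 - a2) / (b2 - a2), ?_⟩
      rw [h1, zero_mul, zero_sub, neg_eq_zero] at h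
      have h3 : c1 - a1 = 0 := (mul_eq_zero.1 h).resolve_left h2
      ext
      · simp [h1]; linarith
      · simp; field_simp; ring
    · refine ⟨(c1 - a1) / (b1 - a1), ?_⟩
      ext
      · simp; field_simp; ring
      · simp; field_simp; linarith

theorem InGeneralPosition.det_ne_zero {P : Set Point} (hP : InGeneralPosition P) {a b c : Point}
    (ha : a ∈ P) (hb : b ∈ P) (hc : c ∈ P) (hab : a ≠ b) (hac : a ≠ c) (hbc : b ≠ c) :
    det a b c ≠ 0 :=
  fun h => hP a ha b hb c hc hab hac hbc (collinear_of_det_eq_zero hab h)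

theorem det_lineMap (a b c d : Point) (u v : ℝ) (h : u + v = 1) :
    det a b (u • c + v • d) = u * det a b c + v * det a b d := by
  obtain rfl : u = 1 - v := by linarith
  simp [det]; ring

/-- The line through `a` and `b` separates `c` and `d`. -/
def Separates (a b c d : Point) : Prop := det a b c * det a b d < 0

/-- `det a b` is affine in its last argument and vanishes on the line through `a` and `b`. It thus
has a zero strictly between `c` and `d` exactly when its values there have opposite signs. This
reduces a condition on convex hulls to four signs. -/
theorem crosses_pair_iff {a b c d : Point} (h1 : det a b c ≠ 0) (h2 : det a b d ≠ 0)
    (h3 : det c d a ≠ 0) (h4 : det c d b ≠ 0) :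
    Crosses {a, b} {c, d} ↔ Separates a b c d ∧ Separates c d a b := by
  have aux : ∀ {a b c d x : Point}, det a b c ≠ 0 → det a b d ≠ 0 → x ∈ segment ℝ a b →
      x ∈ segment ℝ c d → Separates a b c d := by
    rintro a b c d x h1 h2 ⟨u, v, hu, hv, huv, rfl⟩ ⟨u', v', hu', hv', huv', hx⟩
    have e1 := det_lineMap a b a b u v huv
    rw [det_self_left, det_self_right, ← hx, det_lineMap _ _ _ _ _ _ huv'] at e1
    simp only [mul_zero, add_zero] at e1
    unfold Separates
    by_contra hn
    rw [not_lt] at hn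
    have hpos : 0 < det a b c * det a b d := lt_of_le_of_ne hn (mul_ne_zero h1 h2).symm
    obtain rfl : u' = 1 - v' := by linarith
    rcases mul_pos_iff.1 hpos with ⟨p, q⟩ | ⟨p, q⟩
    · have := mul_nonneg hu' p.le
      have := mul_nonneg hv' q.le
      rcases hv'.eq_or_lt with h | h
      · rw [← h] at e1; linarith
      · have := mul_pos h q; linarith
    · have := mul_nonneg hu' (neg_nonneg.2 p.le)
      have := mul_nonneg hv' (neg_nonneg.2 q.le)
      rcases hv'.eq_or_lt with h | h
      · rw [← h] at e1; linarith
      · have := mul_pos h (neg_pos.2 q); linarith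
  unfold Crosses
  simp only [Finset.coe_insert, Finset.coe_singleton, convexHull_pair]
  constructor
  · rintro ⟨x, hx, -, -⟩
    have hm : x ∈ segment ℝ a b ∩ segment ℝ c d := by rw [hx]; rfl
    exact ⟨aux h1 h2 hm.1 hm.2, aux h3 h4 hm.2 hm.1⟩
  · rintro ⟨s1, s2⟩
    unfold Separates at s1 s2
    have key : ∀ p q : ℝ, p * q < 0 → 0 < p / (p - q) ∧ 0 < -q / (p - q) ∧ p - q ≠ 0 := by
      intro p q h
      rcases mul_neg_iff.1 h with ⟨hp, hq⟩ | ⟨hp, hq⟩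
      · exact ⟨div_pos hp (by linarith), div_pos (by linarith) (by linarith), by linarith⟩
      · exact ⟨div_pos_of_neg_of_neg hp (by linarith),
          div_pos_of_neg_of_neg (by linarith) (by linarith), by linarith⟩
    obtain ⟨k1, k2, k3⟩ := key _ _ s1
    obtain ⟨l1, l2, l3⟩ := key _ _ s2
    set p := det a b c with hp
    set q := det a b d with hq
    set r := det c d a with hr
    set s := det c d b with hs
    -- The zero of `det a b` on the line through `c` and `d`; `hx2` shows that it is also the zero
    -- of `det c d` on the line through `a` and `b`.
    set x : Point := (-q / (p - q)) • c + (p / (p - q)) • d with hxdef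
    -- Both differences are the cross product of the directions of the two lines, so the two
    -- descriptions of `x` share their denominator up to sign.
    have hrel : p - q = s - r := by rw [hp, hq, hr, hs]; unfold det; ring
    have hx2 : x = (-s / (r - s)) • a + (r / (r - s)) • b := by
      have e : r - s = -(p - q) := by linarith
      rw [hxdef, e]
      ext
      · simp only [Prod.fst_add, Prod.smul_fst, smul_eq_mul]
        field_simp
        rw [hp, hq, hr, hs]; unfold det; ring
      · simp only [Prod.snd_add, Prod.smul_snd, smul_eq_mul]
        field_simp
        rw [hp, hq, hr, hs]; unfold det; ring
    have hxcd : x ∈ segment ℝ c d := ⟨_, _, k2.le, k1.le, by field_simp; ring, rfl⟩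
    have hxab : x ∈ segment ℝ a b := ⟨_, _, l2.le, l1.le, by field_simp; ring, hx2.symm⟩
    have hdx : det a b x = 0 := by
      rw [hx2, det_lineMap _ _ _ _ _ _ (by field_simp; ring), det_self_left, det_self_right]; ring
    have hdx' : det c d x = 0 := by
      rw [hxdef, det_lineMap _ _ _ _ _ _ (by field_simp; ring), det_self_left, det_self_right]; ring
    refine ⟨x, ?_, ?_, ?_⟩
    · refine Set.Subset.antisymm ?_ (Set.singleton_subset_iff.2 ⟨hxab, hxcd⟩)
      rintro y ⟨⟨u, v, hu, hv, huv, hy⟩, u', v', hu', hv', huv', hy'⟩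
      have e1 : det a b y = 0 := by
        rw [← hy, det_lineMap _ _ _ _ _ _ huv, det_self_left, det_self_right]; ring
      rw [← hy', det_lineMap _ _ _ _ _ _ huv', ← hp, ← hq] at e1
      obtain rfl : u' = 1 - v' := by linarith
      have ev : v' = p / (p - q) := by field_simp; linarith
      have eu : 1 - v' = -q / (p - q) := by rw [ev]; field_simp; ring
      rw [Set.mem_singleton_iff, ← hy', hxdef, ← ev, ← eu]
    · simp only [Finset.mem_insert, Finset.mem_singleton, not_or]
      exact ⟨fun h => h3 (by rw [hr, ← h, hdx']), fun h => h4 (by rw [hs, ← h, hdx'])⟩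
    · simp only [Finset.mem_insert, Finset.mem_singleton, not_or]
      exact ⟨fun h => h1 (by rw [hp, ← h, hdx]), fun h => h2 (by rw [hq, ← h, hdx])⟩

theorem not_crosses_of_mem {e f : Finset Point} {a : Point} (he : a ∈ e) (hf : a ∈ f) :
    ¬ Crosses e f := by
  rintro ⟨x, hx, hxe, -⟩
  have : a ∈ convexHull ℝ (e : Set Point) ∩ convexHull ℝ (f : Set Point) :=
    ⟨subset_convexHull ℝ _ he, subset_convexHull ℝ _ hf⟩
  rw [hx, Set.mem_singleton_iff] at this
  exact hxe (this ▸ he)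

/-! ### Double counting: the crossing number from side counts -/

theorem sum_offDiag_pair {α : Type*} [DecidableEq α] (S : Finset α) (g : Finset α → ℕ) :
    ∑ p ∈ S.offDiag, g {p.1, p.2} = 2 * ∑ e ∈ S.powersetCard 2, g e := by
  rw [← Finset.sum_fiberwise_of_maps_to (t := S.powersetCard 2)
    (g := fun p : α × α => ({p.1, p.2} : Finset α)), Finset.mul_sum]
  · refine Finset.sum_congr rfl fun e he => ?_
    rw [Finset.mem_powersetCard, Finset.card_eq_two] at he
    obtain ⟨hS, a, b, hab, rfl⟩ := he
    have ha : a ∈ S := hS (by simp)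
    have hb : b ∈ S := hS (by simp)
    have : S.offDiag.filter (fun p : α × α => ({p.1, p.2} : Finset α) = {a, b}) =
        {(a, b), (b, a)} := by
      ext ⟨x, y⟩
      simp only [Finset.mem_filter, Finset.mem_offDiag, Finset.mem_insert, Finset.mem_singleton,
        Prod.mk.injEq]
      constructor
      · rintro ⟨⟨-, -, hxy⟩, h⟩
        have hx : x ∈ ({a, b} : Finset α) := by rw [← h]; simp
        have hy : y ∈ ({a, b} : Finset α) := by rw [← h]; simp
        simp only [Finset.mem_insert, Finset.mem_singleton] at hx hy
        rcases hx with rfl | rfl <;> rcases hy with rfl | rfl <;> simp_all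
      · rintro (⟨rfl, rfl⟩ | ⟨rfl, rfl⟩)
        · exact ⟨⟨ha, hb, hab⟩, rfl⟩
        · exact ⟨⟨hb, ha, hab.symm⟩, Finset.pair_comm _ _⟩
    rw [this, Finset.sum_pair (by simp [hab])]
    simp only [Finset.pair_comm b a]
    ring
  · rintro ⟨a, b⟩ h
    rw [Finset.mem_offDiag] at h
    rw [Finset.mem_powersetCard]
    refine ⟨?_, Finset.card_pair h.2.2⟩
    intro x hx
    simp only [Finset.mem_insert, Finset.mem_singleton] at hx
    rcases hx with rfl | rfl
    exacts [h.1, h.2.1]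

theorem sum_offDiag_of_diag_eq_zero {α M : Type*} [DecidableEq α] [AddCommMonoid M] {S : Finset α}
    {f : α × α → M} (hf : ∀ a ∈ S, f (a, a) = 0) :
    ∑ p ∈ S.offDiag, f p = ∑ a ∈ S, ∑ b ∈ S, f (a, b) := by
  rw [← Finset.sum_product']
  refine Finset.sum_subset (fun p hp => ?_) (fun p hp hp' => ?_)
  · rw [Finset.mem_offDiag] at hp
    exact Finset.mem_product.2 ⟨hp.1, hp.2.1⟩
  · obtain ⟨a, b⟩ := p
    rw [Finset.mem_product] at hp
    have : a = b := by
      by_contra h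
      exact hp' (Finset.mem_offDiag.2 ⟨hp.1, hp.2, h⟩)
    subst this
    exact hf a hp.1

open Classical in
theorem two_mul_card_sym2_filter {α : Type*} (E : Finset α) {R : α → α → Prop} (hR : Std.Symm R)
    (hirr : ∀ e, ¬ R e e) :
    2 * (E.sym2.filter (fun pair => pair ∈ Sym2.fromRel hR)).card =
      ∑ e ∈ E, ∑ f ∈ E, if R e f then 1 else 0 := by
  rw [← Finset.sum_product', ← Finset.sum_filter, ← Finset.card_eq_sum_ones,
    Finset.card_eq_sum_card_fiberwise (f := fun p : α × α => s(p.1, p.2))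
      (t := E.sym2.filter (fun pair => pair ∈ Sym2.fromRel hR)), mul_comm, ← smul_eq_mul,
      ← Finset.sum_const]
  · refine (Finset.sum_congr rfl fun z hz => ?_).symm
    induction z using Sym2.ind with
    | _ a b =>
      simp only [Finset.mem_filter, Finset.mk_mem_sym2_iff, Sym2.fromRel_prop] at hz
      have hne : a ≠ b := by rintro rfl; exact hirr _ hz.2
      rw [Finset.card_eq_two]
      refine ⟨(a, b), (b, a), by simp [hne], ?_⟩
      ext ⟨x, y⟩
      simp only [Finset.mem_filter, Finset.mem_product, Finset.mem_insert, Finset.mem_singleton,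
        Prod.mk.injEq, Sym2.eq_iff]
      constructor
      · rintro ⟨-, h⟩; exact h
      · rintro (⟨rfl, rfl⟩ | ⟨rfl, rfl⟩)
        · exact ⟨⟨hz.1, hz.2⟩, by simp⟩
        · exact ⟨⟨hz.1.symm, hR.symm _ _ hz.2⟩, by simp⟩
  · rintro ⟨a, b⟩ h
    simp only [Finset.coe_filter, Finset.mem_product, Set.mem_ofPred_eq] at h
    simp only [Finset.coe_filter, Set.mem_ofPred_eq, Finset.mk_mem_sym2_iff, Sym2.fromRel_prop]
    exact h

-- The factor 8 consists of two orders of the two edges and two orientations of each.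
open Classical in
theorem eight_mul_crossingNumber (S : Finset Point) :
    8 * crossingNumber S =
      ∑ p ∈ S.offDiag, ∑ q ∈ S.offDiag, if Crosses {p.1, p.2} {q.1, q.2} then 1 else 0 := by
  have h1 := two_mul_card_sym2_filter (S.powersetCard 2) crosses_symm (fun e h => by
    rcases e.eq_empty_or_nonempty with rfl | ⟨a, ha⟩
    · obtain ⟨x, hx, -⟩ := h
      have : x ∈ ({x} : Set Point) := rfl
      rw [← hx] at this
      simp at this
    · exact not_crosses_of_mem ha ha h)
  have h2 : ∑ p ∈ S.offDiag, ∑ q ∈ S.offDiag,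
      (if Crosses {p.1, p.2} {q.1, q.2} then 1 else 0) =
      4 * ∑ e ∈ S.powersetCard 2, ∑ f ∈ S.powersetCard 2, if Crosses e f then 1 else 0 := by
    rw [sum_offDiag_pair S (fun e => ∑ q ∈ S.offDiag, if Crosses e {q.1, q.2} then 1 else 0)]
    simp only [fun e => sum_offDiag_pair S (fun f => if Crosses e f then 1 else 0)]
    rw [← Finset.mul_sum]; ring
  rw [h2, ← h1]
  unfold crossingNumber
  ring

open Classical in
/-- The indicator of `Separates`. -/
noncomputable def sepInd (a b c d : Point) : ℝ := if Separates a b c d then 1 else 0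

theorem sepInd_of_eq₁₂ (a c d : Point) : sepInd a a c d = 0 := by
  simp [sepInd, Separates, det_self]
theorem sepInd_of_eq₁₃ (a b d : Point) : sepInd a b a d = 0 := by
  simp [sepInd, Separates, det_self_left]
theorem sepInd_of_eq₁₄ (a b c : Point) : sepInd a b c a = 0 := by
  simp [sepInd, Separates, det_self_left]
theorem sepInd_of_eq₂₃ (a b d : Point) : sepInd a b b d = 0 := by
  simp [sepInd, Separates, det_self_right]
theorem sepInd_of_eq₂₄ (a b c : Point) : sepInd a b c b = 0 := by
  simp [sepInd, Separates, det_self_right]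
theorem sepInd_of_eq₃₄ (a b c : Point) : sepInd a b c c = 0 := by
  simp [sepInd, Separates, (mul_self_nonneg (det a b c)).not_gt]

/-- A check of the signs of the four triples. With a repeated point every indicator vanishes, so
quadruples may afterwards be summed without restriction. -/
theorem sum_sepInd {P : Set Point} (hP : InGeneralPosition P) {a b c d : Point}
    (ha : a ∈ P) (hb : b ∈ P) (hc : c ∈ P) (hd : d ∈ P) :
    sepInd a b c d + sepInd c d a b + sepInd a c b d + sepInd b d a c + sepInd a d b c +
      sepInd b c a d + sepInd a b c d * sepInd c d a b + sepInd a c b d * sepInd b d a c +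
      sepInd a d b c * sepInd b c a d =
      if a ≠ b ∧ a ≠ c ∧ a ≠ d ∧ b ≠ c ∧ b ≠ d ∧ c ≠ d then 3 else 0 := by
  split_ifs with h
  · obtain ⟨h1, h2, h3, h4, h5, h6⟩ := h
    have s1 := hP.det_ne_zero ha hb hc h1 h2 h4
    have s2 := hP.det_ne_zero ha hb hd h1 h3 h5
    have s3 := hP.det_ne_zero ha hc hd h2 h3 h6
    have s4 := hP.det_ne_zero hb hc hd h4 h5 h6
    -- The relation between the four determinants excludes the two of the sixteen sign patterns that
    -- no quadruple realises.
    have e : det b c d - det a c d + det a b d - det a b c = 0 := by unfold det; ring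
    have e1 : det c d a = det a c d := by unfold det; ring
    have e2 : det c d b = det b c d := by unfold det; ring
    have e3 : det a c b = -det a b c := by unfold det; ring
    have e4 : det b d a = det a b d := by unfold det; ring
    have e5 : det b d c = -det b c d := by unfold det; ring
    have e6 : det a d b = -det a b d := by unfold det; ring
    have e7 : det a d c = -det a c d := by unfold det; ring
    have e8 : det b c a = det a b c := by unfold det; ring
    unfold sepInd Separates
    rw [e1, e2, e3, e4, e5, e6, e7, e8]
    rcases lt_or_gt_of_ne s1 with s1 | s1 <;> rcases lt_or_gt_of_ne s2 with s2 | s2 <;>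
      rcases lt_or_gt_of_ne s3 with s3 | s3 <;> rcases lt_or_gt_of_ne s4 with s4 | s4 <;>
      first
        | (exfalso; linarith)
        | (simp only [mul_neg_iff, s1, s2, s3, s4, s1.not_gt, s2.not_gt, s3.not_gt, s4.not_gt,
            neg_pos, neg_lt_zero]; norm_num)
  · have : a = b ∨ a = c ∨ a = d ∨ b = c ∨ b = d ∨ c = d := by tauto
    rcases this with rfl | rfl | rfl | rfl | rfl | rfl <;>
      simp only [sepInd_of_eq₁₂, sepInd_of_eq₁₃, sepInd_of_eq₁₄, sepInd_of_eq₂₃, sepInd_of_eq₂₄,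
        sepInd_of_eq₃₄, mul_zero, add_zero]

theorem sum_distinct_quadruples {α : Type*} [DecidableEq α] (S : Finset α) :
    ∑ a ∈ S, ∑ b ∈ S, ∑ c ∈ S, ∑ d ∈ S,
      (if a ≠ b ∧ a ≠ c ∧ a ≠ d ∧ b ≠ c ∧ b ≠ d ∧ c ≠ d then (3 : ℝ) else 0) =
      3 * (S.card * (S.card - 1) * (S.card - 2) * (S.card - 3)) := by
  have hd : ∀ a ∈ S, ∀ b ∈ S, ∀ c ∈ S, ∑ d ∈ S,
      (if a ≠ b ∧ a ≠ c ∧ a ≠ d ∧ b ≠ c ∧ b ≠ d ∧ c ≠ d then (3 : ℝ) else 0) =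
      if a ≠ b ∧ a ≠ c ∧ b ≠ c then 3 * ((S.card : ℝ) - 3) else 0 := by
    intro a ha b hb c hc
    split_ifs with h
    · have : ∀ d ∈ S, (if a ≠ b ∧ a ≠ c ∧ a ≠ d ∧ b ≠ c ∧ b ≠ d ∧ c ≠ d then (3 : ℝ) else 0) =
          3 - (if a = d then 3 else 0) - (if b = d then 3 else 0) - (if c = d then 3 else 0) := by
        intro d _
        by_cases h1 : a = d
        · subst h1; simp [h.1.symm, h.2.1.symm]
        by_cases h2 : b = d
        · subst h2; simp [h.1, h.2.2.symm]
        by_cases h3 : c = d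
        · subst h3; simp [h.2.1, h.2.2]
        simp [h, h1, h2, h3]
      rw [Finset.sum_congr rfl this]
      simp only [Finset.sum_sub_distrib, Finset.sum_const, Finset.sum_ite_eq, ha, hb, hc, if_true,
        nsmul_eq_mul]
      ring
    · refine Finset.sum_eq_zero fun d _ => if_neg fun h' => h ⟨h'.1, h'.2.1, h'.2.2.2.1⟩
  have hc : ∀ a ∈ S, ∀ b ∈ S, ∑ c ∈ S,
      (if a ≠ b ∧ a ≠ c ∧ b ≠ c then 3 * ((S.card : ℝ) - 3) else 0) =
      if a ≠ b then 3 * ((S.card : ℝ) - 3) * (S.card - 2) else 0 := by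
    intro a ha b hb
    split_ifs with h
    · have : ∀ c ∈ S, (if a ≠ b ∧ a ≠ c ∧ b ≠ c then 3 * ((S.card : ℝ) - 3) else 0) =
          3 * ((S.card : ℝ) - 3) - (if a = c then 3 * ((S.card : ℝ) - 3) else 0) -
            (if b = c then 3 * ((S.card : ℝ) - 3) else 0) := by
        intro d _
        by_cases h1 : a = d
        · subst h1; simp [Ne.symm h]
        by_cases h2 : b = d
        · subst h2; simp [h]
        simp [h, h1, h2]
      rw [Finset.sum_congr rfl this]
      simp only [Finset.sum_sub_distrib, Finset.sum_const, Finset.sum_ite_eq, ha, hb, if_true,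
        nsmul_eq_mul]
      ring
    · refine Finset.sum_eq_zero fun d _ => if_neg fun h' => h h'.1
  have hb : ∀ a ∈ S, ∑ b ∈ S, (if a ≠ b then 3 * ((S.card : ℝ) - 3) * (S.card - 2) else 0) =
      3 * ((S.card : ℝ) - 3) * (S.card - 2) * (S.card - 1) := by
    intro a ha
    rw [← Finset.sum_filter, Finset.sum_const, Finset.filter_ne, Finset.card_erase_of_mem ha,
      nsmul_eq_mul, Nat.cast_sub (Finset.card_pos.2 ⟨a, ha⟩)]
    push_cast
    ring
  rw [Finset.sum_congr rfl fun a ha => Finset.sum_congr rfl fun b hb => Finset.sum_congr rfl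
    (hd a ha b hb)]
  rw [Finset.sum_congr rfl fun a ha => Finset.sum_congr rfl (hc a ha)]
  rw [Finset.sum_congr rfl hb, Finset.sum_const, nsmul_eq_mul]
  ring

/-- The number of points of `S` to the left of the directed line `a b`. -/
noncomputable def leftCount (S : Finset Point) (a b : Point) : ℝ :=
  ∑ c ∈ S, if 0 < det a b c then 1 else 0

/-- The number of points of `S` to the right of the directed line `a b`. -/
noncomputable def rightCount (S : Finset Point) (a b : Point) : ℝ :=
  ∑ c ∈ S, if det a b c < 0 then 1 else 0

/-- A separated ordered pair takes one point from each side, in one of two orders. -/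
theorem sum_sepInd_eq (S : Finset Point) (a b : Point) :
    ∑ c ∈ S, ∑ d ∈ S, sepInd a b c d = 2 * (leftCount S a b * rightCount S a b) := by
  have h : ∀ c d, sepInd a b c d =
      (if 0 < det a b c then 1 else 0) * (if det a b d < 0 then 1 else 0) +
      (if det a b c < 0 then 1 else 0) * (if 0 < det a b d then 1 else 0) := by
    intro c d
    unfold sepInd Separates
    rcases lt_trichotomy (det a b c) 0 with h1 | h1 | h1 <;>
      rcases lt_trichotomy (det a b d) 0 with h2 | h2 | h2 <;>
      simp [h1, h2, mul_neg_iff, h1.not_gt, h2.not_gt]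
  unfold leftCount rightCount
  simp only [h, Finset.sum_add_distrib, ← Finset.mul_sum, ← Finset.sum_mul]
  ring

/-- Summing `sum_sepInd` over ordered quadruples gives six copies of the separation sum and three
copies of the sum of products. By `sum_sepInd_eq` and `eight_mul_crossingNumber` these are `12`
times the side-product sum and `24` times the crossing number; dividing by 3 gives the formula. -/
theorem crossingNumber_formula {S : Finset Point} (hS : InGeneralPosition (S : Set Point)) :
    8 * (crossingNumber S : ℝ) + 4 * ∑ a ∈ S, ∑ b ∈ S, leftCount S a b * rightCount S a b =
      S.card * (S.card - 1) * (S.card - 2) * (S.card - 3) := by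
  classical
  have hX : 8 * (crossingNumber S : ℝ) =
      ∑ a ∈ S, ∑ b ∈ S, ∑ c ∈ S, ∑ d ∈ S, sepInd a b c d * sepInd c d a b := by
    have := eight_mul_crossingNumber S
    have h8 : 8 * (crossingNumber S : ℝ) = ((8 * crossingNumber S : ℕ) : ℝ) := by push_cast; rfl
    rw [h8, this, Nat.cast_sum, ← sum_offDiag_of_diag_eq_zero (f := fun p : Point × Point =>
      ∑ c ∈ S, ∑ d ∈ S, sepInd p.1 p.2 c d * sepInd c d p.1 p.2)]
    · refine Finset.sum_congr rfl fun p hp => ?_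
      rw [Nat.cast_sum, ← sum_offDiag_of_diag_eq_zero (f := fun q : Point × Point =>
        sepInd p.1 p.2 q.1 q.2 * sepInd q.1 q.2 p.1 p.2)]
      · refine Finset.sum_congr rfl fun q hq => ?_
        obtain ⟨a, b⟩ := p
        obtain ⟨c, d⟩ := q
        rw [Finset.mem_offDiag] at hp hq
        obtain ⟨ha, hb, hab⟩ := hp
        obtain ⟨hc, hd, hcd⟩ := hq
        dsimp only at *
        by_cases h1 : a = c
        · subst h1
          rw [if_neg (not_crosses_of_mem (a := a) (by simp) (by simp))]
          simp [sepInd_of_eq₁₃]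
        by_cases h2 : a = d
        · subst h2
          rw [if_neg (not_crosses_of_mem (a := a) (by simp) (by simp))]
          simp [sepInd_of_eq₁₄]
        by_cases h3 : b = c
        · subst h3
          rw [if_neg (not_crosses_of_mem (a := b) (by simp) (by simp))]
          simp [sepInd_of_eq₂₃]
        by_cases h4 : b = d
        · subst h4
          rw [if_neg (not_crosses_of_mem (a := b) (by simp) (by simp))]
          simp [sepInd_of_eq₂₄]
        rw [Nat.cast_ite]
        simp only [crosses_pair_iff (hS.det_ne_zero ha hb hc hab h1 h3)
          (hS.det_ne_zero ha hb hd hab h2 h4)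
          (hS.det_ne_zero hc hd ha hcd (Ne.symm h1) (Ne.symm h2))
          (hS.det_ne_zero hc hd hb hcd (Ne.symm h3) (Ne.symm h4)), sepInd]
        by_cases hx : Separates a b c d <;> by_cases hy : Separates c d a b <;> simp [hx, hy]
      · intro c _
        simp [sepInd_of_eq₁₂]
    · intro a _
      simp [sepInd_of_eq₁₂]
  have hY : ∑ a ∈ S, ∑ b ∈ S, ∑ c ∈ S, ∑ d ∈ S, sepInd a b c d =
      2 * ∑ a ∈ S, ∑ b ∈ S, leftCount S a b * rightCount S a b := by
    simp only [sum_sepInd_eq, Finset.mul_sum]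
  have hZ := sum_distinct_quadruples S
  rw [← Finset.sum_congr rfl fun a ha => Finset.sum_congr rfl fun b hb => Finset.sum_congr rfl
    fun c hc => Finset.sum_congr rfl fun d hd => sum_sepInd hS ha hb hc hd] at hZ
  simp only [Finset.sum_add_distrib] at hZ
  -- The nine sums differ only by the names of the summation variables; these permutations bring
  -- them to two normal forms.
  have swap : ∀ f : Point → Point → Point → Point → ℝ,
      ∑ a ∈ S, ∑ b ∈ S, ∑ c ∈ S, ∑ d ∈ S, f a c b d =
      ∑ a ∈ S, ∑ b ∈ S, ∑ c ∈ S, ∑ d ∈ S, f a b c d := fun f =>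
    Finset.sum_congr rfl fun a _ => Finset.sum_comm
  have swap12 : ∀ f : Point → Point → Point → Point → ℝ,
      ∑ a ∈ S, ∑ b ∈ S, ∑ c ∈ S, ∑ d ∈ S, f b a c d =
      ∑ a ∈ S, ∑ b ∈ S, ∑ c ∈ S, ∑ d ∈ S, f a b c d := fun f => Finset.sum_comm
  have swap34 : ∀ f : Point → Point → Point → Point → ℝ,
      ∑ a ∈ S, ∑ b ∈ S, ∑ c ∈ S, ∑ d ∈ S, f a b d c =
      ∑ a ∈ S, ∑ b ∈ S, ∑ c ∈ S, ∑ d ∈ S, f a b c d := fun f =>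
    Finset.sum_congr rfl fun a _ => Finset.sum_congr rfl fun b _ => Finset.sum_comm
  have cyc : ∀ f : Point → Point → Point → Point → ℝ,
      ∑ a ∈ S, ∑ b ∈ S, ∑ c ∈ S, ∑ d ∈ S, f a d b c =
      ∑ a ∈ S, ∑ b ∈ S, ∑ c ∈ S, ∑ d ∈ S, f a b c d := fun f =>
    (swap34 fun a b c d => f a c b d).trans (swap f)
  have rev : ∀ f : Point → Point → Point → Point → ℝ,
      ∑ a ∈ S, ∑ b ∈ S, ∑ c ∈ S, ∑ d ∈ S, f c d a b =
      ∑ a ∈ S, ∑ b ∈ S, ∑ c ∈ S, ∑ d ∈ S, f a b c d := fun f => by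
    rw [← swap f, ← swap12 fun a b c d => f a c b d, ← swap34 fun a b c d => f b c a d]
    exact swap fun a b c d => f b d a c
  have t2 := rev fun a b c d => sepInd a b c d
  have t3 := swap fun a b c d => sepInd a b c d
  have t4 := swap fun a b c d => sepInd c d a b
  have t5 := cyc fun a b c d => sepInd a b c d
  have t6 := cyc fun a b c d => sepInd c d a b
  have t7 := swap fun a b c d => sepInd a b c d * sepInd c d a b
  have t8 := cyc fun a b c d => sepInd a b c d * sepInd c d a b
  rw [t4, t6, t3, t5, t7, t8, t2, hY, ← hX] at hZ
  linarith

/-! ### The effect of adding one point -/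

theorem leftCount_insert {T : Finset Point} {q : Point} (hq : q ∉ T) (a b : Point) :
    leftCount (insert q T) a b = (if 0 < det a b q then 1 else 0) + leftCount T a b := by
  unfold leftCount; rw [Finset.sum_insert hq]

theorem rightCount_insert {T : Finset Point} {q : Point} (hq : q ∉ T) (a b : Point) :
    rightCount (insert q T) a b = (if det a b q < 0 then 1 else 0) + rightCount T a b := by
  unfold rightCount; rw [Finset.sum_insert hq]

theorem leftCount_swap (T : Finset Point) (a b : Point) : leftCount T b a = rightCount T a b := by
  unfold leftCount rightCount; simp only [det_swap a b, neg_pos]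

theorem rightCount_swap (T : Finset Point) (a b : Point) : rightCount T b a = leftCount T a b := by
  rw [leftCount_swap]

/-- The sum over all lines through two points of `T` of the number of points of `T` on the side not
containing `q`. -/
noncomputable def oppositeCount (T : Finset Point) (q : Point) : ℝ :=
  ∑ a ∈ T, ∑ b ∈ T, ((if 0 < det a b q then rightCount T a b else 0) +
    (if det a b q < 0 then leftCount T a b else 0))

/-- A point `q` off the line `a b` raises one of the two factors by 1, so the product grows by the
other factor, the count on the side without `q`. The new pairs `(q, b)` and `(b, q)` have equal
products, hence the factor 2. -/
theorem sum_counts_insert {T : Finset Point} {q : Point} (hq : q ∉ T) :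
    ∑ a ∈ insert q T, ∑ b ∈ insert q T,
      leftCount (insert q T) a b * rightCount (insert q T) a b =
    ∑ a ∈ T, ∑ b ∈ T, leftCount T a b * rightCount T a b + oppositeCount T q +
      2 * ∑ b ∈ T, leftCount T q b * rightCount T q b := by
  have h0 : leftCount (insert q T) q q * rightCount (insert q T) q q = 0 := by
    simp [leftCount, det_self]
  have h1 : ∀ b, leftCount (insert q T) q b * rightCount (insert q T) q b =
      leftCount T q b * rightCount T q b := fun b => by
    rw [leftCount_insert hq, rightCount_insert hq, det_self_left]; simp
  have h2 : ∀ b, leftCount (insert q T) b q * rightCount (insert q T) b q =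
      leftCount T q b * rightCount T q b := fun b => by
    rw [leftCount_swap _ q b, rightCount_swap _ q b, mul_comm, h1]
  have h3 : ∀ a b, leftCount (insert q T) a b * rightCount (insert q T) a b =
      leftCount T a b * rightCount T a b + ((if 0 < det a b q then rightCount T a b else 0) +
      (if det a b q < 0 then leftCount T a b else 0)) := fun a b => by
    rw [leftCount_insert hq, rightCount_insert hq]
    rcases lt_trichotomy (det a b q) 0 with h | h | h
    · simp [h, h.not_gt]; ring
    · simp [h]
    · simp [h, h.not_gt]; ring
  rw [Finset.sum_insert hq, Finset.sum_insert hq, h0]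
  simp only [Finset.sum_insert hq, Finset.sum_add_distrib, oppositeCount]
  simp only [h1, h2]
  simp only [h3, Finset.sum_add_distrib]
  ring

/-! ### Line arrangements and the walk around the cells met by a new line -/

/-- Lines `1, …, N` ordered by increasing slope, no three of them concurrent. The number `x i j` is
the abscissa of the intersection of the lines `i` and `j`, and `x i 0` is a common lower bound for
these abscissae. -/
structure Arrangement (N : ℕ) where
  L : ℕ → ℝ → ℝ
  x : ℕ → ℕ → ℝ
  bot : ℝ
  x_zero : ∀ i, x i 0 = bot
  x_comm : ∀ i j, 1 ≤ i → 1 ≤ j → x i j = x j i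
  bot_lt : ∀ i j, 1 ≤ i → i ≤ N → 1 ≤ j → j ≤ N → i ≠ j → bot < x i j
  lt_iff : ∀ i j t, 1 ≤ i → i < j → j ≤ N → (L i t < L j t ↔ x i j < t)
  eq_iff : ∀ i j t, 1 ≤ i → i < j → j ≤ N → (L i t = L j t ↔ x i j = t)
  x_ne : ∀ i j k, 1 ≤ i → i ≤ N → 1 ≤ j → j ≤ N → 1 ≤ k → k ≤ N → i ≠ j → i ≠ k → j ≠ k →
    x i j ≠ x i k

namespace Arrangement

variable {N : ℕ} (R : Arrangement N)

theorem x_inj {i j k : ℕ} (hi : 1 ≤ i) (hiN : i ≤ N) (hj : j ≤ N) (hk : k ≤ N) (hij : i ≠ j)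
    (hik : i ≠ k) (h : R.x i j = R.x i k) : j = k := by
  by_contra hne
  rcases Nat.eq_zero_or_pos j with rfl | hj0
  · have := R.bot_lt i k hi hiN (by omega) hk hik
    rw [R.x_zero] at h; linarith
  rcases Nat.eq_zero_or_pos k with rfl | hk0
  · have := R.bot_lt i j hi hiN (by omega) hj hij
    rw [R.x_zero] at h; linarith
  exact R.x_ne i j k hi hiN hj0 hj hk0 hk hij hik hne h

theorem gt_iff {i j : ℕ} {t : ℝ} (hi : 1 ≤ i) (hij : i < j) (hj : j ≤ N) :
    R.L j t < R.L i t ↔ t < R.x i j := by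
  have h1 := R.lt_iff i j t hi hij hj
  have h2 := R.eq_iff i j t hi hij hj
  constructor
  · intro h
    rcases lt_trichotomy t (R.x i j) with h' | h' | h'
    · exact h'
    · exact absurd (h2.2 h'.symm) h.ne'
    · exact absurd (h1.2 h') h.not_gt
  · intro h
    rcases lt_trichotomy (R.L j t) (R.L i t) with h' | h' | h'
    · exact h'
    · exact absurd (h2.1 h'.symm) h.ne'
    · exact absurd (h1.1 h') h.not_gt

/-- The crossings of three lines are ordered in one of two ways. -/
theorem x_triple {i j k : ℕ} (hi : 1 ≤ i) (hij : i < j) (hjk : j < k) (hk : k ≤ N) :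
    (R.x i j < R.x i k ∧ R.x i k < R.x j k) ∨ (R.x j k < R.x i k ∧ R.x i k < R.x i j) := by
  -- The order is decided where `i` and `k` meet: line `j` passes either above or below that point.
  have e1 := (R.eq_iff i k (R.x i k) hi (hij.trans hjk) hk).2 rfl
  have n1 := R.x_ne i j k hi (by omega) (by omega) (by omega) (by omega) hk (by omega) (by omega)
    (by omega)
  have n2 := R.x_ne k i j (by omega) hk hi (by omega) (by omega) (by omega) (by omega) (by omega)
    (by omega)
  rw [R.x_comm k i (by omega) hi, R.x_comm k j (by omega) (by omega)] at n2
  rcases lt_or_gt_of_ne n1 with h | h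
  · left
    refine ⟨h, ?_⟩
    have h1 := (R.lt_iff i j _ hi hij (by omega)).2 h
    rw [e1] at h1
    exact (R.gt_iff (by omega) hjk hk).1 h1
  · right
    refine ⟨?_, h⟩
    have h1 := (R.gt_iff hi hij (by omega)).2 h
    rw [e1] at h1
    exact (R.lt_iff j k _ (by omega) hjk hk).1 h1

/-- The vertex `(c, d)` (at the far left of the line `c` if `d = 0`) lies on the boundary of the
cell that the line `k` traverses after having crossed the lines in `A`, to the left of the line `k`.
A walker at this vertex is about to go to the right on the line `c`, which bounds the cell from
above, or, if `left` holds, has arrived by going to the left on the line `c`, which bounds the cell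
from below. -/
structure Walk (k : ℕ) (A : Finset ℕ) (left : Prop) (c d : ℕ) : Prop where
  mem_range : ∀ a ∈ A, 1 ≤ a ∧ a < k
  before : ∀ a ∈ A, ∀ b, 1 ≤ b → b < k → b ∉ A → R.x a k < R.x b k
  one_le : 1 ≤ c
  c_lt : c < k
  d_lt : d < k
  ne : c ≠ d
  x_lt : R.x c d < R.x c k
  above : ∀ a ∈ A, R.L a (R.x c d) ≤ R.L c (R.x c d)
  below : ∀ b, 1 ≤ b → b < k → b ∉ A → R.L c (R.x c d) ≤ R.L b (R.x c d)
  -- Crossed lines are floors and uncrossed ones ceilings. Slopes increase to the right along a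
  -- floor and decrease along a ceiling, and at the leftmost vertex of a cell the ceiling is steeper
  -- than the floor. In each case the crossed neighbour `d` is the less steep one.
  side : d ≠ 0 → (d ∈ A ↔ d < c)
  left_iff : left ↔ c ∈ A

variable {R} {k : ℕ} {A : Finset ℕ} {c d e : ℕ}

/-- This identifies the next line to be crossed. For `b` steeper than `c`, lying above `c` at the
current vertex forces `b` to meet `c` no later than there. For `b` less steep, meeting `c` that
early would put `b` below `c`, or make it `d`, against `side`; so `b` meets `c` only after `k`. In
both cases `x_triple` gives the order on `k`. -/
theorem Walk.lt_of_notMem (hk : k ≤ N) (h : R.Walk k A False c d)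
    (he : ∀ j < k, j ≠ c → R.x c j ≤ R.x c d ∨ R.x c k < R.x c j) {b : ℕ} (hb1 : 1 ≤ b) (hbk : b < k)
    (hb : b ∉ A) (hbc : b ≠ c) : R.x c k < R.x b k := by
  have hc := h.c_lt
  have hc1 := h.one_le
  have hbel := h.below b hb1 hbk hb
  have hx := h.x_lt
  rcases lt_or_gt_of_ne hbc with hlt | hlt
  · rcases R.x_triple hb1 hlt hc hk with ⟨t1, t2⟩ | ⟨t1, t2⟩
    · exfalso
      have h3 := R.x_comm b c hb1 hc1
      rcases he b hbk hbc with h1 | h1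
      · rcases h1.eq_or_lt with h2 | h2
        · have := R.x_inj hc1 (by omega) (by omega) (by have := h.d_lt; omega) hbc.symm h.ne h2
          subst this
          exact hb ((h.side (by omega)).2 hlt)
        · have := (R.lt_iff b c (R.x c d) hb1 hlt (by omega)).2 (by linarith)
          linarith
      · linarith
    · linarith
  · have h4 : ¬ R.x c d < R.x c b := fun h5 => by
      have := (R.gt_iff hc1 hlt (by omega)).2 h5
      linarith
    rcases R.x_triple hc1 hlt hbk hk with ⟨t1, t2⟩ | ⟨t1, t2⟩
    · exact t2
    · linarith

/-- The walker stays at the same vertex but changes sides: the ceiling `c` of the old cell is the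
floor of the new one. -/
theorem Walk.cross (hk : k ≤ N) (h : R.Walk k A False c d)
    (he : ∀ j < k, j ≠ c → R.x c j ≤ R.x c d ∨ R.x c k < R.x c j) :
    R.Walk k (insert c A) True c d := by
  have hcA : c ∉ A := fun hc => h.left_iff.2 hc
  refine ⟨?_, ?_, h.one_le, h.c_lt, h.d_lt, h.ne, h.x_lt, ?_, ?_, ?_, by simp⟩
  · intro a ha
    rcases Finset.mem_insert.1 ha with rfl | ha
    exacts [⟨h.one_le, h.c_lt⟩, h.mem_range a ha]
  · intro a ha b hb1 hbk hb
    rw [Finset.mem_insert, not_or] at hb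
    rcases Finset.mem_insert.1 ha with rfl | ha
    · exact h.lt_of_notMem hk he hb1 hbk hb.2 hb.1
    · exact h.before a ha b hb1 hbk hb.2
  · intro a ha
    rcases Finset.mem_insert.1 ha with rfl | ha
    exacts [le_rfl, h.above a ha]
  · intro b hb1 hbk hb
    rw [Finset.mem_insert, not_or] at hb
    exact h.below b hb1 hbk hb.2
  · intro hd
    rw [Finset.mem_insert, ← h.side hd]
    exact ⟨fun h' => h'.resolve_left h.ne.symm, Or.inr⟩

/-- A line in `A` lies below the ceiling and meets `k` before `c` does, so it cannot reach the
ceiling to the left of `k`. Hence the next line `e` met on the ceiling is uncrossed, and it comes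
down from above `c`, so it is less steep. -/
theorem Walk.ceiling (hk : k ≤ N) (h : R.Walk k A False c d) (he0 : e ≠ 0) (hek : e < k)
    (hec : e ≠ c) (hde : R.x c d < R.x c e) (hbet : ∀ j < k, j ≠ c → R.x c j ≤ R.x c d ∨
      R.x c e ≤ R.x c j) (hlt : R.x c e < R.x c k) : e < c ∧ R.Walk k A False e c := by
  have hcA : c ∉ A := fun hc => h.left_iff.2 hc
  have hc := h.c_lt
  have hc1 := h.one_le
  have hd := h.d_lt
  have hed : e ≠ d := by rintro rfl; exact lt_irrefl _ hde
  have heA : e ∉ A := by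
    intro heA
    have h1 := h.above e heA
    have h2 := h.before e heA c hc1 hc hcA
    rcases lt_or_gt_of_ne hec with h3 | h3
    · have h4 := R.x_comm e c (by omega) hc1
      have : ¬ R.x c d < R.x e c := fun h5 => by
        have := (R.gt_iff (by omega) h3 (by omega)).2 h5; linarith
      linarith
    · rcases R.x_triple hc1 h3 hek hk with ⟨t1, t2⟩ | ⟨t1, t2⟩ <;> linarith
  have hlt' : e < c := by
    by_contra h3
    have h3 : c < e := by omega
    have := (R.gt_iff hc1 h3 (by omega)).2 hde
    have := h.below e (by omega) hek heA
    linarith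
  have hcomm := R.x_comm e c (by omega) hc1
  have hEq := (R.eq_iff e c _ (by omega) hlt' (by omega)).2 hcomm
  refine ⟨hlt', ⟨h.mem_range, h.before, by omega, hek, hc, hec, ?_, ?_, ?_, ?_, ?_⟩⟩
  · rcases R.x_triple (by omega) hlt' hc hk with ⟨t1, t2⟩ | ⟨t1, t2⟩ <;> linarith
  · intro a ha
    rw [hcomm, hEq]
    obtain ⟨ha1, hak⟩ := h.mem_range a ha
    have h1 := h.above a ha
    have h2 := h.before a ha c hc1 hc hcA
    have hac : a ≠ c := by rintro rfl; exact hcA ha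
    by_contra hcon
    rw [not_le] at hcon
    rcases lt_or_gt_of_ne hac with h3 | h3
    · have h5 := (R.gt_iff ha1 h3 (by omega)).1 hcon
      have := (R.gt_iff ha1 h3 (by omega)).2 (hde.trans h5)
      linarith
    · have h5 := (R.lt_iff c a _ hc1 h3 (by omega)).1 hcon
      rcases R.x_triple hc1 h3 hak hk with ⟨t1, t2⟩ | ⟨t1, t2⟩ <;> linarith
  · intro b hb1 hbk hb
    rw [hcomm, hEq]
    have h1 := h.below b hb1 hbk hb
    by_cases hbc : b = c
    · rw [hbc]
    by_contra hcon
    rw [not_le] at hcon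
    rcases lt_or_gt_of_ne hbc with h3 | h3
    · have h5 := (R.lt_iff b c _ hb1 h3 (by omega)).1 hcon
      have h6 := R.x_comm b c hb1 hc1
      rcases hbet b hbk hbc with h7 | h7
      · rcases h7.eq_or_lt with h8 | h8
        · have := R.x_inj hc1 (by omega) (by omega) (by omega) (Ne.symm hbc) h.ne h8
          subst this
          exact hb ((h.side (by omega)).2 h3)
        · have := (R.lt_iff b c (R.x c d) hb1 h3 (by omega)).2 (by linarith)
          linarith
      · linarith
    · have h5 := (R.gt_iff hc1 h3 (by omega)).1 hcon
      have := (R.gt_iff hc1 h3 (by omega)).2 (hde.trans h5)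
      linarith
  · intro _
    exact iff_of_false hcA (by omega)
  · exact iff_of_false id heA

/-- The cell is unbounded to the left. Far left the lines lie in decreasing order of slope from
bottom to top, so the crossed lines are those from `c` on, and the ceiling directly above `c` is `c
- 1`. -/
theorem Walk.bottom (hk : k ≤ N) (h : R.Walk k A True c 0) (hA : A.card + 1 < k) :
    R.Walk k A False (c - 1) 0 := by
  have hcA := h.left_iff.1 trivial
  have hc := h.c_lt
  have hc1 := h.one_le
  have hA' : ∀ a ∈ A, c ≤ a := by
    intro a ha
    obtain ⟨h1, h2⟩ := h.mem_range a ha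
    by_contra h3
    have h4 := h.above a ha
    have := (R.gt_iff (t := R.x c 0) h1 (not_le.1 h3) (by omega)).2 (by
      rw [R.x_zero]; exact R.bot_lt _ _ h1 (by omega) hc1 (by omega) (by omega))
    linarith
  have hB' : ∀ b, 1 ≤ b → b < k → b ∉ A → b < c := by
    intro b hb1 hbk hb
    by_contra h3
    have hbc : c ≠ b := by rintro rfl; exact hb hcA
    have h4 := h.below b hb1 hbk hb
    have := (R.gt_iff (t := R.x c 0) hc1 (show c < b by omega) (by omega)).2 (by
      rw [R.x_zero]; exact R.bot_lt _ _ hc1 (by omega) hb1 (by omega) (by omega))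
    linarith
  -- If `c` were 1, every earlier line would already be crossed, against `hA`.
  have hc2 : 2 ≤ c := by
    by_contra h3
    have : Finset.Ico 1 k ⊆ A := by
      intro b hb
      rw [Finset.mem_Ico] at hb
      by_contra h4
      have := hB' b hb.1 hb.2 h4
      omega
    have := Finset.card_le_card this
    rw [Nat.card_Ico] at this
    omega
  have hbot : ∀ i j, 1 ≤ i → i < j → j < k → ∀ l, R.L j (R.x l 0) < R.L i (R.x l 0) := by
    intro i j hi hij hj l
    refine (R.gt_iff hi hij (by omega)).2 ?_
    rw [R.x_zero]
    exact R.bot_lt i j hi (by omega) (by omega) (by omega) (by omega)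
  refine ⟨h.mem_range, h.before, by omega, by omega, by omega, by omega, ?_, ?_, ?_, by simp, ?_⟩
  · rw [R.x_zero]; exact R.bot_lt _ _ (by omega) (by omega) (by omega) hk (by omega)
  · intro a ha
    have := hA' a ha
    exact (hbot (c - 1) a (by omega) (by omega) (h.mem_range a ha).2 _).le
  · intro b hb1 hbk hb
    have := hB' b hb1 hbk hb
    rcases Nat.eq_or_lt_of_le (show b ≤ c - 1 by omega) with h5 | h5
    · rw [h5]
    · exact (hbot b (c - 1) hb1 h5 (by omega) _).le
  · refine iff_of_false id fun hcon => ?_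
    have := hA' _ hcon
    omega

/-- By `side` the steeper line `d` is uncrossed, so this vertex is the leftmost one of the cell and
the ceiling starts on `d`. -/
theorem Walk.turn (hk : k ≤ N) (h : R.Walk k A True c d) (hcd : c < d) : R.Walk k A False d c := by
  have hcA := h.left_iff.1 trivial
  have hc1 := h.one_le
  have hd := h.d_lt
  have hcomm := R.x_comm d c (by omega) hc1
  have hEq := (R.eq_iff c d (R.x c d) hc1 hcd (by omega)).2 rfl
  refine ⟨h.mem_range, h.before, by omega, hd, h.c_lt, by omega, ?_, ?_, ?_, ?_, ?_⟩
  · have := h.x_lt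
    rcases R.x_triple hc1 hcd hd hk with ⟨t1, t2⟩ | ⟨t1, t2⟩ <;> linarith
  · rw [hcomm, ← hEq]; exact h.above
  · rw [hcomm, ← hEq]; exact h.below
  · intro _; exact iff_of_true hcA hcd
  · refine iff_of_false id fun hdA => ?_
    have := (h.side (by omega)).1 hdA
    omega

theorem Walk.x_lt_floor (hk : k ≤ N) (h : R.Walk k A True c d) (hd0 : d ≠ 0) (hdc : d < c) :
    R.x d c < R.x d k ∧ R.x d k < R.x c k := by
  have hc := h.c_lt
  have hx := h.x_lt
  have := R.x_comm d c (by omega) (by omega)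
  rcases R.x_triple (by omega) hdc hc hk with ⟨t1, t2⟩ | ⟨t1, t2⟩
  · exact ⟨t1, t2⟩
  · linarith

/-- By `side` the less steep line `d` is crossed, so the floor continues on it. No line meets `d`
between `e` and `c`, so no line can enter the cell there, and the cell conditions carry over from
the old vertex to the new one. -/
theorem Walk.floor (hk : k ≤ N) (h : R.Walk k A True c d) (hd0 : d ≠ 0) (hdc : d < c) (hek : e < k)
    (hed : e ≠ d) (hlt : R.x d e < R.x d c)
    (hbet : ∀ j < k, j ≠ d → R.x d j ≤ R.x d e ∨ R.x d c ≤ R.x d j) : R.Walk k A True d e := by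
  have hcA := h.left_iff.1 trivial
  have hc := h.c_lt
  have hc1 := h.one_le
  have hd := h.d_lt
  have hdA := (h.side hd0).2 hdc
  have hcomm := R.x_comm d c (by omega) hc1
  have hEq := (R.eq_iff d c (R.x c d) (by omega) hdc (by omega)).2 hcomm
  have hlt' := h.x_lt_floor hk hd0 hdc
  refine ⟨h.mem_range, h.before, by omega, hd, hek, hed.symm, by linarith, ?_, ?_, ?_,
    iff_of_true trivial hdA⟩
  · intro a ha
    obtain ⟨ha1, hak⟩ := h.mem_range a ha
    have h1 := h.above a ha
    rw [← hEq, ← hcomm] at h1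
    by_cases had : a = d
    · rw [had]
    by_contra hcon
    rw [not_le] at hcon
    rcases lt_or_gt_of_ne had with h3 | h3
    · have h5 := (R.gt_iff ha1 h3 (by omega)).1 hcon
      have h6 := R.x_comm a d ha1 (by omega)
      rcases hbet a hak had with h7 | h7
      · linarith
      · rcases h7.eq_or_lt with h8 | h8
        · have := R.x_inj (by omega) (by omega) (by omega) (by omega) (by omega) (Ne.symm had) h8
          omega
        · have := (R.gt_iff (t := R.x d c) ha1 h3 (by omega)).2 (by linarith)
          linarith
    · have h5 := (R.lt_iff d a _ (by omega) h3 (by omega)).1 hcon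
      have := (R.lt_iff d a (R.x d c) (by omega) h3 (by omega)).2 (by linarith)
      linarith
  · intro b hb1 hbk hb
    have h1 := h.below b hb1 hbk hb
    rw [← hEq, ← hcomm] at h1
    have hbd : b ≠ d := by rintro rfl; exact hb hdA
    by_contra hcon
    rw [not_le] at hcon
    rcases lt_or_gt_of_ne hbd with h3 | h3
    · have h5 := (R.lt_iff b d _ hb1 h3 (by omega)).1 hcon
      have := (R.lt_iff b d (R.x d c) hb1 h3 (by omega)).2 (by linarith)
      linarith
    · have h5 := (R.gt_iff (by omega) h3 (by omega)).1 hcon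
      rcases hbet b hbk hbd with h7 | h7
      · linarith
      · rcases h7.eq_or_lt with h8 | h8
        · have := R.x_inj (by omega) (by omega) (by omega) (by omega) (by omega) (Ne.symm hbd) h8
          subst this
          exact hb hcA
        · have := (R.gt_iff (t := R.x d c) (by omega) h3 (by omega)).2 h8
          linarith
  · intro he0
    constructor
    · intro heA
      by_contra h3
      have h3 : d < e := by omega
      have := (R.lt_iff d e (R.x d c) (by omega) h3 (by omega)).2 hlt
      have := h.above e heA
      rw [← hEq, ← hcomm] at this
      linarith
    · intro h3
      by_contra heB
      have h4 := R.x_comm e d (by omega) (by omega)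
      have := (R.lt_iff e d (R.x d c) (by omega) h3 (by omega)).2 (by linarith)
      have := h.below e (by omega) hek heB
      rw [← hEq, ← hcomm] at this
      linarith

end Arrangement

/-! ### The zone bound: every line is charged once on a floor and once on a ceiling -/

namespace Arrangement

variable {N : ℕ} (R : Arrangement N)

/-- The lines in `F` have been left by a walker going to the left on the lower boundary of a cell,
and this will not happen to them again. The walker is at abscissa `t`. -/
def FloorCharged (k : ℕ) (A : Finset ℕ) (left : Prop) (t : ℝ) (F : Finset ℕ) : Prop :=
  ∀ c ∈ F, c ∈ A ∧ ∃ d ∈ A, d < c ∧ R.x d k < R.x c k ∧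
    (∀ a, 1 ≤ a → a < c → R.x a k < R.x c k → R.x c a ≤ R.x c d) ∧
    ((∃ b ∈ A, R.L c (R.x c d) < R.L b (R.x c d)) ∨
      ((∀ b, 1 ≤ b → b < k → b ∉ A → R.L c (R.x c d) < R.L b (R.x c d)) ∧ (left → t < R.x c d)))

/-- The lines in `G` have been entered by a walker going to the right on the upper boundary of a
cell, and this will not happen to them again. The walker is at abscissa `t`. -/
def CeilingCharged (k : ℕ) (A : Finset ℕ) (left : Prop) (t : ℝ) (G : Finset ℕ) : Prop :=
  ∀ e ∈ G, 1 ≤ e ∧ e < k ∧ (e ∈ A ∨ ∃ c, e < c ∧ c < k ∧ R.x e k < R.x c k ∧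
    (∀ b, e < b → b < k → R.x e k < R.x b k → R.x e b ≤ R.x e c) ∧
    ((∃ a ∈ A, R.L e (R.x e c) < R.L a (R.x e c)) ∨
      (¬ left ∧ R.x e c ≤ t ∧
        ∀ b, 1 ≤ b → b < k → b ∉ A → b ≠ e → b ≠ c → R.L e (R.x e c) < R.L b (R.x e c))))

variable {R} {k : ℕ} {A F G : Finset ℕ} {left : Prop} {c d e : ℕ} {t t' : ℝ}

theorem FloorCharged.right (h : R.FloorCharged k A left t F) : R.FloorCharged k A False t' F := by
  intro c hc
  obtain ⟨h1, d, h2, h3, h4, h5, h6⟩ := h c hc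
  exact ⟨h1, d, h2, h3, h4, h5, h6.imp_right fun h7 => ⟨h7.1, False.elim⟩⟩

/-- All uncrossed lines were strictly above a charged vertex of the current cell. The newly crossed
line is one of them, so the vertex now lies strictly below a line in `A` and can never return to a
floor. -/
theorem FloorCharged.cross (h : R.FloorCharged k A False t F) (hc1 : 1 ≤ c) (hck : c < k)
    (hc : c ∉ A) : R.FloorCharged k (insert c A) True t' F := by
  intro f hf
  obtain ⟨h1, d, h2, h3, h4, h5, h6⟩ := h f hf
  refine ⟨Finset.mem_insert_of_mem h1, d, Finset.mem_insert_of_mem h2, h3, h4, h5, Or.inl ?_⟩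
  rcases h6 with ⟨b, hb, h6⟩ | ⟨h6, -⟩
  · exact ⟨b, Finset.mem_insert_of_mem hb, h6⟩
  · exact ⟨c, Finset.mem_insert_self _ _, h6 c hc1 hck hc⟩

/-- The vertex where the walker leaves `c` is determined by `c` and `k` alone: it is the rightmost
crossing of `c` with a less steep line that meets `k` before `c`. A second charge would occur at the
same vertex, but that vertex is either below a line in `A` or strictly to the right of the walker.
-/
theorem FloorCharged.floor (hk : k ≤ N) (hw : R.Walk k A True c d)
    (h : R.FloorCharged k A True (R.x c d) F) (hd0 : d ≠ 0) (hdc : d < c) (ht : t' < R.x c d) :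
    c ∉ F ∧ R.FloorCharged k A True t' (insert c F) := by
  have hcA := hw.left_iff.1 trivial
  have hc := hw.c_lt
  have hc1 := hw.one_le
  have hd := hw.d_lt
  have hdA := (hw.side hd0).2 hdc
  have hlt := (hw.x_lt_floor hk hd0 hdc).2
  -- Such a line `a` is crossed, hence not above the floor at this vertex; being less steep than
  -- `c`, it cannot meet `c` further right.
  have hmax : ∀ a, 1 ≤ a → a < c → R.x a k < R.x c k → R.x c a ≤ R.x c d := by
    intro a ha1 hac hax
    have haA : a ∈ A := by
      by_contra haA
      have := hw.before c hcA a ha1 (by omega) haA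
      linarith
    have h1 := hw.above a haA
    by_contra h2
    rw [R.x_comm c a hc1 ha1] at h2
    have := (R.gt_iff ha1 hac (by omega)).2 (not_le.1 h2)
    linarith
  constructor
  · intro hcF
    obtain ⟨-, d', hd'A, hd'c, hlt', hmax', hsp⟩ := h c hcF
    have hd'1 := (hw.mem_range d' hd'A).1
    have he := le_antisymm (hmax d' hd'1 hd'c hlt') (hmax' d (by omega) hdc hlt)
    have := R.x_inj hc1 (by omega) (by omega) (by omega) (by omega) (by omega) he
    subst this
    rcases hsp with ⟨b, hb, h6⟩ | ⟨-, h6⟩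
    · have := hw.above b hb
      linarith
    · exact lt_irrefl _ (h6 trivial)
  · intro f hf
    rcases Finset.mem_insert.1 hf with rfl | hf
    · refine ⟨hcA, d, hdA, hdc, hlt, hmax, Or.inr ⟨fun b hb1 hbk hb => ?_, fun _ => ht⟩⟩
      refine lt_of_le_of_ne (hw.below b hb1 hbk hb) fun heq => ?_
      have hbf : b ≠ f := by rintro rfl; exact hb hcA
      have hx : R.x f b = R.x f d := by
        rcases lt_or_gt_of_ne hbf with h1 | h1
        · rw [R.x_comm f b hc1 hb1]
          exact (R.eq_iff b f _ hb1 h1 (by omega)).1 heq.symm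
        · exact (R.eq_iff f b _ hc1 h1 (by omega)).1 heq
      have := R.x_inj hc1 (by omega) (by omega) (by omega) hbf.symm (by omega) hx
      subst this
      exact hb hdA
    · obtain ⟨h1, d', h2, h3, h4, h5, h6⟩ := h f hf
      exact ⟨h1, d', h2, h3, h4, h5, h6.imp_right fun h7 => ⟨h7.1, fun _ => ht.trans (h7.2 trivial)⟩⟩

theorem CeilingCharged.of_left (h : R.CeilingCharged k A True t G) :
    R.CeilingCharged k A left t' G := by
  intro e he
  obtain ⟨h1, h2, h3⟩ := h e he
  refine ⟨h1, h2, h3.imp_right ?_⟩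
  rintro ⟨c, h4, h5, h6, h7, h8⟩
  exact ⟨c, h4, h5, h6, h7, Or.inl (h8.resolve_right fun h => h.1 trivial)⟩

/-- For a charged line that stays uncrossed, the crossed line `c` is strictly above its entry vertex
unless it is the other line `c'` there. That is impossible, since `c` is the first remaining line on
`k` while `c'` comes after the charged one. -/
theorem CeilingCharged.cross (h : R.CeilingCharged k A False t G) (hc1 : 1 ≤ c) (hck : c < k)
    (hc : c ∉ A) (hmin : ∀ b, 1 ≤ b → b < k → b ∉ A → b ≠ c → R.x c k < R.x b k) :
    R.CeilingCharged k (insert c A) True t' G := by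
  intro e he
  obtain ⟨h1, h2, h3⟩ := h e he
  refine ⟨h1, h2, ?_⟩
  by_cases hec : e = c
  · exact Or.inl (hec ▸ Finset.mem_insert_self _ _)
  by_cases heA : e ∈ A
  · exact Or.inl (Finset.mem_insert_of_mem heA)
  obtain ⟨c', h4, h5, h6, h7, h8⟩ := h3.resolve_left heA
  refine Or.inr ⟨c', h4, h5, h6, h7, Or.inl ?_⟩
  rcases h8 with ⟨a, ha, h8⟩ | ⟨-, -, h8⟩
  · exact ⟨a, Finset.mem_insert_of_mem ha, h8⟩
  · refine ⟨c, Finset.mem_insert_self _ _, h8 c hc1 hck hc (Ne.symm hec) ?_⟩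
    rintro rfl
    have := hmin e h1 h2 heA hec
    linarith

/-- The mirror image of the floor argument. The entry vertex of `e` is the rightmost crossing of `e`
with a steeper line that meets `k` after `e`. If `e` had been charged before, that vertex would lie
below a line in `A` or not to the right of the walker's previous abscissa `t`, and `t < R.x e c`
excludes the latter. -/
theorem CeilingCharged.ceiling (hk : k ≤ N) (hw : R.Walk k A False e c) (hec : e < c)
    (h : R.CeilingCharged k A False t G) (ht : t < R.x e c) :
    e ∉ G ∧ R.CeilingCharged k A False (R.x e c) (insert e G) := by
  have heA : e ∉ A := fun he => hw.left_iff.2 he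
  have he1 := hw.one_le
  have hek := hw.c_lt
  have hck := hw.d_lt
  have hlt : R.x e k < R.x c k := by
    have hx := hw.x_lt
    rcases R.x_triple he1 hec hck hk with ⟨t1, t2⟩ | ⟨t1, t2⟩
    · exact t2
    · linarith
  have hmax : ∀ b, e < b → b < k → R.x e k < R.x b k → R.x e b ≤ R.x e c := by
    intro b heb hbk hbx
    have hb : b ∉ A := by
      intro hb
      have := hw.before b hb e he1 hek heA
      linarith
    have h1 := hw.below b (by omega) hbk hb
    by_contra h2
    have := (R.gt_iff he1 heb (by omega)).2 (not_le.1 h2)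
    linarith
  constructor
  · intro heG
    obtain ⟨-, -, h3⟩ := h e heG
    obtain ⟨c', h4, h5, h6, h7, h8⟩ := h3.resolve_left heA
    have hx := le_antisymm (hmax c' h4 h5 h6) (h7 c hec hck hlt)
    have := R.x_inj he1 (by omega) (by omega) (by omega) (by omega) (by omega) hx
    subst this
    rcases h8 with ⟨a, ha, h8⟩ | ⟨-, h8, -⟩
    · have := hw.above a ha
      linarith
    · linarith
  · intro f hf
    rcases Finset.mem_insert.1 hf with rfl | hf
    · refine ⟨he1, hek, Or.inr ⟨c, hec, hck, hlt, hmax, Or.inr ⟨id, le_rfl, ?_⟩⟩⟩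
      intro b hb1 hbk hb hbf hbc
      refine lt_of_le_of_ne (hw.below b hb1 hbk hb) fun heq => hbc ?_
      have hx : R.x f b = R.x f c := by
        rcases lt_or_gt_of_ne hbf with h1 | h1
        · rw [R.x_comm f b he1 hb1]
          exact (R.eq_iff b f _ hb1 h1 (by omega)).1 heq.symm
        · exact (R.eq_iff f b _ he1 h1 (by omega)).1 heq
      exact R.x_inj he1 (by omega) (by omega) (by omega) hbf.symm (by omega) hx
    · obtain ⟨h1, h2, h3⟩ := h f hf
      refine ⟨h1, h2, h3.imp_right ?_⟩
      rintro ⟨c', h4, h5, h6, h7, h8⟩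
      exact ⟨c', h4, h5, h6, h7, h8.imp_right fun h9 => ⟨id, h9.2.1.trans ht.le, h9.2.2⟩⟩

end Arrangement

/-! ### Sorted circular linked lists -/

/-- The functions `nx` and `pv` give the successors and predecessors in the circular list of the
elements of `V` in the order of their keys, in which the first element `0` follows the last one. -/
structure Linked (V : Set ℕ) (key : ℕ → ℝ) (nx pv : ℕ → ℕ) : Prop where
  nx_mem : ∀ j ∈ V, nx j ∈ V
  pv_mem : ∀ j ∈ V, pv j ∈ V
  pv_nx : ∀ j ∈ V, pv (nx j) = j
  nx_pv : ∀ j ∈ V, nx (pv j) = j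
  last : ∀ j ∈ V, nx j = 0 → ∀ i ∈ V, key i ≤ key j
  lt : ∀ j ∈ V, nx j ≠ 0 → key j < key (nx j)
  gap : ∀ j ∈ V, nx j ≠ 0 → ∀ i ∈ V, key i ≤ key j ∨ key (nx j) ≤ key i

namespace Linked

variable {V : Set ℕ} {key : ℕ → ℝ} {nx pv : ℕ → ℕ}

theorem singleton (key : ℕ → ℝ) : Linked {0} key (fun _ => 0) (fun _ => 0) where
  nx_mem _ _ := rfl
  pv_mem _ _ := rfl
  pv_nx _ h := Eq.symm h
  nx_pv _ h := Eq.symm h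
  last := by rintro j rfl - i rfl; exact le_rfl
  lt _ _ h := absurd rfl h
  gap _ _ h := absurd rfl h

theorem congr {nx' pv' : ℕ → ℕ} (h : Linked V key nx pv) (hn : ∀ j ∈ V, nx' j = nx j)
    (hp : ∀ j ∈ V, pv' j = pv j) : Linked V key nx' pv' where
  nx_mem j hj := by rw [hn j hj]; exact h.nx_mem j hj
  pv_mem j hj := by rw [hp j hj]; exact h.pv_mem j hj
  pv_nx j hj := by rw [hn j hj, hp _ (h.nx_mem j hj)]; exact h.pv_nx j hj
  nx_pv j hj := by rw [hp j hj, hn _ (h.pv_mem j hj)]; exact h.nx_pv j hj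
  last j hj := by rw [hn j hj]; exact h.last j hj
  lt j hj := by rw [hn j hj]; exact h.lt j hj
  gap j hj := by rw [hn j hj]; exact h.gap j hj

theorem insert (h : Linked V key nx pv) (hinj : Set.InjOn key V) {k d : ℕ} (hk : k ∉ V)
    (hk0 : k ≠ 0) (hd : d ∈ V) (hdk : key d < key k) (hke : nx d = 0 ∨ key k < key (nx d)) :
    Linked (Insert.insert k V) key (Function.update (Function.update nx d k) k (nx d))
      (Function.update (Function.update pv (nx d) k) k d) := by
  have hdk' : d ≠ k := by rintro rfl; exact hk hd
  have he := h.nx_mem d hd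
  have hek : nx d ≠ k := fun h' => hk (h' ▸ he)
  have n1 : ∀ j ∈ V, j ≠ d →
      Function.update (Function.update nx d k) k (nx d) j = nx j := fun j hj hjd => by
    have : j ≠ k := by rintro rfl; exact hk hj
    simp [this, hjd]
  have n2 : Function.update (Function.update nx d k) k (nx d) d = k := by simp [hdk']
  have n3 : Function.update (Function.update nx d k) k (nx d) k = nx d := by simp
  have p1 : ∀ j ∈ V, j ≠ nx d →
      Function.update (Function.update pv (nx d) k) k d j = pv j := fun j hj hjd => by
    have : j ≠ k := by rintro rfl; exact hk hj
    simp [this, hjd]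
  have p2 : Function.update (Function.update pv (nx d) k) k d (nx d) = k := by simp [hek]
  have p3 : Function.update (Function.update pv (nx d) k) k d k = d := by simp
  generalize Function.update (Function.update nx d k) k (nx d) = nx' at *
  generalize Function.update (Function.update pv (nx d) k) k d = pv' at *
  have hnxd : ∀ j ∈ V, j ≠ d → nx j ≠ nx d := fun j hj hjd hn => hjd (by
    rw [← h.pv_nx j hj, hn, h.pv_nx d hd])
  have hpvd : ∀ j ∈ V, j ≠ nx d → pv j ≠ d := fun j hj hjd hn => hjd (by
    rw [← h.nx_pv j hj, hn])
  have hcase : ∀ j ∈ Insert.insert k V, j = k ∨ j = d ∨ (j ∈ V ∧ j ≠ d) := by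
    rintro j (hj | hj)
    · exact Or.inl hj
    · by_cases hjd : j = d
      exacts [Or.inr (Or.inl hjd), Or.inr (Or.inr ⟨hj, hjd⟩)]
  refine ⟨?_, ?_, ?_, ?_, ?_, ?_, ?_⟩
  · intro j hj
    rcases hcase j hj with rfl | rfl | ⟨hjV, hjd⟩
    · rw [n3]; exact Or.inr he
    · rw [n2]; exact Or.inl rfl
    · rw [n1 j hjV hjd]; exact Or.inr (h.nx_mem j hjV)
  · rintro j (rfl | hj)
    · rw [p3]; exact Or.inr hd
    · by_cases hjd : j = nx d
      · rw [hjd, p2]; exact Or.inl rfl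
      · rw [p1 j hj hjd]; exact Or.inr (h.pv_mem j hj)
  · intro j hj
    rcases hcase j hj with rfl | rfl | ⟨hjV, hjd⟩
    · rw [n3, p2]
    · rw [n2, p3]
    · rw [n1 j hjV hjd, p1 _ (h.nx_mem j hjV) (hnxd j hjV hjd), h.pv_nx j hjV]
  · rintro j (rfl | hj)
    · rw [p3, n2]
    · by_cases hjd : j = nx d
      · rw [hjd, p2, n3]
      · rw [p1 j hj hjd, n1 _ (h.pv_mem j hj) (hpvd j hj hjd), h.nx_pv j hj]
  · intro j hj h0 i hi
    rcases hcase j hj with rfl | rfl | ⟨hjV, hjd⟩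
    · rw [n3] at h0
      rcases hi with rfl | hi
      · exact le_rfl
      · exact (h.last d hd h0 i hi).trans hdk.le
    · rw [n2] at h0; exact absurd h0 hk0
    · rw [n1 j hjV hjd] at h0
      rcases hi with rfl | hi
      · have hne : nx d ≠ 0 := fun h1 => hnxd j hjV hjd (h0.trans h1.symm)
        exact ((hke.resolve_left hne).trans_le (h.last j hjV h0 _ he)).le
      · exact h.last j hjV h0 i hi
  · intro j hj h0
    rcases hcase j hj with rfl | rfl | ⟨hjV, hjd⟩
    · rw [n3] at h0 ⊢
      exact hke.resolve_left h0
    · rw [n2]; exact hdk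
    · rw [n1 j hjV hjd] at h0 ⊢; exact h.lt j hjV h0
  · intro j hj h0 i hi
    rcases hcase j hj with rfl | rfl | ⟨hjV, hjd⟩
    · rw [n3] at h0 ⊢
      rcases hi with rfl | hi
      · exact Or.inl le_rfl
      · rcases h.gap d hd h0 i hi with h1 | h1
        exacts [Or.inl (h1.trans hdk.le), Or.inr h1]
    · rw [n2] at h0 ⊢
      rcases hi with rfl | hi
      · exact Or.inr le_rfl
      · by_cases h1 : nx j = 0
        · exact Or.inl (h.last j hd h1 i hi)
        · rcases h.gap j hd h1 i hi with h2 | h2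
          exacts [Or.inl h2, Or.inr ((hke.resolve_left h1).le.trans h2)]
    · rw [n1 j hjV hjd] at h0 ⊢
      rcases hi with rfl | hi
      · rcases h.gap j hjV h0 d hd with h1 | h1
        · left
          -- Injectivity of the keys excludes a tie; without it `j` could have the same key as `d`
          -- and still precede the new element.
          have h2 : key d < key j := lt_of_le_of_ne h1 fun h3 => hjd (hinj hd hjV h3).symm
          by_cases h4 : nx d = 0
          · have := h.last d hd h4 j hjV
            linarith
          · have := hke.resolve_left h4
            rcases h.gap d hd h4 j hjV with h5 | h5 <;> linarith
        · exact Or.inr (h1.trans hdk.le)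
      · exact h.gap j hjV h0 i hi

theorem pv_gap (h : Linked V key nx pv) {j : ℕ} (hj : j ∈ V) (hj0 : j ≠ 0) :
    key (pv j) < key j ∧ ∀ i ∈ V, key i ≤ key (pv j) ∨ key j ≤ key i := by
  have h1 := h.nx_pv j hj
  have h2 := h.lt _ (h.pv_mem j hj) (by rw [h1]; exact hj0)
  have h3 := h.gap _ (h.pv_mem j hj) (by rw [h1]; exact hj0)
  rw [h1] at h2 h3
  exact ⟨h2, h3⟩

end Linked

/-! ### The lists and the step budget during the insertion of a line -/

/-- The nodes of the list of the line `i` while the line `k` is inserted, and has crossed the lines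
in `A`. -/
def nodes (k : ℕ) (A : Finset ℕ) (i : ℕ) : Set ℕ :=
  {j | j = 0 ∨ (1 ≤ j ∧ j ≠ i ∧ ((i < k ∧ j < k) ∨ (i = k ∧ j ∈ A) ∨ (j = k ∧ i ∈ A)))}

theorem mem_nodes {k : ℕ} {A : Finset ℕ} {i j : ℕ} : j ∈ nodes k A i ↔
    j = 0 ∨ (1 ≤ j ∧ j ≠ i ∧ ((i < k ∧ j < k) ∨ (i = k ∧ j ∈ A) ∨ (j = k ∧ i ∈ A))) := Iff.rfl

namespace Arrangement

variable {N : ℕ} {R : Arrangement N}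

/-- The lists of all lines are correct while the line `k` is inserted. -/
def Stage (R : Arrangement N) (k : ℕ) (A : Finset ℕ) (nx pv : ℕ → ℕ → ℕ) : Prop :=
  ∀ i, 1 ≤ i → i ≤ N → Linked (nodes k A i) (R.x i) (nx i) (pv i)

variable {k : ℕ} {A : Finset ℕ} {c d e : ℕ} {nx pv nx' pv' : ℕ → ℕ → ℕ}

theorem Stage.zero (R : Arrangement N) : R.Stage 1 ∅ (fun _ _ => 0) (fun _ _ => 0) := by
  intro i h1 _
  have : nodes 1 ∅ i = {0} := by
    ext j; simp [mem_nodes]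
  rw [this]
  exact Linked.singleton _

/-- Once all earlier lines are crossed, the list of every line has exactly the nodes it should have
before the next insertion. -/
theorem Stage.succ (h : R.Stage k (Finset.Ico 1 k) nx pv) : R.Stage (k + 1) ∅ nx pv := by
  intro i h1 h2
  have : nodes (k + 1) ∅ i = nodes k (Finset.Ico 1 k) i := by
    ext j; simp only [mem_nodes, Finset.mem_Ico, Finset.notMem_empty]; grind
  rw [this]
  exact h i h1 h2

theorem nodes_le (hk : k ≤ N) (hA : ∀ a ∈ A, 1 ≤ a ∧ a < k) {i j : ℕ} (h : j ∈ nodes k A i) :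
    j ≤ N := by
  rw [mem_nodes] at h
  rcases h with h | ⟨-, -, h | ⟨-, h⟩ | h⟩
  · omega
  · omega
  · have := hA _ h; omega
  · have := h.1; omega

theorem ne_of_mem_nodes {i j : ℕ} (hi : 1 ≤ i) (h : j ∈ nodes k A i) : i ≠ j := by
  rw [mem_nodes] at h; omega

theorem injOn_nodes (R : Arrangement N) (hk : k ≤ N) (hA : ∀ a ∈ A, 1 ≤ a ∧ a < k) {i : ℕ}
    (hi : 1 ≤ i) (hiN : i ≤ N) : Set.InjOn (R.x i) (nodes k A i) := fun _ hj _ hl h =>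
  R.x_inj hi hiN (nodes_le hk hA hj) (nodes_le hk hA hl) (ne_of_mem_nodes hi hj)
    (ne_of_mem_nodes hi hl) h

/-- The lists after the crossing of the line `k` with the line `c` has been entered. -/
theorem Stage.cross (h : R.Stage k A nx pv) (hk : k ≤ N) (hw : R.Walk k A False c d)
    (he : ∀ j < k, j ≠ c → R.x c j ≤ R.x c d ∨ R.x c k < R.x c j)
    (hnx : ∀ i j, i ≤ N → j ≤ N → nx' i j = if i = k ∧ j = c then 0 else if i = k ∧ j = pv k 0
      then c else if i = c ∧ j = k then nx c d else if i = c ∧ j = d then k else nx i j)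
    (hpv : ∀ i j, i ≤ N → j ≤ N → pv' i j = if i = k ∧ j = c then pv k 0 else if i = k ∧ j = 0
      then c else if i = c ∧ j = k then d else if i = c ∧ j = nx c d then k else pv i j) :
    R.Stage k (insert c A) nx' pv' := by
  have hcA : c ∉ A := fun hc => hw.left_iff.2 hc
  have hc := hw.c_lt
  have hc1 := hw.one_le
  have hd := hw.d_lt
  have hkA : k ∉ A := fun hkA => lt_irrefl _ (hw.mem_range k hkA).2
  have hmemA := hw.mem_range
  intro i hi hiN
  by_cases hic : i = c
  · subst hic
    have hV : nodes k (insert i A) i = insert k (nodes k A i) := by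
      ext j
      simp only [mem_nodes, Set.mem_insert_iff, Finset.mem_insert]
      grind
    have hLi := h i hi hiN
    have hdV : d ∈ nodes k A i := by
      have := hw.ne
      rw [mem_nodes]; grind
    have hkV : k ∉ nodes k A i := by
      rw [mem_nodes]; grind
    rw [hV]
    refine (hLi.insert (injOn_nodes R hk hmemA hi hiN) hkV (by omega) hdV hw.x_lt ?_).congr ?_ ?_
    -- On line `c` the node `k` goes directly after `d`: the next old crossing lies beyond `k`.
    · by_cases h0 : nx i d = 0
      · exact Or.inl h0
      right
      have h1 := hLi.nx_mem d hdV
      have h2 := ne_of_mem_nodes hi h1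
      have h3 : nx i d < k := by
        rw [mem_nodes] at h1; grind
      have := hLi.lt d hdV h0
      rcases he _ h3 h2.symm with h4 | h4
      · linarith
      · exact h4
    · intro j hj
      have hjN : j ≤ N := by
        rcases hj with rfl | hj
        exacts [hk, nodes_le hk hmemA hj]
      rw [hnx i j hiN hjN]
      simp only [Function.update_apply]
      grind
    · intro j hj
      have hjN : j ≤ N := by
        rcases hj with rfl | hj
        exacts [hk, nodes_le hk hmemA hj]
      rw [hpv i j hiN hjN]
      simp only [Function.update_apply]
      grind
  by_cases hik : i = k
  · subst hik
    have hV : nodes i (insert c A) i = insert c (nodes i A i) := by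
      ext j
      simp only [mem_nodes, Set.mem_insert_iff, Finset.mem_insert]
      grind
    have hLi := h i hi hiN
    have h0V : 0 ∈ nodes i A i := Or.inl rfl
    have hdV := hLi.pv_mem 0 h0V
    have hn := hLi.nx_pv 0 h0V
    have hcV : c ∉ nodes i A i := by
      rw [mem_nodes]; grind
    rw [hV]
    refine (hLi.insert (injOn_nodes R hk hmemA hi hiN) hcV (by omega) hdV ?_ (Or.inl hn)).congr
      ?_ ?_
    -- On the new line, crossings are found from left to right, so `c` is appended after the last
    -- node; `before` places it to the right of all of `A`.
    · rcases Nat.eq_zero_or_pos (pv i 0) with h0 | h0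
      · rw [h0, R.x_zero]
        exact R.bot_lt _ _ hi hiN hc1 (by omega) (by omega)
      · have hpA : pv i 0 ∈ A := by
          rw [mem_nodes] at hdV
          have := hdV.resolve_left (by omega)
          grind
        have := hw.before _ hpA c hc1 hc hcA
        rwa [R.x_comm i _ hi h0, R.x_comm i c hi hc1]
    · intro j hj
      have hjN : j ≤ N := by
        rcases hj with rfl | hj
        exacts [by omega, nodes_le hk hmemA hj]
      rw [hnx i j hiN hjN]
      simp only [Function.update_apply]
      grind
    · intro j hj
      have hjN : j ≤ N := by
        rcases hj with rfl | hj
        exacts [by omega, nodes_le hk hmemA hj]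
      rw [hpv i j hiN hjN]
      simp only [Function.update_apply]
      grind
  · have hV : nodes k (insert c A) i = nodes k A i := by
      ext j
      simp only [mem_nodes, Finset.mem_insert]
      grind
    rw [hV]
    refine (h i hi hiN).congr (fun j hj => ?_) (fun j hj => ?_)
    · rw [hnx i j hiN (nodes_le hk hmemA hj)]; simp [hic, hik]
    · rw [hpv i j hiN (nodes_le hk hmemA hj)]; simp [hic, hik]

open Classical in
/-- The invariant of the insertion of the line `k`, with `r` bounding the remaining number of
steps. -/
def WalkInv (R : Arrangement N) (k : ℕ) (nx pv : ℕ → ℕ → ℕ) (left : Prop) (c d : ℕ) (A : Finset ℕ)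
    (r : ℕ) : Prop :=
  R.Stage k A nx pv ∧ R.Walk k A left c d ∧ ∃ F ⊆ Finset.Ico 1 k, ∃ G ⊆ Finset.Ico 1 k,
    R.FloorCharged k A left (R.x c d) F ∧ R.CeilingCharged k A left (R.x c d) G ∧
    r + 2 * A.card + F.card + G.card = 4 * k + if left then 1 else 0

/-- The budget `4 * k` pays 2 for each crossing (the crossing itself and the later turn), 1 for each
floor charge and 1 for each ceiling charge. There are fewer than `k` of each kind. -/
theorem WalkInv.start (h : R.Stage k ∅ nx pv) (hk : k ≤ N) (h2 : 2 ≤ k) :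
    R.WalkInv k nx pv False (k - 1) 0 ∅ (4 * k) := by
  refine ⟨h, ⟨by simp, by simp, by omega, by omega, by omega, by omega, ?_, by simp, ?_, by simp,
    by simp⟩, ∅, by simp, ∅, by simp, by simp [FloorCharged], by simp [CeilingCharged], by simp⟩
  · rw [R.x_zero]; exact R.bot_lt _ _ (by omega) (by omega) (by omega) hk (by omega)
  · intro b hb1 hbk _
    rcases Nat.eq_or_lt_of_le (show b ≤ k - 1 by omega) with h5 | h5
    · rw [h5]
    · refine ((R.gt_iff hb1 h5 (by omega)).2 ?_).le
      rw [R.x_zero]; exact R.bot_lt _ _ hb1 (by omega) (by omega) (by omega) (by omega)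

/-- While `c` is uncrossed its list contains no node `k`, so the successor of `d` is the next
crossing of `c` with an older line. -/
theorem WalkInv.right_gap (h : R.Stage k A nx pv) (hk : k ≤ N) (hw : R.Walk k A False c d) :
    nx c d < k ∧ nx c d ≠ c ∧ (nx c d = 0 → ∀ j < k, j ≠ c → R.x c j ≤ R.x c d) ∧
    (nx c d ≠ 0 → R.x c d < R.x c (nx c d) ∧
      ∀ j < k, j ≠ c → R.x c j ≤ R.x c d ∨ R.x c (nx c d) ≤ R.x c j) := by
  have hcA : c ∉ A := fun hc => hw.left_iff.2 hc
  have hc := hw.c_lt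
  have hc1 := hw.one_le
  have hd := hw.d_lt
  have hne := hw.ne
  have hL := h c hc1 (by omega)
  have hdV : d ∈ nodes k A c := by rw [mem_nodes]; grind
  have hjV : ∀ j < k, j ≠ c → j ∈ nodes k A c := by
    intro j hj hjc; rw [mem_nodes]; grind
  have h1 := hL.nx_mem d hdV
  refine ⟨?_, (ne_of_mem_nodes hc1 h1).symm, ?_, ?_⟩
  · rw [mem_nodes] at h1; grind
  · exact fun h0 j hj hjc => hL.last d hdV h0 j (hjV j hj hjc)
  · exact fun h0 => ⟨hL.lt d hdV h0, fun j hj hjc => hL.gap d hdV h0 j (hjV j hj hjc)⟩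

theorem WalkInv.ceiling {r : ℕ} (h : R.WalkInv k nx pv False c d A r) (hk : k ≤ N)
    (h0 : nx c d ≠ 0) (hlt : R.x c (nx c d) < R.x c k) :
    ∃ r' < r, R.WalkInv k nx pv False (nx c d) c A r' := by
  obtain ⟨hs, hw, F, hF, G, hG, hFC, hGC, hr⟩ := h
  obtain ⟨g1, g2, -, g3⟩ := WalkInv.right_gap hs hk hw
  obtain ⟨g3, g4⟩ := g3 h0
  obtain ⟨hec, hw'⟩ := hw.ceiling hk h0 g1 g2 g3 g4 hlt
  have hcomm := R.x_comm (nx c d) c (by omega) hw.one_le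
  obtain ⟨heG, hGC'⟩ := hGC.ceiling hk hw' hec (by rw [hcomm]; exact g3)
  have hsub : insert (nx c d) G ⊆ Finset.Ico 1 k :=
    Finset.insert_subset (Finset.mem_Ico.2 ⟨by omega, g1⟩) hG
  have hcG := Finset.card_le_card hsub
  have hcF := Finset.card_le_card hF
  have hcA := Finset.card_le_card (show A ⊆ Finset.Ico 1 k from
    fun a ha => Finset.mem_Ico.2 (hw.mem_range a ha))
  rw [Finset.card_insert_of_notMem heG, Nat.card_Ico] at hcG
  rw [Nat.card_Ico] at hcF hcA
  rw [if_neg id] at hr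
  refine ⟨r - 1, by omega, hs, hw', F, hF, _, hsub, hFC.right, hGC', ?_⟩
  rw [Finset.card_insert_of_notMem heG, if_neg id]
  omega

theorem WalkInv.cross {r : ℕ} (h : R.WalkInv k nx pv False c d A r) (hk : k ≤ N)
    (hcr : ¬ (nx c d ≠ 0 ∧ nx c d < c ∧ R.x c (nx c d) < R.x c k))
    (hnx : ∀ i j, i ≤ N → j ≤ N → nx' i j = if i = k ∧ j = c then 0 else if i = k ∧ j = pv k 0
      then c else if i = c ∧ j = k then nx c d else if i = c ∧ j = d then k else nx i j)
    (hpv : ∀ i j, i ≤ N → j ≤ N → pv' i j = if i = k ∧ j = c then pv k 0 else if i = k ∧ j = 0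
      then c else if i = c ∧ j = k then d else if i = c ∧ j = nx c d then k else pv i j) :
    c ∉ A ∧ ∃ r' < r, R.WalkInv k nx' pv' True c d (insert c A) r' := by
  obtain ⟨hs, hw, F, hF, G, hG, hFC, hGC, hr⟩ := h
  have hc := hw.c_lt
  have hc1 := hw.one_le
  have he : ∀ j < k, j ≠ c → R.x c j ≤ R.x c d ∨ R.x c k < R.x c j := by
    intro j hj hjc
    obtain ⟨g1, g2, g5, g3⟩ := WalkInv.right_gap hs hk hw
    by_cases h0 : nx c d = 0
    · exact Or.inl (g5 h0 j hj hjc)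
    · obtain ⟨g3, g4⟩ := g3 h0
      refine (g4 j hj hjc).imp_right fun g6 => lt_of_lt_of_le ?_ g6
      -- The test also demands `nx c d < c`, but this is automatic when the next vertex lies before
      -- `k`, by `Walk.ceiling`. A failed test therefore means that `k` comes first.
      by_contra hlt
      have hlt := lt_of_le_of_ne (not_lt.1 hlt)
        (R.x_ne c (nx c d) k hc1 (by omega) (by omega) (by omega) (by omega) hk g2.symm
          (by omega) (by omega))
      exact hcr ⟨h0, (hw.ceiling hk h0 g1 g2 g3 g4 hlt).1, hlt⟩
  have hcA : c ∉ A := fun hc => hw.left_iff.2 hc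
  rw [if_neg id] at hr
  have hw' := hw.cross hk he
  have hcard := Finset.card_le_card (show insert c A ⊆ Finset.Ico 1 k from
    fun a ha => Finset.mem_Ico.2 (hw'.mem_range a ha))
  have hcF := Finset.card_le_card hF
  have hcG := Finset.card_le_card hG
  rw [Finset.card_insert_of_notMem hcA] at hcard
  rw [Nat.card_Ico] at hcard hcF hcG
  -- The term `2 * A.card` grows by 2 and the indicator of `left` by 1, so the budget drops by 1.
  -- The indicator is given back by `turn` or `bottom`.
  refine ⟨hcA, r - 1, by omega, hs.cross hk hw he hnx hpv, hw', F, hF, G, hG,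
    hFC.cross hc1 hc hcA, hGC.cross hc1 hc hcA (fun b => hw.lt_of_notMem hk he), ?_⟩
  rw [Finset.card_insert_of_notMem hcA, if_pos trivial]
  omega

theorem WalkInv.bottom {r : ℕ} (h : R.WalkInv k nx pv True c 0 A r) (hk : k ≤ N)
    (hA : A.card + 1 < k) : ∃ r' < r, R.WalkInv k nx pv False (c - 1) 0 A r' := by
  obtain ⟨hs, hw, F, hF, G, hG, hFC, hGC, hr⟩ := h
  have hcF := Finset.card_le_card hF
  have hcG := Finset.card_le_card hG
  rw [Nat.card_Ico] at hcF hcG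
  rw [if_pos trivial] at hr
  refine ⟨r - 1, by omega, hs, hw.bottom hk hA, F, hF, G, hG, hFC.right, hGC.of_left, ?_⟩
  rw [if_neg id]
  omega

theorem WalkInv.turn {r : ℕ} (h : R.WalkInv k nx pv True c d A r) (hk : k ≤ N) (hA : A.card + 1 < k)
    (hcd : c < d) : ∃ r' < r, R.WalkInv k nx pv False d c A r' := by
  obtain ⟨hs, hw, F, hF, G, hG, hFC, hGC, hr⟩ := h
  have hcF := Finset.card_le_card hF
  have hcG := Finset.card_le_card hG
  rw [Nat.card_Ico] at hcF hcG
  rw [if_pos trivial] at hr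
  refine ⟨r - 1, by omega, hs, hw.turn hk hcd, F, hF, G, hG, hFC.right, hGC.of_left, ?_⟩
  rw [if_neg id]
  omega

theorem WalkInv.floor {r : ℕ} (h : R.WalkInv k nx pv True c d A r) (hk : k ≤ N) (hd0 : d ≠ 0)
    (hdc : d < c) : ∃ r' < r, R.WalkInv k nx pv True d (pv d c) A r' := by
  obtain ⟨hs, hw, F, hF, G, hG, hFC, hGC, hr⟩ := h
  have hc := hw.c_lt
  have hd := hw.d_lt
  have hL := hs d (by omega) (by omega)
  have hcV : c ∈ nodes k A d := by rw [mem_nodes]; grind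
  obtain ⟨g1, g2⟩ := hL.pv_gap hcV (by omega)
  have hm := hL.pv_mem c hcV
  have hne := ne_of_mem_nodes (by omega) hm
  have hx := hw.x_lt_floor hk hd0 hdc
  have hek : pv d c < k := by
    by_contra hcon
    have : pv d c = k := by
      rw [mem_nodes] at hm; grind
    rw [this] at g1
    linarith
  have hw' := hw.floor hk hd0 hdc hek hne.symm g1 (fun j hj hjd => g2 j (by
    rw [mem_nodes]; grind))
  have hcomm := R.x_comm d c (by omega) (by omega)
  obtain ⟨hcF, hFC'⟩ := hFC.floor hk hw hd0 hdc (by rw [← hcomm]; exact g1)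
  have hsub : insert c F ⊆ Finset.Ico 1 k :=
    Finset.insert_subset (Finset.mem_Ico.2 ⟨hw.one_le, hc⟩) hF
  have hcF' := Finset.card_le_card hsub
  have hcG := Finset.card_le_card hG
  have hcA := Finset.card_le_card (show A ⊆ Finset.Ico 1 k from
    fun a ha => Finset.mem_Ico.2 (hw.mem_range a ha))
  rw [Finset.card_insert_of_notMem hcF, Nat.card_Ico] at hcF'
  rw [Nat.card_Ico] at hcG hcA
  rw [if_pos trivial] at hr
  refine ⟨r - 1, by omega, hs, hw', _, hsub, G, hG, hFC', hGC.of_left, ?_⟩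
  rw [Finset.card_insert_of_notMem hcF, if_pos trivial]
  omega

theorem WalkInv.eq_Ico {left : Prop} {r : ℕ} (h : R.WalkInv k nx pv left c d A r)
    (hA : k ≤ A.card + 1) : A = Finset.Ico 1 k := by
  refine Finset.eq_of_subset_of_card_le
    (fun a ha => Finset.mem_Ico.2 (h.2.1.mem_range a ha)) ?_
  rw [Nat.card_Ico]; omega

end Arrangement

/-! ### Lexicographic order and point-line duality -/

/-- The lexicographic order of points. -/
def LexLt (p q : Point) : Prop := p.1 < q.1 ∨ (p.1 = q.1 ∧ p.2 < q.2)

theorem LexLt.trans {p q r : Point} (h₁ : LexLt p q) (h₂ : LexLt q r) : LexLt p r := by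
  unfold LexLt at *
  rcases h₁ with h₁ | ⟨h₁, h₁'⟩ <;> rcases h₂ with h₂ | ⟨h₂, h₂'⟩
  · exact Or.inl (h₁.trans h₂)
  · exact Or.inl (h₂ ▸ h₁)
  · exact Or.inl (h₁ ▸ h₂)
  · exact Or.inr ⟨h₁.trans h₂, h₁'.trans h₂'⟩

theorem LexLt.irrefl (p : Point) : ¬ LexLt p p := by simp [LexLt]

theorem LexLt.total {p q : Point} (h : p ≠ q) : LexLt p q ∨ LexLt q p := by
  unfold LexLt
  rcases lt_trichotomy p.1 q.1 with h1 | h1 | h1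
  · exact Or.inl (Or.inl h1)
  · rcases lt_trichotomy p.2 q.2 with h2 | h2 | h2
    · exact Or.inl (Or.inr ⟨h1, h2⟩)
    · exact absurd (Prod.ext h1 h2) h
    · exact Or.inr (Or.inr ⟨h1.symm, h2⟩)
  · exact Or.inr (Or.inl h1)

/-- A shear turns the lexicographic order of finitely many points into the order of their
abscissae. -/
theorem exists_shear {N : ℕ} {φ : ℕ → Point}
    (hlex : ∀ i j, 1 ≤ i → i < j → j ≤ N → LexLt (φ i) (φ j)) :
    ∃ ε : ℝ, ∀ i j, 1 ≤ i → i < j → j ≤ N →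
      (φ i).1 + ε * (φ i).2 < (φ j).1 + ε * (φ j).2 := by
  -- For each pair the inequality holds for all sufficiently small positive `ε`: strict inequality
  -- of the abscissae survives a small perturbation, and ties are decided by the ordinates. Finitely
  -- many pairs then have a common `ε`.
  have key : ∀ i ∈ Finset.Icc 1 N, ∀ j ∈ Finset.Icc 1 N, ∀ᶠ ε : ℝ in nhdsWithin 0 (Set.Ioi 0),
      i < j → (φ i).1 + ε * (φ i).2 < (φ j).1 + ε * (φ j).2 := by
    intro i hi j hj
    rw [Finset.mem_Icc] at hi hj
    by_cases hij : i < j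
    · rcases hlex i j hi.1 hij hj.2 with h | ⟨h, h'⟩
      · have hc : Filter.Tendsto (fun ε : ℝ => (φ j).1 + ε * (φ j).2 - ((φ i).1 + ε * (φ i).2))
            (nhdsWithin 0 (Set.Ioi 0)) (nhds ((φ j).1 + 0 * (φ j).2 - ((φ i).1 + 0 * (φ i).2))) :=
          ((by fun_prop : Continuous fun ε : ℝ =>
            (φ j).1 + ε * (φ j).2 - ((φ i).1 + ε * (φ i).2)).tendsto 0).mono_left
            nhdsWithin_le_nhds
        filter_upwards [hc.eventually_const_lt (u := 0) (by linarith)] with ε hε _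
        linarith
      · filter_upwards [self_mem_nhdsWithin] with ε hε _
        have := mul_lt_mul_of_pos_left h' (Set.mem_Ioi.1 hε)
        linarith
    · exact Filter.Eventually.of_forall fun _ h => absurd h hij
  have := ((Finset.Icc 1 N).eventually_all).2 fun i hi => ((Finset.Icc 1 N).eventually_all).2
    (key i hi)
  obtain ⟨ε, hε⟩ := this.exists
  exact ⟨ε, fun i j hi hij hj => hε i (Finset.mem_Icc.2 ⟨hi, by omega⟩) j
    (Finset.mem_Icc.2 ⟨by omega, hj⟩) hij⟩

/-- The dual line arrangement of a set of points in general position. -/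
theorem exists_arrangement {N : ℕ} {φ : ℕ → Point}
    (hlex : ∀ i j, 1 ≤ i → i < j → j ≤ N → LexLt (φ i) (φ j))
    (hdet : ∀ i j k, 1 ≤ i → i ≤ N → 1 ≤ j → j ≤ N → 1 ≤ k → k ≤ N → i ≠ j → i ≠ k → j ≠ k →
      det (φ i) (φ j) (φ k) ≠ 0) :
    ∃ (R : Arrangement N) (a : ℕ → ℝ), (∀ i j, 1 ≤ i → i < j → j ≤ N → a i < a j) ∧
      ∀ i j k, 1 ≤ i → i ≤ N → 1 ≤ j → j ≤ N → 1 ≤ k → k ≤ N → i ≠ j → i ≠ k →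
        det (φ i) (φ j) (φ k) = (a j - a i) * (a k - a i) * (R.x i k - R.x i j) := by
  obtain ⟨ε, hε⟩ := exists_shear hlex
  set a : ℕ → ℝ := fun i => (φ i).1 + ε * (φ i).2 with ha
  set b : ℕ → ℝ := fun i => (φ i).2 with hb
  -- The slope of the line through two sheared points, which is also the abscissa where their dual
  -- lines `t ↦ a i * t - b i` meet. The shear preserves area, so `det` keeps its value.
  set m : ℕ → ℕ → ℝ := fun i j => (b j - b i) / (a j - a i) with hm
  have hne : ∀ i j, 1 ≤ i → i ≤ N → 1 ≤ j → j ≤ N → i ≠ j → a j - a i ≠ 0 := by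
    intro i j hi hiN hj hjN hij
    rcases lt_or_gt_of_ne hij with h | h
    · have := hε i j hi h hjN
      exact (sub_pos.2 this).ne'
    · have := hε j i hj h hiN
      exact (sub_neg.2 this).ne
  have hD : ∀ i j k, 1 ≤ i → i ≤ N → 1 ≤ j → j ≤ N → 1 ≤ k → k ≤ N → i ≠ j → i ≠ k →
      det (φ i) (φ j) (φ k) = (a j - a i) * (a k - a i) * (m i k - m i j) := by
    intro i j k hi hiN hj hjN hk hkN hij hik
    have h1 := hne i j hi hiN hj hjN hij
    have h2 := hne i k hi hiN hk hkN hik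
    have : (a j - a i) * (a k - a i) * (m i k - m i j) =
        (a j - a i) * (b k - b i) - (a k - a i) * (b j - b i) := by
      simp only [hm]; field_simp
    rw [this]
    simp only [ha, hb, det]
    ring
  have hcomm : ∀ i j, m i j = m j i := by
    intro i j
    simp only [hm]
    rw [← neg_sub (b i), ← neg_sub (a i), neg_div_neg_eq]
  obtain ⟨B, hB⟩ : ∃ B : ℝ, ∀ i ∈ Finset.range (N + 1), ∀ j ∈ Finset.range (N + 1), B < m i j := by
    obtain ⟨B, hB⟩ := ((Finset.range (N + 1) ×ˢ Finset.range (N + 1)).image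
      fun p => m p.1 p.2).bddBelow
    refine ⟨B - 1, fun i hi j hj => ?_⟩
    have := hB (Finset.mem_coe.2 (Finset.mem_image_of_mem _ (Finset.mk_mem_product hi hj)))
    simp only at this
    linarith
  have hlt : ∀ i j t, 1 ≤ i → i < j → j ≤ N → (a i * t - b i < a j * t - b j ↔ m i j < t) := by
    intro i j t hi hij hj
    have := hε i j hi hij hj
    simp only [hm]
    rw [div_lt_iff₀ (sub_pos.2 this)]
    constructor <;> intro h <;> linarith
  have heq : ∀ i j t, 1 ≤ i → i < j → j ≤ N → (a i * t - b i = a j * t - b j ↔ m i j = t) := by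
    intro i j t hi hij hj
    have := hε i j hi hij hj
    simp only [hm]
    rw [div_eq_iff (sub_pos.2 this).ne']
    constructor <;> intro h <;> linarith
  have hx : ∀ i j, 1 ≤ j → (if j = 0 then B else m i j) = m i j := fun i j hj =>
    if_neg (by omega)
  refine ⟨⟨fun i t => a i * t - b i, fun i j => if j = 0 then B else m i j, B, by simp, ?_, ?_, ?_,
    ?_, ?_⟩, a, hε, ?_⟩
  · intro i j hi hj
    rw [hx i j hj, hx j i hi, hcomm]
  · intro i j _ hiN hj hjN _
    rw [hx i j hj]
    exact hB i (Finset.mem_range.2 (by omega)) j (Finset.mem_range.2 (by omega))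
  · intro i j t hi hij hj
    rw [hx i j (by omega)]
    exact hlt i j t hi hij hj
  · intro i j t hi hij hj
    rw [hx i j (by omega)]
    exact heq i j t hi hij hj
  · intro i j k hi hiN hj hjN hk hkN hij hik hjk h
    rw [hx i j hj, hx i k hk] at h
    have := hdet i j k hi hiN hj hjN hk hkN hij hik hjk
    rw [hD i j k hi hiN hj hjN hk hkN hij hik, h, sub_self, mul_zero] at this
    exact this rfl
  · intro i j k hi hiN hj hjN hk hkN hij hik
    simp only [hx i j hj, hx i k hk]
    exact hD i j k hi hiN hj hjN hk hkN hij hik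

/-! ### The program: copying and sorting the points -/

namespace RealRAM

theorem Runs.cond {b : Cond} {c₁ c₂ : Program} {s : State} {T : ℕ} {Q : State → Prop}
    (h₁ : b.Holds s → Runs c₁ s T Q) (h₂ : ¬ b.Holds s → Runs c₂ s T Q) :
    Runs (.cond b c₁ c₂) s (b.cost + 1 + T) Q := by
  by_cases hb : b.Holds s
  · obtain ⟨t, s', he, ht, hq⟩ := h₁ hb
    exact ⟨_, _, .condTrue hb he, by omega, hq⟩
  · obtain ⟨t, s', he, ht, hq⟩ := h₂ hb
    exact ⟨_, _, .condFalse hb he, by omega, hq⟩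

/-- A loop with a counter running from `lo` to `hi`. -/
theorem Runs.forLoop {b : Cond} {c : Program} {T : ℕ} (I : ℕ → State → Prop) {lo hi : ℕ}
    (hlo : lo ≤ hi) (hb : ∀ i s, I i s → (b.Holds s ↔ i < hi))
    (step : ∀ i s, lo ≤ i → i < hi → I i s → Runs c s T (I (i + 1))) {s : State} (h : I lo s) :
    Runs (.loop b c) s ((b.cost + 1 + T) * (hi - lo + 1)) (I hi) := by
  refine (Runs.loop (b := b) (c := c) (T := T)
    (fun r s => ∃ i, lo ≤ i ∧ i ≤ hi ∧ r = hi - i ∧ I i s) ?_ (hi - lo) s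
    ⟨lo, le_rfl, hlo, rfl, h⟩).mono ?_ ?_
  · rintro r s ⟨i, h1, h2, rfl, hI⟩ hbs
    have hi' := (hb i s hI).1 hbs
    exact (step i s h1 hi' hI).mono le_rfl fun s' h' =>
      ⟨hi - (i + 1), by omega, i + 1, by omega, hi', rfl, h'⟩
  · rw [Nat.mul_succ]; omega
  · rintro s' ⟨hn, r, i, h1, h2, -, hI⟩
    rw [hb i s' hI] at hn
    obtain rfl : i = hi := by omega
    exact hI

/-- The sequential composition of a list of programs. -/
def Program.block : List Program → Program
  | [] => .skip
  | [c] => c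
  | c :: cs => .seq c (Program.block cs)

section Programs

open NatExpr

/-- The abscissa of the point with the given index. -/
def absc (i : NatExpr) : RealExpr := .get 0 i

/-- The ordinate of the point with the given index. -/
def ordi (i : NatExpr) : RealExpr := .get 1 i

def incr (x : ℕ) : Program := .setNat x (.add (var x) (const 1))

def copyInit : Program := .block [.setNat 3 (.add (var 0) (var 1)),
  .setNat 4 (.add (var 3) (const 1)), .setNat 5 (const 0)]

def copyBody : Program := .block [.storeReal 0 (.add (var 0) (var 5)) (.get 2 (var 5)),
  .storeReal 1 (.add (var 0) (var 5)) (.get 3 (var 5)), incr 5]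

/-- Appends the candidates to the arrays of the points. -/
def copyProgram : Program := .seq copyInit (.loop (.natLt (var 5) (var 1)) copyBody)

/-- The lexicographic comparison of two points. -/
def lexCond (i j : NatExpr) : Cond :=
  .or (.realLt (absc i) (absc j)) (.and (.realEq (absc i) (absc j)) (.realLt (ordi i) (ordi j)))

def rankInit : Program := .block [.setNat 12 (const 1), .setNat 6 (const 0)]

def rankCount : Program := .block [.cond (lexCond (var 6) (var 5)) (incr 12) .skip, incr 6]

/-- Natural numbers cannot be multiplied on this machine, so the row offsets of the two-dimensional
tables are prepared by repeated addition. -/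
def rankStore : Program := .block [.storeNat 1 (var 12) (var 5),
  .storeNat 0 (.add (var 5) (const 1)) (.add (.get 0 (var 5)) (var 4)), incr 5]

/-- Sorts the points lexicographically by counting smaller points, and tabulates the multiples of
the row length of the tables of lists. -/
def rankProgram : Program :=
  .seq (.setNat 5 (const 0)) (.loop (.natLt (var 5) (var 3))
    (.seq rankInit (.seq (.loop (.natLt (var 6) (var 3)) rankCount) rankStore)))

end Programs

/-- The contents of the memory after the candidates have been appended to the points. -/
structure Base (n m p : ℕ) (P : ℕ → Point) (s : State) : Prop where
  var0 : s.natVar 0 = n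
  var1 : s.natVar 1 = m
  var2 : s.natVar 2 = p
  var3 : s.natVar 3 = n + m
  var4 : s.natVar 4 = n + m + 1
  absc : ∀ i < n + m, s.realArr 0 i = (P i).1
  ordi : ∀ i < n + m, s.realArr 1 i = (P i).2
  out : ∀ i, s.realArr 6 i = 0

/-- Agreement of everything that is fixed after the candidates have been appended. -/
structure SameBase (s s' : State) : Prop where
  var : ∀ i < 5, s'.natVar i = s.natVar i
  real : s'.realArr = s.realArr

theorem Base.of_same {n m p : ℕ} {P : ℕ → Point} {s s' : State} (h : Base n m p P s)
    (hs : SameBase s s') : Base n m p P s' where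
  var0 := (hs.var 0 (by omega)).trans h.var0
  var1 := (hs.var 1 (by omega)).trans h.var1
  var2 := (hs.var 2 (by omega)).trans h.var2
  var3 := (hs.var 3 (by omega)).trans h.var3
  var4 := (hs.var 4 (by omega)).trans h.var4
  absc := by rw [hs.real]; exact h.absc
  ordi := by rw [hs.real]; exact h.ordi
  out := by rw [hs.real]; exact h.out

theorem runs_copyProgram : ∃ K : ℕ, ∀ (n m p : ℕ) (P : ℕ → Point) (s : State), s.natVar 0 = n →
    s.natVar 1 = m → s.natVar 2 = p → (∀ i < n, s.realArr 0 i = (P i).1) →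
    (∀ i < n, s.realArr 1 i = (P i).2) → (∀ i < m, s.realArr 2 i = (P (n + i)).1) →
    (∀ i < m, s.realArr 3 i = (P (n + i)).2) → (∀ i, s.realArr 6 i = 0) →
    (∀ a i, s.natArr a i = 0) →
    Runs copyProgram s (K * (n + m + 1)) (fun s' => Base n m p P s' ∧ ∀ a i, s'.natArr a i = 0) := by
  refine ⟨copyInit.maxCost +
    ((Cond.natLt (.var 5) (.var 1)).cost + 1 + copyBody.maxCost), ?_⟩
  intro n m p P s h0 h1 h2 hx hy hcx hcy ho hz
  refine (Runs.seq (Runs.of_wp (by simp [copyInit, Program.Flat, Program.block])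
    (Q := fun s' => s'.natVar 0 = n ∧ s'.natVar 1 = m ∧ s'.natVar 2 = p ∧ s'.natVar 3 = n + m ∧
        s'.natVar 4 = n + m + 1 ∧ s'.natVar 5 = 0 ∧ s'.realArr = s.realArr ∧
        s'.natArr = s.natArr) ?_) (fun s' hs' => Runs.forLoop (fun i s' => s'.natVar 0 = n ∧
        s'.natVar 1 = m ∧ s'.natVar 2 = p ∧ s'.natVar 3 = n + m ∧ s'.natVar 4 = n + m + 1 ∧
        s'.natVar 5 = i ∧ (∀ j < n + i, s'.realArr 0 j = (P j).1 ∧ s'.realArr 1 j = (P j).2) ∧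
        (∀ j < m, s'.realArr 2 j = (P (n + j)).1 ∧ s'.realArr 3 j = (P (n + j)).2) ∧
        (∀ j, s'.realArr 6 j = 0) ∧ ∀ a j, s'.natArr a j = 0)
      (T := copyBody.maxCost) (Nat.zero_le m) ?_ ?_ ?_)).mono ?_ ?_
  · simp [copyInit, Program.wp, Program.block, NatExpr.eval, h0, h1, h2]
  · rintro i s ⟨g0, g1, g2, g3, g4, g5, -⟩
    simp [Cond.Holds, NatExpr.eval, g1, g5]
  · rintro i s - hi ⟨g0, g1, g2, g3, g4, g5, g6, g7, g8, g9⟩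
    refine Runs.of_wp (by simp [copyBody, incr, Program.Flat, Program.block]) ?_
    simp only [copyBody, incr, Program.wp, Program.block, NatExpr.eval, RealExpr.eval]
    simp only [State.natVar_setNat, State.natVar_storeReal, State.realArr_storeReal,
      State.realArr_setNat, State.natArr_setNat, State.natArr_storeReal, g0, g1, g2, g3, g4, g5]
    refine ⟨rfl, rfl, rfl, rfl, rfl, rfl, ?_, by simpa using g7, by simpa using g8, g9⟩
    intro j hj
    by_cases hj' : j = n + i
    · subst hj'
      simp [g7 i hi]
    · simp [hj', g6 j (by omega)]
  · obtain ⟨g0, g1, g2, g3, g4, g5, g6, g7⟩ := hs'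
    refine ⟨g0, g1, g2, g3, g4, g5, ?_, ?_, ?_, ?_⟩
    · rw [g6]; exact fun j hj => ⟨hx j (by omega), hy j (by omega)⟩
    · rw [g6]; exact fun j hj => ⟨hcx j (by omega), hcy j (by omega)⟩
    · rw [g6]; exact ho
    · rw [g7]; exact hz
  · exact (Nat.add_le_add (Nat.le_mul_of_pos_right _ (Nat.succ_pos (n + m))) (Nat.mul_le_mul_left _
      (show m - 0 + 1 ≤ n + m + 1 by omega))).trans_eq (add_mul _ _ _).symm
  · rintro s' ⟨g0, g1, g2, g3, g4, -, g6, -, g8, g9⟩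
    exact ⟨⟨g0, g1, g2, g3, g4, fun i hi => (g6 i hi).1, fun i hi => (g6 i hi).2, g8⟩, g9⟩

open Classical in
/-- The position of the point with index `i` in the lexicographic order. -/
noncomputable def rank (N : ℕ) (P : ℕ → Point) (i : ℕ) : ℕ :=
  1 + ((Finset.range N).filter fun j => LexLt (P j) (P i)).card

theorem rank_lt {N : ℕ} {P : ℕ → Point} {i j : ℕ} (hi : i < N) (h : LexLt (P i) (P j)) :
    rank N P i < rank N P j := by
  classical
  unfold rank
  refine Nat.add_lt_add_left (Finset.card_lt_card ?_) 1
  rw [Finset.ssubset_iff_of_subset]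
  · exact ⟨i, by simpa [hi] using h, by simp [LexLt.irrefl]⟩
  · intro l hl
    rw [Finset.mem_filter] at hl ⊢
    exact ⟨hl.1, hl.2.trans h⟩

/-- The points are sorted by the permutation `π`. -/
structure Sorting (N : ℕ) (P : ℕ → Point) (π : ℕ → ℕ) : Prop where
  lt : ∀ r, 1 ≤ r → r ≤ N → π r < N
  inj : ∀ r r', 1 ≤ r → r ≤ N → 1 ≤ r' → r' ≤ N → π r = π r' → r = r'
  surj : ∀ i < N, ∃ r, 1 ≤ r ∧ r ≤ N ∧ π r = i
  lex : ∀ r r', 1 ≤ r → r < r' → r' ≤ N → LexLt (P (π r)) (P (π r'))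

/-- For distinct points `π` is a left inverse of the rank, so ranks are injective and, by counting,
fill `1, …, N`. -/
theorem Sorting.of_rank {N : ℕ} {P : ℕ → Point} {π : ℕ → ℕ}
    (hP : ∀ i < N, ∀ j < N, i ≠ j → P i ≠ P j) (h : ∀ i < N, π (rank N P i) = i) :
    Sorting N P π := by
  classical
  have hmem : ∀ i < N, 1 ≤ rank N P i ∧ rank N P i ≤ N := by
    intro i hi
    refine ⟨by unfold rank; omega, ?_⟩
    have : ((Finset.range N).filter fun j => LexLt (P j) (P i)).card < (Finset.range N).card := by
      refine Finset.card_lt_card ?_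
      rw [Finset.ssubset_iff_of_subset (Finset.filter_subset _ _)]
      exact ⟨i, by simpa using hi, by simp [LexLt.irrefl]⟩
    rw [Finset.card_range] at this
    unfold rank
    omega
  have hsurj : ∀ r, 1 ≤ r → r ≤ N → ∃ i < N, rank N P i = r := by
    intro r h1 h2
    have himg : (Finset.range N).image (rank N P) = Finset.Icc 1 N := by
      refine Finset.eq_of_subset_of_card_le ?_ ?_
      · intro r hr
        obtain ⟨i, hi, rfl⟩ := Finset.mem_image.1 hr
        exact Finset.mem_Icc.2 (hmem i (Finset.mem_range.1 hi))
      · rw [Finset.card_image_of_injOn, Finset.card_range, Nat.card_Icc]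
        · omega
        · intro i hi j hj hij
          rw [← h i (Finset.mem_range.1 hi), hij, h j (Finset.mem_range.1 hj)]
    have : r ∈ (Finset.range N).image (rank N P) := by rw [himg]; exact Finset.mem_Icc.2 ⟨h1, h2⟩
    obtain ⟨i, hi, rfl⟩ := Finset.mem_image.1 this
    exact ⟨i, Finset.mem_range.1 hi, rfl⟩
  refine ⟨?_, ?_, ?_, ?_⟩
  · intro r h1 h2
    obtain ⟨i, hi, rfl⟩ := hsurj r h1 h2
    rw [h i hi]; exact hi
  · intro r r' h1 h2 h3 h4 he
    obtain ⟨i, hi, rfl⟩ := hsurj r h1 h2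
    obtain ⟨j, hj, rfl⟩ := hsurj r' h3 h4
    rw [h i hi, h j hj] at he
    rw [he]
  · exact fun i hi => ⟨_, (hmem i hi).1, (hmem i hi).2, h i hi⟩
  · intro r r' h1 h2 h3
    obtain ⟨i, hi, rfl⟩ := hsurj r h1 (by omega)
    obtain ⟨j, hj, rfl⟩ := hsurj r' (by omega) h3
    rw [h i hi, h j hj]
    have hij : i ≠ j := by rintro rfl; omega
    refine (LexLt.total (hP i hi j hj hij)).resolve_right fun hlt => ?_
    have := rank_lt hj hlt
    omega

/-- The contents of the memory after the points have been sorted. -/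
structure Sorted (n m p : ℕ) (P : ℕ → Point) (π : ℕ → ℕ) (s : State) : Prop extends
    Base n m p P s where
  row : ∀ i ≤ n + m, s.natArr 0 i = i * (n + m + 1)
  pos : ∀ r, 1 ≤ r → r ≤ n + m → s.natArr 1 r = π r

theorem holds_lexCond {n m p : ℕ} {P : ℕ → Point} {s : State} (h : Base n m p P s)
    {e₁ e₂ : NatExpr} (h₁ : e₁.eval s < n + m) (h₂ : e₂.eval s < n + m) :
    (lexCond e₁ e₂).Holds s ↔ LexLt (P (e₁.eval s)) (P (e₂.eval s)) := by
  simp only [lexCond, Cond.Holds, absc, ordi, RealExpr.eval, h.absc _ h₁, h.absc _ h₂,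
    h.ordi _ h₁, h.ordi _ h₂, LexLt]

theorem runs_rankCount : ∃ K : ℕ, ∀ (n m p : ℕ) (P : ℕ → Point) (s : State) (i : ℕ), i < n + m →
    Base n m p P s → s.natVar 5 = i → s.natVar 12 = 1 → s.natVar 6 = 0 →
    Runs (.loop (.natLt (.var 6) (.var 3)) rankCount) s (K * (n + m + 1)) (fun s' =>
      SameBase s s' ∧ s'.natVar 5 = i ∧ s'.natArr = s.natArr ∧
      s'.natVar 12 = rank (n + m) P i) := by
  classical
  refine ⟨(Cond.natLt (.var 6) (.var 3)).cost + 1 + rankCount.maxCost, ?_⟩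
  intro n m p P s i hi hB h5 h12 h6
  refine (Runs.forLoop (fun j s' => SameBase s s' ∧ s'.natVar 5 = i ∧ s'.natArr = s.natArr ∧
    s'.natVar 6 = j ∧ s'.natVar 12 = 1 + ((Finset.range j).filter fun l => LexLt (P l) (P i)).card)
    (T := rankCount.maxCost) (Nat.zero_le (n + m)) ?_ ?_ ?_).mono le_rfl ?_
  · rintro j s' ⟨g1, g2, g3, g4, g5⟩
    simp [Cond.Holds, NatExpr.eval, g4, (hB.of_same g1).var3]
  · rintro j s' - hj ⟨g1, g2, g3, g4, g5⟩
    have hB' := hB.of_same g1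
    refine Runs.of_wp (by simp [rankCount, incr, Program.Flat, Program.block]) ?_
    have hlex := holds_lexCond hB' (e₁ := .var 6) (e₂ := .var 5)
      (by simpa [NatExpr.eval, g4] using hj) (by simpa [NatExpr.eval, g2] using hi)
    simp only [NatExpr.eval, g4, g2] at hlex
    have hr : ((Finset.range (j + 1)).filter fun l => LexLt (P l) (P i)).card =
        ((Finset.range j).filter fun l => LexLt (P l) (P i)).card +
          if LexLt (P j) (P i) then 1 else 0 := by
      rw [Finset.range_add_one, Finset.filter_insert]
      split_ifs with hl
      · rw [Finset.card_insert_of_notMem (by simp)]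
      · rfl
    simp only [rankCount, incr, Program.wp, Program.block, hlex]
    refine ⟨fun hl => ⟨⟨fun l hl => ?_, ?_⟩, ?_, ?_, ?_, ?_⟩,
      fun hl => ⟨⟨fun l hl => ?_, ?_⟩, ?_, ?_, ?_, ?_⟩⟩
    · have := g1.var l hl
      simp [show l ≠ 6 by omega, show l ≠ 12 by omega, this]
    · exact g1.real
    · simpa using g2
    · simpa using g3
    · simp [NatExpr.eval, g4]
    · rw [hr, if_pos hl]; simp [NatExpr.eval, g5]; omega
    · have := g1.var l hl
      simp [show l ≠ 6 by omega, this]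
    · exact g1.real
    · simpa using g2
    · simpa using g3
    · simp [NatExpr.eval, g4]
    · rw [hr, if_neg hl]; simp [g5]
  · exact ⟨⟨fun _ _ => rfl, rfl⟩, h5, rfl, h6, by simpa using h12⟩
  · rintro s' ⟨g1, g2, g3, -, g5⟩
    refine ⟨g1, g2, g3, ?_⟩
    rw [g5, rank]

theorem runs_rankProgram : ∃ K : ℕ, ∀ (n m p : ℕ) (P : ℕ → Point) (s : State),
    (∀ i < n + m, ∀ j < n + m, i ≠ j → P i ≠ P j) → Base n m p P s → (∀ a i, s.natArr a i = 0) →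
    Runs rankProgram s (K * (n + m + 1) ^ 2) (fun s' => ∃ π, Sorting (n + m) P π ∧
      Sorted n m p P π s' ∧ ∀ i, s'.natArr 2 i = 0 ∧ s'.natArr 3 i = 0) := by
  obtain ⟨K, hK⟩ := runs_rankCount
  refine ⟨(Program.setNat 5 (.const 0)).maxCost + ((Cond.natLt (.var 5) (.var 3)).cost + 1 +
    (rankInit.maxCost + (K + rankStore.maxCost))), ?_⟩
  intro n m p P s hP hB hz
  have hrank : ∀ i < n + m, ∀ j < n + m, rank (n + m) P i = rank (n + m) P j → i = j := by
    intro i hi j hj hij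
    by_contra hne
    rcases LexLt.total (hP i hi j hj hne) with h | h
    · exact (rank_lt hi h).ne hij
    · exact (rank_lt hj h).ne' hij
  refine (Runs.seq (Runs.of_wp (by simp [Program.Flat])
    (Q := fun s' => SameBase s s' ∧ s'.natArr = s.natArr ∧ s'.natVar 5 = 0) ?_)
    (fun s' hs' => Runs.forLoop (fun i s' => Base n m p P s' ∧ s'.natVar 5 = i ∧
      (∀ j < i, s'.natArr 1 (rank (n + m) P j) = j) ∧
      (∀ j ≤ i, s'.natArr 0 j = j * (n + m + 1)) ∧
      ∀ j, s'.natArr 2 j = 0 ∧ s'.natArr 3 j = 0)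
      (T := rankInit.maxCost + (K * (n + m + 1) + rankStore.maxCost))
      (Nat.zero_le (n + m)) ?_ ?_ ?_)).mono ?_ ?_
  · simp only [Program.wp, NatExpr.eval]
    refine ⟨⟨fun l hl => ?_, rfl⟩, rfl, by simp⟩
    simp [show l ≠ 5 by omega]
  · rintro i s' ⟨g1, g2, -⟩
    simp [Cond.Holds, NatExpr.eval, g2, g1.var3]
  · rintro i s₁ - hi ⟨g1, g2, g3, g4, g5⟩
    refine Runs.seq (Runs.of_wp (by simp [rankInit, Program.Flat, Program.block])
      (Q := fun s' => SameBase s₁ s' ∧ s'.natArr = s₁.natArr ∧ s'.natVar 5 = i ∧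
        s'.natVar 12 = 1 ∧ s'.natVar 6 = 0) ?_) (fun s₂ h₂ => Runs.seq
        (hK n m p P s₂ i hi (g1.of_same h₂.1) h₂.2.2.1 h₂.2.2.2.1 h₂.2.2.2.2) fun s₃ h₃ =>
          Runs.of_wp (by simp [rankStore, incr, Program.Flat, Program.block]) ?_)
    · simp only [rankInit, Program.block, Program.wp, NatExpr.eval]
      refine ⟨⟨fun l hl => ?_, rfl⟩, rfl, by simpa using g2, by simp, by simp⟩
      simp [show l ≠ 6 by omega, show l ≠ 12 by omega]
    · obtain ⟨k1, k2, -⟩ := h₂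
      obtain ⟨k3, k5, k4, k6⟩ := h₃
      have hB₃ := (g1.of_same k1).of_same k3
      rw [k2] at k4
      simp only [rankStore, incr, Program.block, Program.wp, NatExpr.eval]
      refine ⟨hB₃.of_same ⟨fun l hl => ?_, rfl⟩, by simp [k5], ?_, ?_, ?_⟩
      · simp [show l ≠ 5 by omega]
      · intro j hj
        simp only [State.natArr_setNat, State.natArr_storeNat, State.natVar_storeNat, k4, k5, k6]
        by_cases hji : j = i
        · simp [hji]
        · have : rank (n + m) P j ≠ rank (n + m) P i := fun h => hji (hrank j (by omega) i hi h)
          simp [this, g3 j (by omega)]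
      · intro j hj
        simp only [State.natArr_setNat, State.natArr_storeNat, State.natVar_storeNat, k4, k5, k6]
        by_cases hji : j = i + 1
        · simp [hji, g4 i le_rfl, hB₃.var4]; ring
        · simp [hji, g4 j (by omega)]
      · intro j
        simp [k4, g5 j]
  · obtain ⟨g1, g2, g3⟩ := hs'
    refine ⟨hB.of_same g1, g3, fun j hj => absurd hj (by omega), fun j hj => ?_, fun j => ?_⟩
    · rw [g2, hz]; simp; omega
    · rw [g2]; exact ⟨hz _ _, hz _ _⟩
  · have e1 := Nat.le_mul_of_pos_right (Program.setNat 5 (.const 0)).maxCost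
      (show 0 < (n + m + 1) ^ 2 by positivity)
    have e2 : (Cond.natLt (.var 5) (.var 3)).cost + 1 +
        (rankInit.maxCost + (K * (n + m + 1) + rankStore.maxCost)) ≤
        ((Cond.natLt (.var 5) (.var 3)).cost + 1 +
        (rankInit.maxCost + (K + rankStore.maxCost))) * (n + m + 1) := by
      generalize (Cond.natLt (.var 5) (.var 3)).cost + 1 = a
      generalize rankInit.maxCost = b
      generalize rankStore.maxCost = c
      nlinarith [Nat.zero_le (a * (n + m)), Nat.zero_le (b * (n + m)), Nat.zero_le (c * (n + m))]
    have e3 := Nat.mul_le_mul_right (n + m - 0 + 1) e2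
    refine (Nat.add_le_add e1 (e3.trans (le_of_eq ?_))).trans_eq (add_mul _ _ _).symm
    rw [Nat.sub_zero, mul_assoc, sq]
  · rintro s' ⟨g1, -, g3, g4, g5⟩
    exact ⟨s'.natArr 1, Sorting.of_rank hP g3, ⟨g1, g4, fun _ _ _ => rfl⟩, g5⟩

end RealRAM

/-! ### The program: computing the sorted lists of all lines -/

namespace RealRAM

section Programs

open NatExpr

/-- The address of the entry in row `i` and column `j` of a table. -/
def entry (i j : NatExpr) : NatExpr := .add (.get 0 i) j

/-- The point with label `i` in the sorted order. -/
def label (i : NatExpr) : NatExpr := .get 1 i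

/-- The points with labels `u`, `v`, `w` form a right turn. -/
def rightTurn (u v w : NatExpr) : Cond :=
  .realLt (.mul (.sub (absc (label v)) (absc (label u))) (.sub (ordi (label w)) (ordi (label u))))
    (.mul (.sub (ordi (label v)) (ordi (label u))) (.sub (absc (label w)) (absc (label u))))

/-- Inserts the crossing of the lines in the variables `5` and `6` into their lists. -/
def crossProgram : Program := .block [
  .setNat 11 (.get 3 (entry (var 5) (const 0))),
  .storeNat 2 (entry (var 6) (var 7)) (var 5),
  .storeNat 2 (entry (var 6) (var 5)) (var 8),
  .storeNat 2 (entry (var 5) (var 11)) (var 6),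
  .storeNat 2 (entry (var 5) (var 6)) (const 0),
  .storeNat 3 (entry (var 6) (var 8)) (var 5),
  .storeNat 3 (entry (var 6) (var 5)) (var 7),
  .storeNat 3 (entry (var 5) (const 0)) (var 6),
  .storeNat 3 (entry (var 5) (var 6)) (var 11),
  .setNat 9 (const 1),
  incr 10]

/-- Variable `5` is the new line `k`, variables `6` and `7` are the vertex `(c, d)`, and `8` is
scratch space. Variable `9` is the direction flag and `10` is one more than the number of crossed
lines. Array `2` holds successors, array `3` predecessors. -/
def rightProgram : Program := .block [
  .setNat 8 (.get 2 (entry (var 6) (var 7))),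
  .cond (.and (.not (.natEq (var 8) (const 0)))
      (.and (.natLt (var 8) (var 6)) (rightTurn (var 6) (var 8) (var 5))))
    (.block [.setNat 7 (var 6), .setNat 6 (var 8)])
    crossProgram]

/-- The three cases are an unbounded cell, the leftmost vertex of a bounded one, and a floor that
continues; see `Walk.bottom`, `Walk.turn` and `Walk.floor`. -/
def leftProgram : Program :=
  .cond (.natEq (var 7) (const 0)) (.block [.setNat 6 (.sub (var 6) (const 1)), .setNat 9 (const 0)])
    (.block [.setNat 8 (var 6), .setNat 6 (var 7),
      .cond (.natLt (var 8) (var 7)) (.block [.setNat 7 (var 8), .setNat 9 (const 0)])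
        (.setNat 7 (.get 3 (entry (var 6) (var 8))))])

/-- One step of the walk along the line in the variable `5`. -/
def walkBody : Program := .cond (.natEq (var 9) (const 0)) rightProgram leftProgram

def walkInit : Program := .block [.setNat 6 (.sub (var 5) (const 1)), .setNat 7 (const 0),
  .setNat 9 (const 0), .setNat 10 (const 1)]

/-- Computes the lists of all lines by inserting one line after the other. -/
def listProgram : Program :=
  .seq (.setNat 5 (const 1)) (.loop (.natLt (var 5) (var 4))
    (.seq walkInit (.seq (.loop (.natLt (var 10) (var 5)) walkBody) (incr 5))))

end Programs

theorem Program.wp_seq (c₁ c₂ : Program) (Q : State → Prop) (s : State) :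
    (Program.seq c₁ c₂).wp Q s = c₁.wp (c₂.wp Q) s := rfl

theorem Program.wp_setNat {x v : ℕ} {e : NatExpr} {Q : State → Prop} {s : State}
    (he : e.eval s = v) (h : Q (s.setNat x v)) : (Program.setNat x e).wp Q s := by
  subst he; exact h

theorem Program.wp_storeNat {a x v : ℕ} {i e : NatExpr} {Q : State → Prop} {s : State}
    (hi : i.eval s = x) (he : e.eval s = v) (h : Q (s.storeNat a x v)) :
    (Program.storeNat a i e).wp Q s := by
  subst hi he; exact h

/-- A table stored row by row. -/
def table (M a : ℕ) (s : State) (i j : ℕ) : ℕ := s.natArr a (i * M + j)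

@[simp] theorem table_setNat (M a : ℕ) (s : State) (x v : ℕ) :
    table M a (s.setNat x v) = table M a s := rfl

theorem entry_inj {M i j i' j' : ℕ} (hj : j < M) (hj' : j' < M) :
    i * M + j = i' * M + j' ↔ i = i' ∧ j = j' := by
  constructor
  · intro h
    have h1 : i = i' := by
      have := congrArg (· / M) h
      simpa [Nat.add_div_of_dvd_right, Nat.mul_div_cancel _ (show 0 < M by omega),
        Nat.div_eq_of_lt hj, Nat.div_eq_of_lt hj'] using this
    subst h1
    exact ⟨rfl, by omega⟩
  · rintro ⟨rfl, rfl⟩; rfl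

/-- The dual arrangement of the sorted points. -/
structure Dual (N : ℕ) (φ : ℕ → Point) (R : Arrangement N) (a : ℕ → ℝ) : Prop where
  lt : ∀ i j, 1 ≤ i → i < j → j ≤ N → a i < a j
  det_eq : ∀ i j k, 1 ≤ i → i ≤ N → 1 ≤ j → j ≤ N → 1 ≤ k → k ≤ N → i ≠ j → i ≠ k →
    det (φ i) (φ j) (φ k) = (a j - a i) * (a k - a i) * (R.x i k - R.x i j)

/-- The sorted order fixes the signs of `a e - a c` and `a k - a c`, so an orientation test compares
the abscissae of two crossings without evaluating either. -/
theorem Dual.x_lt_iff {N : ℕ} {φ : ℕ → Point} {R : Arrangement N} {a : ℕ → ℝ} (h : Dual N φ R a)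
    {e c k : ℕ} (he : 1 ≤ e) (hec : e < c) (hck : c < k) (hk : k ≤ N) :
    R.x c e < R.x c k ↔ det (φ c) (φ e) (φ k) < 0 := by
  rw [h.det_eq c e k (by omega) (by omega) he (by omega) (by omega) hk (by omega) (by omega)]
  have h1 := h.lt e c he hec (by omega)
  have h2 := h.lt c k (by omega) hck hk
  have h3 : (a e - a c) * (a k - a c) < 0 := mul_neg_of_neg_of_pos (by linarith) (by linarith)
  rw [mul_neg_iff]
  constructor
  · intro h4; exact Or.inr ⟨h3, by linarith⟩
  · rintro (⟨h4, -⟩ | ⟨-, h4⟩)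
    · linarith
    · linarith

variable {n m p : ℕ} {P : ℕ → Point} {π : ℕ → ℕ}

theorem Sorted.of_same {s s' : State} (h : Sorted n m p P π s) (hs : SameBase s s')
    (h0 : s'.natArr 0 = s.natArr 0) (h1 : s'.natArr 1 = s.natArr 1) : Sorted n m p P π s' where
  toBase := h.toBase.of_same hs
  row := by rw [h0]; exact h.row
  pos := by rw [h1]; exact h.pos

theorem holds_rightTurn {s : State} (h : Sorted n m p P π s) (hπ : Sorting (n + m) P π)
    {u v w : NatExpr} (hu : 1 ≤ u.eval s) (huN : u.eval s ≤ n + m) (hv : 1 ≤ v.eval s)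
    (hvN : v.eval s ≤ n + m) (hw : 1 ≤ w.eval s) (hwN : w.eval s ≤ n + m) :
    (rightTurn u v w).Holds s ↔
      det (P (π (u.eval s))) (P (π (v.eval s))) (P (π (w.eval s))) < 0 := by
  simp only [rightTurn, Cond.Holds, RealExpr.eval, absc, ordi, label, NatExpr.eval,
    h.pos _ hu huN, h.pos _ hv hvN, h.pos _ hw hwN, h.absc _ (hπ.lt _ hu huN),
    h.absc _ (hπ.lt _ hv hvN), h.absc _ (hπ.lt _ hw hwN), h.ordi _ (hπ.lt _ hu huN),
    h.ordi _ (hπ.lt _ hv hvN), h.ordi _ (hπ.lt _ hw hwN), det, sub_neg]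

/-- The contents of the memory during the insertion of the line `k`. -/
def Walking (n m p : ℕ) (P : ℕ → Point) (π : ℕ → ℕ) (R : Arrangement (n + m)) (k r : ℕ)
    (s : State) : Prop :=
  Sorted n m p P π s ∧ s.natVar 5 = k ∧ ∃ A : Finset ℕ, s.natVar 10 = A.card + 1 ∧
    ((s.natVar 9 = 0 ∧ R.WalkInv k (table (n + m + 1) 2 s) (table (n + m + 1) 3 s) False
        (s.natVar 6) (s.natVar 7) A r) ∨
      (s.natVar 9 = 1 ∧ R.WalkInv k (table (n + m + 1) 2 s) (table (n + m + 1) 3 s) True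
        (s.natVar 6) (s.natVar 7) A r))

variable {R : Arrangement (n + m)} {a : ℕ → ℝ}

theorem walking_of_cross {s s' : State} {k c d r : ℕ} {A : Finset ℕ}
    (hI : R.WalkInv k (table (n + m + 1) 2 s) (table (n + m + 1) 3 s) False c d A r)
    (hk : k ≤ n + m)
    (hcr : ¬ (table (n + m + 1) 2 s c d ≠ 0 ∧ table (n + m + 1) 2 s c d < c ∧
      R.x c (table (n + m + 1) 2 s c d) < R.x c k)) (hs : Sorted n m p P π s')
    (h5 : s'.natVar 5 = k) (h6 : s'.natVar 6 = c) (h7 : s'.natVar 7 = d) (h9 : s'.natVar 9 = 1)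
    (h10 : s'.natVar 10 = A.card + 1 + 1)
    (hnx : ∀ i j, i ≤ n + m → j ≤ n + m → table (n + m + 1) 2 s' i j =
      if i = k ∧ j = c then 0 else if i = k ∧ j = table (n + m + 1) 3 s k 0
      then c else if i = c ∧ j = k then table (n + m + 1) 2 s c d else if i = c ∧ j = d then k
      else table (n + m + 1) 2 s i j)
    (hpv : ∀ i j, i ≤ n + m → j ≤ n + m → table (n + m + 1) 3 s' i j =
      if i = k ∧ j = c then table (n + m + 1) 3 s k 0 else if i = k ∧ j = 0
      then c else if i = c ∧ j = k then d else if i = c ∧ j = table (n + m + 1) 2 s c d then k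
      else table (n + m + 1) 3 s i j) :
    ∃ r' < r, Walking n m p P π R k r' s' := by
  obtain ⟨hcA, r', hr', hI'⟩ := hI.cross hk hcr hnx hpv
  refine ⟨r', hr', hs, h5, insert c A, ?_, Or.inr ⟨h9, ?_⟩⟩
  · rw [h10, Finset.card_insert_of_notMem hcA]
  · rw [h6, h7]; exact hI'

theorem wp_crossProgram {s : State} {k c d r : ℕ} {A : Finset ℕ} (hs : Sorted n m p P π s)
    (h5 : s.natVar 5 = k) (h6 : s.natVar 6 = c) (h7 : s.natVar 7 = d)
    (h10 : s.natVar 10 = A.card + 1) (hk : k ≤ n + m)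
    (hI : R.WalkInv k (table (n + m + 1) 2 s) (table (n + m + 1) 3 s) False c d A r)
    (h8 : s.natVar 8 = table (n + m + 1) 2 s c d)
    (hcr : ¬ (table (n + m + 1) 2 s c d ≠ 0 ∧ table (n + m + 1) 2 s c d < c ∧
      R.x c (table (n + m + 1) 2 s c d) < R.x c k)) :
    crossProgram.wp (fun s' => ∃ r' < r, Walking n m p P π R k r' s') s := by
  have hc := hI.2.1.c_lt
  have hc1 := hI.2.1.one_le
  have hd := hI.2.1.d_lt
  have hL := hI.1 k (by omega) hk
  have hl : table (n + m + 1) 3 s k 0 ≤ n + m :=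
    Arrangement.nodes_le hk hI.2.1.mem_range (hL.pv_mem 0 (Or.inl rfl))
  have he := (Arrangement.WalkInv.right_gap hI.1 hk hI.2.1).1
  have hrc := hs.row c (by omega)
  have hrk := hs.row k hk
  have hev : s.natArr 3 (k * (n + m + 1)) = table (n + m + 1) 3 s k 0 := by
    simp [table]
  set M := n + m + 1 with hM
  set e := table M 2 s c d with he_def
  set l := table M 3 s k 0 with hl_def
  have hT : ∀ i j i' j', j ≤ n + m → j' ≤ n + m → (i * M + j = i' * M + j' ↔
      i = i' ∧ j = j') := fun i j i' j' hj hj' => entry_inj (by omega) (by omega)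
  have hee : s.natArr 2 (c * M + d) = e := rfl
  simp only [crossProgram, Program.block, Program.wp_seq, incr]
  -- The last node of line `k` is read before anything is overwritten. Later stores take precedence,
  -- in the order of the nested conditions of `Stage.cross`. The indices `d`, `e` and `l` may be 0,
  -- the sentinel column.
  refine Program.wp_setNat (v := l) (by simp [NatExpr.eval, entry, h5, hrk, hev]) ?_
  refine Program.wp_storeNat (x := c * M + d) (v := k)
    (by simp [NatExpr.eval, entry, h6, h7, hrc]) (by simp [NatExpr.eval, h5]) ?_
  refine Program.wp_storeNat (x := c * M + k) (v := e)
    (by simp [NatExpr.eval, entry, h6, h5, hrc]) (by simp [NatExpr.eval, h8]) ?_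
  refine Program.wp_storeNat (x := k * M + l) (v := c)
    (by simp [NatExpr.eval, entry, h5, hrk]) (by simp [NatExpr.eval, h6]) ?_
  refine Program.wp_storeNat (x := k * M + c) (v := 0)
    (by simp [NatExpr.eval, entry, h6, h5, hrk]) (by simp [NatExpr.eval]) ?_
  refine Program.wp_storeNat (x := c * M + e) (v := k)
    (by simp [NatExpr.eval, entry, h6, h8, hrc]) (by simp [NatExpr.eval, h5]) ?_
  refine Program.wp_storeNat (x := c * M + k) (v := d)
    (by simp [NatExpr.eval, entry, h6, h5, hrc]) (by simp [NatExpr.eval, h7]) ?_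
  refine Program.wp_storeNat (x := k * M + 0) (v := c)
    (by simp [NatExpr.eval, entry, h5, hrk]) (by simp [NatExpr.eval, h6]) ?_
  refine Program.wp_storeNat (x := k * M + c) (v := l)
    (by simp [NatExpr.eval, entry, h6, h5, hrk]) (by simp [NatExpr.eval]) ?_
  refine Program.wp_setNat (v := 1) (by simp [NatExpr.eval]) ?_
  refine Program.wp_setNat (v := A.card + 1 + 1) (by simp [NatExpr.eval, h10]) ?_
  refine walking_of_cross hI hk hcr (hs.of_same ⟨fun i hi => ?_, rfl⟩ (by ext; simp) (by ext; simp))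
    (by simp [h5]) (by simp [h6]) (by simp [h7]) (by simp) (by simp) (fun i j hi hj => ?_)
    (fun i j hi hj => ?_)
  · simp [show i ≠ 10 by omega, show i ≠ 9 by omega, show i ≠ 11 by omega]
  · simp [table, hT i j _ _ hj hl, hT i j _ c hj (by omega), hT i j _ d hj (by omega),
      hT i j _ k hj hk, hev, hee, ← hM]
  · have hT0 : i * M + j = k * M ↔ i = k ∧ j = 0 := hT i j k 0 hj (by omega)
    simp [table, hT i j _ e hj (by omega), hT i j _ c hj (by omega), hT0, hT i j _ k hj hk, hev,
      hee, ← hM]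

theorem wp_rightProgram {s : State} {k r : ℕ} {A : Finset ℕ} (hs : Sorted n m p P π s)
    (hπ : Sorting (n + m) P π) (hR : Dual (n + m) (fun i => P (π i)) R a)
    (h5 : s.natVar 5 = k) (h9 : s.natVar 9 = 0) (h10 : s.natVar 10 = A.card + 1) (hk : k ≤ n + m)
    (hI : R.WalkInv k (table (n + m + 1) 2 s) (table (n + m + 1) 3 s) False
      (s.natVar 6) (s.natVar 7) A r) :
    rightProgram.wp (fun s' => ∃ r' < r, Walking n m p P π R k r' s') s := by
  generalize h6 : s.natVar 6 = c at hI
  generalize h7 : s.natVar 7 = d at hI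
  have hc := hI.2.1.c_lt
  have hc1 := hI.2.1.one_le
  have he := (Arrangement.WalkInv.right_gap hI.1 hk hI.2.1).1
  simp only [rightProgram, Program.block, Program.wp_seq]
  refine Program.wp_setNat (v := table (n + m + 1) 2 s c d)
    (by simp [NatExpr.eval, entry, h6, h7, hs.row c (by omega), table]) ?_
  set e := table (n + m + 1) 2 s c d with he_def
  have hs' : Sorted n m p P π (s.setNat 8 e) :=
    hs.of_same ⟨fun i hi => by simp [show i ≠ 8 by omega], rfl⟩ rfl rfl
  have hcond : (Cond.and (.not (.natEq (.var 8) (.const 0)))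
      (.and (.natLt (.var 8) (.var 6)) (rightTurn (.var 6) (.var 8) (.var 5)))).Holds
      (s.setNat 8 e) ↔ e ≠ 0 ∧ e < c ∧ R.x c e < R.x c k := by
    simp only [Cond.Holds]
    have e1 : (NatExpr.var 8).eval (s.setNat 8 e) = e := by simp [NatExpr.eval]
    have e2 : (NatExpr.var 6).eval (s.setNat 8 e) = c := by simp [NatExpr.eval, h6]
    have e3 : (NatExpr.var 5).eval (s.setNat 8 e) = k := by simp [NatExpr.eval, h5]
    rw [e1, e2]
    refine and_congr_right fun h0 => and_congr_right fun hec => ?_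
    have he1 : 1 ≤ e := Nat.one_le_iff_ne_zero.2 h0
    rw [holds_rightTurn hs' hπ (by rw [e2]; omega) (by rw [e2]; omega) (by rw [e1]; omega)
      (by rw [e1]; omega) (by rw [e3]; omega) (by rw [e3]; omega), e1, e2, e3]
    exact (hR.x_lt_iff he1 hec hc hk).symm
  refine ⟨fun hcd => ?_, fun hcd => ?_⟩
  · rw [hcond] at hcd
    obtain ⟨r', hr', hI'⟩ := hI.ceiling hk hcd.1 (by exact hcd.2.2)
    refine Program.wp_setNat (v := c) (by simp [NatExpr.eval, h6])
      (Program.wp_setNat (v := e) (by simp [NatExpr.eval]) ?_)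
    refine ⟨r', hr', hs'.of_same ⟨fun i hi => ?_, rfl⟩ rfl rfl, by simpa using h5, A,
      by simpa using h10, Or.inl ⟨by simpa using h9, by simpa using hI'⟩⟩
    simp [show i ≠ 6 by omega, show i ≠ 7 by omega]
  · rw [hcond] at hcd
    exact wp_crossProgram hs' (by simpa using h5) (by simpa using h6) (by simpa using h7)
      (by simpa using h10) hk hI (by simp [e, table]) hcd

theorem wp_leftProgram {s : State} {k r : ℕ} {A : Finset ℕ} (hs : Sorted n m p P π s)
    (h5 : s.natVar 5 = k) (h9 : s.natVar 9 = 1) (h10 : s.natVar 10 = A.card + 1) (hk : k ≤ n + m)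
    (hA : A.card + 1 < k)
    (hI : R.WalkInv k (table (n + m + 1) 2 s) (table (n + m + 1) 3 s) True
      (s.natVar 6) (s.natVar 7) A r) :
    leftProgram.wp (fun s' => ∃ r' < r, Walking n m p P π R k r' s') s := by
  generalize h6 : s.natVar 6 = c at hI
  generalize h7 : s.natVar 7 = d at hI
  have hd := hI.2.1.d_lt
  refine ⟨fun h0 => ?_, fun h0 => ?_⟩
  · have h0 : d = 0 := by simpa [Cond.Holds, NatExpr.eval, h7] using h0
    subst h0
    obtain ⟨r', hr', hI'⟩ := hI.bottom hk hA
    refine Program.wp_setNat (v := c - 1) (by simp [NatExpr.eval, h6])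
      (Program.wp_setNat (v := 0) (by simp [NatExpr.eval]) ?_)
    refine ⟨r', hr', hs.of_same ⟨fun i hi => ?_, rfl⟩ rfl rfl, by simpa using h5, A,
      by simpa using h10, Or.inl ⟨by simp, by simpa [h7] using hI'⟩⟩
    simp [show i ≠ 6 by omega, show i ≠ 9 by omega]
  · have h0 : d ≠ 0 := by simpa [Cond.Holds, NatExpr.eval, h7] using h0
    refine Program.wp_setNat (v := c) (by simp [NatExpr.eval, h6])
      (Program.wp_setNat (v := d) (by simp [NatExpr.eval, h7]) ⟨fun hcd => ?_, fun hcd => ?_⟩)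
    · have hcd : c < d := by simpa [Cond.Holds, NatExpr.eval, h7] using hcd
      obtain ⟨r', hr', hI'⟩ := hI.turn hk hA hcd
      refine Program.wp_setNat (v := c) (by simp [NatExpr.eval])
        (Program.wp_setNat (v := 0) (by simp [NatExpr.eval]) ?_)
      refine ⟨r', hr', hs.of_same ⟨fun i hi => ?_, rfl⟩ rfl rfl, by simpa using h5, A,
        by simpa using h10, Or.inl ⟨by simp, by simpa using hI'⟩⟩
      simp [show i ≠ 6 by omega, show i ≠ 7 by omega, show i ≠ 8 by omega, show i ≠ 9 by omega]
    · have hcd : ¬ c < d := by simpa [Cond.Holds, NatExpr.eval, h7] using hcd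
      have hne := hI.2.1.ne
      obtain ⟨r', hr', hI'⟩ := hI.floor hk h0 (by omega)
      refine Program.wp_setNat (v := table (n + m + 1) 3 s d c)
        (by simp [NatExpr.eval, entry, hs.row d (by omega), table]) ?_
      refine ⟨r', hr', hs.of_same ⟨fun i hi => ?_, rfl⟩ rfl rfl, by simpa using h5, A,
        by simpa using h10, Or.inr ⟨by simpa using h9, by simpa using hI'⟩⟩
      simp [show i ≠ 6 by omega, show i ≠ 7 by omega, show i ≠ 8 by omega]

theorem flat_walkBody : walkBody.Flat := by
  simp [walkBody, rightProgram, leftProgram, crossProgram, incr, Program.Flat, Program.block]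

theorem runs_walkLoop {s : State} {k r : ℕ} (hπ : Sorting (n + m) P π)
    (hR : Dual (n + m) (fun i => P (π i)) R a) (hk : k ≤ n + m) (h : Walking n m p P π R k r s) :
    Runs (.loop (.natLt (.var 10) (.var 5)) walkBody) s
      (((Cond.natLt (.var 10) (.var 5)).cost + 1 + walkBody.maxCost) * (r + 1)) (fun s' =>
        Sorted n m p P π s' ∧ s'.natVar 5 = k ∧
        R.Stage (k + 1) ∅ (table (n + m + 1) 2 s') (table (n + m + 1) 3 s')) := by
  refine (Runs.loop (T := walkBody.maxCost) (Walking n m p P π R k) ?_ r s h).mono ?_ ?_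
  · rintro r s ⟨hs, h5, A, h10, hI⟩ hb
    -- The counter exceeds the number of crossed lines by one, so the loop runs exactly while some
    -- of the `k - 1` earlier lines is uncrossed.
    have hA : A.card + 1 < k := by simpa [Cond.Holds, NatExpr.eval, h5, h10] using hb
    refine Runs.of_wp flat_walkBody ⟨fun h9 => ?_, fun h9 => ?_⟩
    · have h9 : s.natVar 9 = 0 := by simpa [Cond.Holds, NatExpr.eval] using h9
      obtain ⟨-, hI⟩ := hI.resolve_right (by omega)
      exact wp_rightProgram hs hπ hR h5 h9 h10 hk hI
    · have h9 : s.natVar 9 ≠ 0 := by simpa [Cond.Holds, NatExpr.eval] using h9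
      obtain ⟨h9, hI⟩ := hI.resolve_left (by omega)
      exact wp_leftProgram hs h5 h9 h10 hk hA hI
  · rw [Nat.mul_succ]; omega
  · rintro s' ⟨hb, r', hs, h5, A, h10, hI⟩
    have hA : ¬ A.card + 1 < k := by simpa [Cond.Holds, NatExpr.eval, h5, h10] using hb
    refine ⟨hs, h5, ?_⟩
    rcases hI with ⟨-, hI⟩ | ⟨-, hI⟩
    · have := hI.eq_Ico (by omega)
      subst this
      exact hI.1.succ
    · have := hI.eq_Ico (by omega)
      subst this
      exact hI.1.succ

theorem runs_listProgram : ∃ K : ℕ, ∀ (n m p : ℕ) (P : ℕ → Point) (π : ℕ → ℕ)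
    (R : Arrangement (n + m)) (a : ℕ → ℝ) (s : State), Sorting (n + m) P π →
    Dual (n + m) (fun i => P (π i)) R a → Sorted n m p P π s →
    (∀ i, s.natArr 2 i = 0 ∧ s.natArr 3 i = 0) →
    Runs listProgram s (K * (n + m + 1) ^ 2) (fun s' => Sorted n m p P π s' ∧
      R.Stage (n + m + 1) ∅ (table (n + m + 1) 2 s') (table (n + m + 1) 3 s')) := by
  set K₁ := (Cond.natLt (.var 10) (.var 5)).cost + 1 + walkBody.maxCost with hK₁
  refine ⟨(Program.setNat 5 (.const 1)).maxCost + ((Cond.natLt (.var 5) (.var 4)).cost + 1 +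
    (walkInit.maxCost + (4 * K₁ + (incr 5).maxCost))), ?_⟩
  intro n m p P π R a s hπ hR hs hz
  refine (Runs.seq (Runs.of_wp (by simp [Program.Flat])
    (Q := fun s' => Sorted n m p P π s' ∧ s'.natArr = s.natArr ∧ s'.natVar 5 = 1) ?_)
    (fun s₁ hs₁ => Runs.forLoop (fun k s' => Sorted n m p P π s' ∧ s'.natVar 5 = k ∧
      R.Stage k ∅ (table (n + m + 1) 2 s') (table (n + m + 1) 3 s')) (lo := 1) (hi := n + m + 1)
      (T := walkInit.maxCost + (K₁ * (4 * (n + m) + 1) + (incr 5).maxCost))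
      (by omega) ?_ ?_ ?_)).mono ?_ ?_
  · simp only [Program.wp, NatExpr.eval]
    refine ⟨hs.of_same ⟨fun i hi => ?_, rfl⟩ rfl rfl, rfl, by simp⟩
    simp [show i ≠ 5 by omega]
  · rintro k s' ⟨g1, g2, -⟩
    simp [Cond.Holds, NatExpr.eval, g2, g1.var4]
  · rintro k s₁ h1 h2 ⟨g1, g2, g3⟩
    refine Runs.seq (Runs.of_wp (by simp [walkInit, Program.Flat, Program.block])
      (Q := fun s' => Sorted n m p P π s' ∧ s'.natArr = s₁.natArr ∧ s'.natVar 5 = k ∧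
        s'.natVar 6 = k - 1 ∧ s'.natVar 7 = 0 ∧ s'.natVar 9 = 0 ∧ s'.natVar 10 = 1) ?_)
      (fun s₂ h₂ => Runs.seq (R := fun s' => Sorted n m p P π s' ∧ s'.natVar 5 = k ∧
        R.Stage (k + 1) ∅ (table (n + m + 1) 2 s') (table (n + m + 1) 3 s')) ?_ fun s₃ h₃ =>
          Runs.of_wp (by simp [incr, Program.Flat]) ?_)
    · simp only [walkInit, Program.block, Program.wp, NatExpr.eval]
      refine ⟨g1.of_same ⟨fun i hi => ?_, rfl⟩ rfl rfl, rfl, by simpa using g2, by simp [g2],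
        by simp, by simp, by simp⟩
      simp [show i ≠ 6 by omega, show i ≠ 7 by omega, show i ≠ 9 by omega, show i ≠ 10 by omega]
    · obtain ⟨k1, k2, k5, k6, k7, k9, k10⟩ := h₂
      have g3' : R.Stage k ∅ (table (n + m + 1) 2 s₂) (table (n + m + 1) 3 s₂) := by
        have : table (n + m + 1) 2 s₂ = table (n + m + 1) 2 s₁ ∧
            table (n + m + 1) 3 s₂ = table (n + m + 1) 3 s₁ := by
          simp only [funext_iff, table, k2, implies_true, and_self]
        rw [this.1, this.2]; exact g3
      -- The first line has nothing to cross: the loop body is not entered, and `Finset.Ico 1 1` is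
      -- empty.
      rcases Nat.eq_or_lt_of_le h1 with h1 | h1
      · subst h1
        refine ⟨_, s₂, Exec.loopDone (by simp [Cond.Holds, NatExpr.eval, k5, k10]), ?_, k1, k5, ?_⟩
        · refine le_trans ?_ (Nat.le_mul_of_pos_right _ (by omega))
          rw [hK₁]; omega
        · exact Arrangement.Stage.succ (by simpa using g3')
      · refine (runs_walkLoop (r := 4 * k) hπ hR (by omega)
          ⟨k1, k5, ∅, by simpa using k10, Or.inl ⟨k9, ?_⟩⟩).mono ?_ fun _ => id
        · rw [k6, k7]; exact Arrangement.WalkInv.start g3' (by omega) h1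
        · exact Nat.mul_le_mul_left _ (by omega)
    · obtain ⟨k1, k2, k3⟩ := h₃
      simp only [incr, Program.wp, NatExpr.eval]
      refine ⟨k1.of_same ⟨fun i hi => ?_, rfl⟩ rfl rfl, by simp [k2], k3⟩
      simp [show i ≠ 5 by omega]
  · obtain ⟨g1, g2, g3⟩ := hs₁
    refine ⟨g1, g3, ?_⟩
    have : table (n + m + 1) 2 s₁ = (fun _ _ => 0) ∧ table (n + m + 1) 3 s₁ = (fun _ _ => 0) := by
      simp only [funext_iff, table, g2, hz, implies_true, and_self]
    rw [this.1, this.2]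
    exact Arrangement.Stage.zero R
  · have e1 := Nat.le_mul_of_pos_right (Program.setNat 5 (.const 1)).maxCost
      (show 0 < (n + m + 1) ^ 2 by positivity)
    have e2 : (Cond.natLt (.var 5) (.var 4)).cost + 1 +
        (walkInit.maxCost + (K₁ * (4 * (n + m) + 1) + (incr 5).maxCost)) ≤
        ((Cond.natLt (.var 5) (.var 4)).cost + 1 +
        (walkInit.maxCost + (4 * K₁ + (incr 5).maxCost))) * (n + m + 1) := by
      generalize (Cond.natLt (.var 5) (.var 4)).cost + 1 = a
      generalize walkInit.maxCost = b
      generalize (incr 5).maxCost = c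
      nlinarith [Nat.zero_le (a * (n + m)), Nat.zero_le (b * (n + m)), Nat.zero_le (c * (n + m))]
    have e3 := Nat.mul_le_mul_right (n + m + 1 - 1 + 1) e2
    refine (Nat.add_le_add e1 (e3.trans (le_of_eq ?_))).trans_eq (add_mul _ _ _).symm
    rw [Nat.add_sub_cancel, mul_assoc, sq]
  · rintro s' ⟨g1, -, g3⟩
    exact ⟨g1, g3⟩

end RealRAM

/-! ### Side counts along a rotating line -/

namespace Arrangement

variable {N : ℕ} (R : Arrangement N)

/-- The point with label `z` lies above the line through the points with labels `x` and `y`. -/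
def Above (x y z : ℕ) : Prop := (x < z ∧ R.x x y < R.x x z) ∨ (z < x ∧ R.x x z < R.x x y)

open Classical in
/-- The number of points with labels in `T` above the line through `x` and `y`. -/
noncomputable def upper (T : Finset ℕ) (x y : ℕ) : ℝ :=
  ∑ z ∈ (T.erase x).erase y, if R.Above x y z then 1 else 0

open Classical in
/-- The number of points with labels in `T` below the line through `x` and `y`. -/
noncomputable def lower (T : Finset ℕ) (x y : ℕ) : ℝ :=
  ∑ z ∈ (T.erase x).erase y, if R.Above x y z then 0 else 1

/-- The sum of the products of the numbers of points on both sides over all lines through `x`. -/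
noncomputable def pencil (T : Finset ℕ) (x : ℕ) : ℝ :=
  ∑ y ∈ T.erase x, R.upper T x y * R.lower T x y

open Classical in
/-- The sum over all lines through `x` of the number of points on the side not containing `q`. -/
noncomputable def opposite (T : Finset ℕ) (x q : ℕ) : ℝ :=
  ∑ y ∈ T.erase x, if R.Above x y q then R.lower T x y else R.upper T x y

variable {R}

/-- A point to the right of `x` is above the line when its slope is larger, that is, when it has not
yet been passed; for a point to the left it is the reverse. -/
theorem above_iff {x y z : ℕ} {Z : Finset ℕ} (hzx : z ≠ x) (hne : R.x x z ≠ R.x x y)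
    (hZ : z ∈ Z ↔ R.x x z < R.x x y) : R.Above x y z ↔ (z ∈ Z ↔ z < x) := by
  unfold Above
  rw [hZ]
  rcases lt_or_gt_of_ne hne with h | h
  · simp [h, h.not_gt]
  · simp only [h, h.not_gt, and_true, and_false, or_false, false_iff, not_lt]
    omega

end Arrangement

/-- The number of points above a line rotating about the point `x`, after it has passed the points
in `Z`. -/
def upperAfter (T : Finset ℕ) (x : ℕ) (Z : Finset ℕ) : ℝ :=
  ∑ z ∈ T.erase x, if (z ∈ Z ↔ z < x) then 1 else 0

/-- The number of points below a line rotating about the point `x`, after it has passed the points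
in `Z`. -/
def lowerAfter (T : Finset ℕ) (x : ℕ) (Z : Finset ℕ) : ℝ :=
  ∑ z ∈ T.erase x, if (z ∈ Z ↔ z < x) then 0 else 1

section

variable {N : ℕ} {R : Arrangement N} {T Z : Finset ℕ} {x y : ℕ}

/-- The points other than `y` lie on the same sides just before and just after `y` is passed. Only
`y` changes sides: from above to below if it is to the right of `x`, from below to above otherwise.
-/
theorem upperAfter_eq (hy : y ∈ T.erase x) (hyZ : y ∉ Z)
    (hZ : ∀ z ∈ T.erase x, z ≠ y → R.x x z ≠ R.x x y ∧ (z ∈ Z ↔ R.x x z < R.x x y)) :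
    upperAfter T x Z = R.upper T x y + (if x < y then 1 else 0) ∧
    lowerAfter T x Z = R.lower T x y + (if x < y then 0 else 1) ∧
    upperAfter T x (insert y Z) = R.upper T x y + (if x < y then 0 else 1) ∧
    lowerAfter T x (insert y Z) = R.lower T x y + (if x < y then 1 else 0) := by
  classical
  have hyx : y ≠ x := (Finset.mem_erase.1 hy).1
  have h1 : ∀ z ∈ (T.erase x).erase y, R.Above x y z ↔ (z ∈ Z ↔ z < x) := by
    intro z hz
    obtain ⟨hzy, hz⟩ := Finset.mem_erase.1 hz
    exact Arrangement.above_iff (Finset.mem_erase.1 hz).1 (hZ z hz hzy).1 (hZ z hz hzy).2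
  have h2 : ∀ z ∈ (T.erase x).erase y, R.Above x y z ↔ (z ∈ insert y Z ↔ z < x) := by
    intro z hz
    rw [h1 z hz, Finset.mem_insert]
    simp [(Finset.mem_erase.1 hz).1]
  have hlt : y < x ↔ ¬ x < y := by omega
  unfold upperAfter lowerAfter Arrangement.upper Arrangement.lower
  refine ⟨?_, ?_, ?_, ?_⟩
  · rw [← Finset.add_sum_erase _ _ hy, add_comm]
    congr 1
    · exact Finset.sum_congr rfl fun z hz => by simp only [h1 z hz]
    · simp [hyZ, hlt]
  · rw [← Finset.add_sum_erase _ _ hy, add_comm]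
    congr 1
    · exact Finset.sum_congr rfl fun z hz => by simp only [h1 z hz]
    · simp [hyZ, hlt]
  · rw [← Finset.add_sum_erase _ _ hy, add_comm]
    congr 1
    · exact Finset.sum_congr rfl fun z hz => by simp only [h2 z hz]
    · simp only [Finset.mem_insert_self, true_iff, hlt, ite_not]
  · rw [← Finset.add_sum_erase _ _ hy, add_comm]
    congr 1
    · exact Finset.sum_congr rfl fun z hz => by simp only [h2 z hz]
    · simp only [Finset.mem_insert_self, true_iff, hlt, ite_not]

theorem after_insert_of_notMem (hy : y ∉ T.erase x) :
    upperAfter T x (insert y Z) = upperAfter T x Z ∧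
    lowerAfter T x (insert y Z) = lowerAfter T x Z := by
  have h : ∀ z ∈ T.erase x, (z ∈ insert y Z ↔ z ∈ Z) := by
    intro z hz
    have : z ≠ y := by rintro rfl; exact hy hz
    simp [this]
  exact ⟨Finset.sum_congr rfl fun z hz => by simp only [h z hz],
    Finset.sum_congr rfl fun z hz => by simp only [h z hz]⟩

theorem sum_ite_mem_insert {S : Finset ℕ} (hy : y ∈ S) (hyZ : y ∉ Z) (f : ℕ → ℝ) :
    ∑ z ∈ S, (if z ∈ insert y Z then f z else 0) = ∑ z ∈ S, (if z ∈ Z then f z else 0) + f y := by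
  rw [← Finset.add_sum_erase _ _ hy, ← Finset.add_sum_erase _ (fun z => if z ∈ Z then f z else 0) hy,
    if_pos (Finset.mem_insert_self _ _), if_neg hyZ, zero_add, add_comm]
  congr 1
  refine Finset.sum_congr rfl fun z hz => ?_
  simp [(Finset.mem_erase.1 hz).1]

theorem sum_ite_mem_insert_of_notMem {S : Finset ℕ} (hy : y ∉ S) (f : ℕ → ℝ) :
    ∑ z ∈ S, (if z ∈ insert y Z then f z else 0) = ∑ z ∈ S, (if z ∈ Z then f z else 0) := by
  refine Finset.sum_congr rfl fun z hz => ?_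
  have : z ≠ y := by rintro rfl; exact hy hz
  simp [this]

theorem sum_range_ite_mem {S : Finset ℕ} (hS : ∀ z ∈ S, z ≤ N) (f : ℕ → ℝ) :
    ∑ z ∈ Finset.range (N + 1), (if z ∈ S then f z else 0) = ∑ z ∈ S, f z := by
  rw [Finset.sum_ite_mem, Finset.inter_eq_right.2]
  intro z hz
  have := hS z hz
  exact Finset.mem_range.2 (by omega)

end

/-! ### The program: rotating about every point and summing -/

namespace RealRAM

section Programs

open NatExpr

/-- The point with the given label is kept. -/
def keptCond (v : NatExpr) : Cond :=
  .and (.natLt (label v) (var 0)) (.not (.natEq (label v) (var 2)))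

/-- The point with the given label is a candidate. -/
def candCond (v : NatExpr) : Cond := .not (.natLt (label v) (var 0))

def addReal (x : ℕ) (e : RealExpr) : Program := .setReal x (.add (.var x) e)

def countInit : Program := .block [.setReal 0 (.ofNat (const 0)), .setReal 1 (.ofNat (const 0)),
  .setNat 6 (const 1)]

def countBody : Program := .block [
  .cond (keptCond (var 6)) (.cond (.natLt (var 5) (var 6)) (addReal 0 (.ofNat (const 1)))
    (.cond (.natLt (var 6) (var 5)) (addReal 1 (.ofNat (const 1))) .skip)) .skip,
  incr 6]

/-- Counts the points above and below a vertical line through the point in the variable `5`. -/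
def initialCount : Program := .seq countInit (.loop (.natLt (var 6) (var 4)) countBody)

def rotateInit : Program := .block [.setReal 2 (.ofNat (const 0)), .setReal 3 (.ofNat (const 0)),
  .setReal 4 (.ofNat (const 0)), .setNat 13 (.get 2 (entry (var 5) (const 0)))]

/-- The rotating line passes a point. -/
def passProgram : Program := .block [
  .cond (.natLt (var 5) (var 13)) (.setReal 0 (.sub (.var 0) (.ofNat (const 1))))
    (.setReal 1 (.sub (.var 1) (.ofNat (const 1)))),
  addReal 2 (.mul (.var 0) (.var 1)),
  addReal 3 (.var 0),
  addReal 4 (.var 1),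
  .cond (.natLt (var 5) (var 13)) (addReal 1 (.ofNat (const 1))) (addReal 0 (.ofNat (const 1)))]

/-- The difference is stored at every label, kept or not, since the candidates are the ones that
need it. It is stored before the contribution of the passed point is added, in accordance with the
strict inequality in `balance`. -/
def rotateBody : Program := .block [
  .storeReal 5 (var 13) (.sub (.var 4) (.var 3)),
  .cond (keptCond (var 13)) passProgram .skip,
  .setNat 13 (.get 2 (entry (var 5) (var 13)))]

/-- Rotates a line about the point in the variable `5`. -/
def rotate : Program := .seq rotateInit (.loop (.not (.natEq (var 13) (const 0))) rotateBody)

def addBody : Program := .block [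
  .cond (candCond (var 6)) (.cond (.natLt (var 5) (var 6))
    (.storeReal 6 (var 6) (.add (.get 6 (var 6)) (.add (.get 5 (var 6)) (.var 3))))
    (.storeReal 6 (var 6) (.add (.get 6 (var 6)) (.sub (.var 4) (.get 5 (var 6)))))) .skip,
  incr 6]

def addInit : Program := .block [addReal 5 (.var 2), .setNat 6 (const 1)]

/-- Each line through the candidate is counted in both orders of its two points, hence twice the
pencil sum. -/
def addOwn : Program := .cond (candCond (var 5))
  (.storeReal 6 (var 5) (.add (.get 6 (var 5)) (.add (.var 2) (.var 2)))) .skip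

/-- Adds the contributions of the lines through the point in the variable `5`. -/
def contribute : Program := .cond (keptCond (var 5))
  (.seq addInit (.loop (.natLt (var 6) (var 4)) addBody)) addOwn

def sumInit : Program := .block [.setNat 5 (const 1), .setReal 5 (.ofNat (const 0))]

def sumProgram : Program := .seq sumInit (.loop (.natLt (var 5) (var 4))
  (.seq initialCount (.seq rotate (.seq contribute (incr 5)))))

/-- The number of points minus a constant. -/
def sizeSub (k : ℕ) : RealExpr := .sub (.ofNat (var 0)) (.ofNat (const k))

def outBody : Program := .block [
  .cond (candCond (var 6)) (.storeReal 4 (.sub (label (var 6)) (var 0))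
    (.sub (.div (.mul (.mul (.mul (sizeSub 0) (sizeSub 1)) (sizeSub 2)) (sizeSub 3))
      (.ofNat (const 8))) (.div (.add (.var 5) (.get 6 (var 6))) (.ofNat (const 2))))) .skip,
  incr 6]

/-- Computes the output. -/
def outProgram : Program := .seq (.setNat 6 (const 1)) (.loop (.natLt (var 6) (var 4)) outBody)

end Programs

theorem Program.wp_setReal {x : ℕ} {v : ℝ} {e : RealExpr} {Q : State → Prop} {s : State}
    (he : e.eval s = v) (h : Q (s.setReal x v)) : (Program.setReal x e).wp Q s := by
  subst he; exact h

theorem Program.wp_storeReal {a x : ℕ} {v : ℝ} {i : NatExpr} {e : RealExpr} {Q : State → Prop}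
    {s : State} (hi : i.eval s = x) (he : e.eval s = v) (h : Q (s.storeReal a x v)) :
    (Program.storeReal a i e).wp Q s := by
  subst hi he; exact h

/-- The contents of the memory after the lists have been computed. -/
structure Listed (n m p : ℕ) (π : ℕ → ℕ) (nx : ℕ → ℕ → ℕ) (s : State) : Prop where
  var0 : s.natVar 0 = n
  var2 : s.natVar 2 = p
  var4 : s.natVar 4 = n + m + 1
  row : ∀ i ≤ n + m, s.natArr 0 i = i * (n + m + 1)
  pos : ∀ r, 1 ≤ r → r ≤ n + m → s.natArr 1 r = π r
  nx : table (n + m + 1) 2 s = nx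

/-- Agreement of everything that is fixed while the lines through a point are treated. -/
structure Frame (s s' : State) : Prop where
  var : ∀ i < 6, s'.natVar i = s.natVar i
  arr : s'.natArr = s.natArr
  base : s'.realVar 5 = s.realVar 5
  out : s'.realArr 6 = s.realArr 6

theorem Frame.trans {s₁ s₂ s₃ : State} (h : Frame s₁ s₂) (h' : Frame s₂ s₃) : Frame s₁ s₃ :=
  ⟨fun i hi => (h'.var i hi).trans (h.var i hi), h'.arr.trans h.arr, h'.base.trans h.base,
    h'.out.trans h.out⟩

theorem Listed.of_same {n m p : ℕ} {π : ℕ → ℕ} {nx : ℕ → ℕ → ℕ} {s s' : State}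
    (h : Listed n m p π nx s) (hv : ∀ i < 5, s'.natVar i = s.natVar i) (ha : s'.natArr = s.natArr) :
    Listed n m p π nx s' where
  var0 := (hv 0 (by omega)).trans h.var0
  var2 := (hv 2 (by omega)).trans h.var2
  var4 := (hv 4 (by omega)).trans h.var4
  row := by rw [ha]; exact h.row
  pos := by rw [ha]; exact h.pos
  nx := by
    rw [← h.nx]; unfold table; rw [ha]

theorem Listed.frame {n m p : ℕ} {π : ℕ → ℕ} {nx : ℕ → ℕ → ℕ} {s s' : State}
    (h : Listed n m p π nx s) (hf : Frame s s') : Listed n m p π nx s' :=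
  h.of_same (fun i hi => hf.var i (by omega)) hf.arr

/-- The labels of the kept points. -/
def keptLabels (n m p : ℕ) (π : ℕ → ℕ) : Finset ℕ :=
  (Finset.Icc 1 (n + m)).filter fun r => π r < n ∧ π r ≠ p

theorem mem_keptLabels {n m p : ℕ} {π : ℕ → ℕ} {r : ℕ} :
    r ∈ keptLabels n m p π ↔ (1 ≤ r ∧ r ≤ n + m) ∧ π r < n ∧ π r ≠ p := by
  rw [keptLabels, Finset.mem_filter, Finset.mem_Icc]

variable {n m p : ℕ} {π : ℕ → ℕ} {nx : ℕ → ℕ → ℕ}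

theorem holds_keptCond {s : State} (h : Listed n m p π nx s) {v : NatExpr} (h1 : 1 ≤ v.eval s)
    (h2 : v.eval s ≤ n + m) : (keptCond v).Holds s ↔ v.eval s ∈ keptLabels n m p π := by
  simp only [keptCond, Cond.Holds, label, NatExpr.eval, h.pos _ h1 h2, h.var0, h.var2,
    mem_keptLabels, h1, h2, true_and, and_self]

theorem holds_candCond {s : State} (h : Listed n m p π nx s) {v : NatExpr} (h1 : 1 ≤ v.eval s)
    (h2 : v.eval s ≤ n + m) : (candCond v).Holds s ↔ n ≤ π (v.eval s) := by
  simp only [candCond, Cond.Holds, label, NatExpr.eval, h.pos _ h1 h2, h.var0, not_lt]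

/-- The rotation starts just after the vertical direction with slope close to minus infinity, where
the points to the right of `x` are above the line and those to the left below. -/
theorem runs_initialCount : ∃ K : ℕ, ∀ (n m p : ℕ) (π : ℕ → ℕ) (nx : ℕ → ℕ → ℕ) (x : ℕ) (s : State),
    Listed n m p π nx s → s.natVar 5 = x → Runs initialCount s (K * (n + m + 1)) (fun s' =>
      Frame s s' ∧ s'.realVar 0 = upperAfter (keptLabels n m p π) x ∅ ∧
      s'.realVar 1 = lowerAfter (keptLabels n m p π) x ∅) := by
  refine ⟨countInit.maxCost + ((Cond.natLt (.var 6) (.var 4)).cost + 1 + countBody.maxCost), ?_⟩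
  intro n m p π nx x s hs h5
  set T := keptLabels n m p π with hT
  refine (Runs.seq (Runs.of_wp (by simp [countInit, Program.Flat, Program.block])
    (Q := fun s' => Frame s s' ∧ s'.realVar 0 = 0 ∧ s'.realVar 1 = 0 ∧ s'.natVar 6 = 1) ?_)
    (fun s₁ hs₁ => Runs.forLoop (fun j s' => Frame s s' ∧ s'.natVar 6 = j ∧
      s'.realVar 0 = ∑ z ∈ Finset.range j, (if z ∈ T.erase x then if x < z then 1 else 0 else 0) ∧
      s'.realVar 1 = ∑ z ∈ Finset.range j, (if z ∈ T.erase x then if x < z then 0 else 1 else 0))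
      (T := countBody.maxCost) (lo := 1) (hi := n + m + 1) (by omega) ?_ ?_ ?_)).mono ?_ ?_
  · simp only [countInit, Program.block, Program.wp, NatExpr.eval, RealExpr.eval]
    refine ⟨⟨fun i hi => ?_, rfl, rfl, rfl⟩, by simp, by simp, by simp⟩
    simp [show i ≠ 6 by omega]
  · rintro j s' ⟨g1, g2, -⟩
    simp [Cond.Holds, NatExpr.eval, g2, (hs.frame g1).var4]
  · rintro j s₂ hj1 hj ⟨g1, g6, g0, g01⟩
    refine Runs.of_wp (by simp [countBody, addReal, incr, Program.Flat, Program.block]) ?_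
    have hs₂ := hs.frame g1
    have g5 : s₂.natVar 5 = x := (g1.var 5 (by omega)).trans h5
    have hmem := holds_keptCond hs₂ (v := .var 6) (by simpa [NatExpr.eval, g6] using hj1)
      (by simp only [NatExpr.eval, g6]; omega)
    simp only [NatExpr.eval, g6, ← hT] at hmem
    simp only [Finset.sum_range_succ]
    simp only [countBody, addReal, incr, Program.block, Program.wp, hmem, Cond.Holds, NatExpr.eval,
      RealExpr.eval, g6, g5]
    have hfr : ∀ s' : State, (∀ i < 6, s'.natVar i = s₂.natVar i) → s'.natArr = s₂.natArr →
        s'.realVar 5 = s₂.realVar 5 → s'.realArr = s₂.realArr → Frame s s' := fun s' k1 k2 k3 k4 =>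
      g1.trans ⟨k1, k2, k3, by rw [k4]⟩
    refine ⟨fun hjT => ⟨fun hxj => ?_, fun hxj => ⟨fun hxj' => ?_, fun hxj' => ?_⟩⟩, fun hjT => ?_⟩
    · have hjx : j ≠ x := by omega
      refine ⟨hfr _ (fun i hi => by simp [show i ≠ 6 by omega]) rfl (by simp) rfl, by simp [g6], ?_, ?_⟩
      · simp [hjT, hjx, hxj, g0]
      · simp [hjT, hjx, hxj, g01]
    · have hjx : j ≠ x := by omega
      refine ⟨hfr _ (fun i hi => by simp [show i ≠ 6 by omega]) rfl (by simp) rfl, by simp [g6], ?_, ?_⟩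
      · simp [hjT, hjx, hxj, g0]
      · simp [hjT, hjx, hxj, g01]
    · have hjx : j = x := by omega
      refine ⟨hfr _ (fun i hi => by simp [show i ≠ 6 by omega]) rfl (by simp) rfl, by simp, ?_, ?_⟩
      · simp [hjx, g0]
      · simp [hjx, g01]
    · refine ⟨hfr _ (fun i hi => by simp [show i ≠ 6 by omega]) rfl (by simp) rfl, by simp, ?_, ?_⟩
      · simp [hjT, g0]
      · simp [hjT, g01]
  · obtain ⟨g1, g2, g3, g4⟩ := hs₁
    have h0 : 0 ∉ T := fun h => by rw [hT, mem_keptLabels] at h; omega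
    exact ⟨g1, g4, by simp [g2, h0], by simp [g3, h0]⟩
  · exact (Nat.add_le_add (Nat.le_mul_of_pos_right _ (Nat.succ_pos (n + m)))
      (Nat.mul_le_mul_left _ (show n + m + 1 - 1 + 1 ≤ n + m + 1 by omega))).trans_eq
        (add_mul _ _ _).symm
  · rintro s' ⟨g1, -, g2, g3⟩
    have hTN : ∀ z ∈ T.erase x, z ≤ n + m := fun z hz => by
      have := Finset.mem_of_mem_erase hz
      rw [hT, mem_keptLabels] at this
      omega
    rw [sum_range_ite_mem hTN] at g2 g3
    refine ⟨g1, g2.trans (Finset.sum_congr rfl fun z hz => ?_),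
      g3.trans (Finset.sum_congr rfl fun z hz => ?_)⟩
    · have := (Finset.mem_erase.1 hz).1
      simp only [Finset.notMem_empty, false_iff, not_lt]
      exact if_congr (by omega) rfl rfl
    · have := (Finset.mem_erase.1 hz).1
      simp only [Finset.notMem_empty, false_iff, not_lt]
      exact if_congr (by omega) rfl rfl

end RealRAM

/-! ### The rotation and its prefix sums -/

/-- A line rotating about the point `x` has passed the points in `Z`, and passes `y` next, if there
are other points. -/
structure Arrangement.Passed {N : ℕ} (R : Arrangement N) (x : ℕ) (Z : Finset ℕ) (y : ℕ) : Prop where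
  subset : Z ⊆ (Finset.Icc 1 N).erase x
  mem : y ≠ 0 → y ∈ (Finset.Icc 1 N).erase x
  iff : y ≠ 0 → ∀ z ∈ (Finset.Icc 1 N).erase x, z ∈ Z ↔ R.x x z < R.x x y
  full : y = 0 → Z = (Finset.Icc 1 N).erase x

namespace Arrangement

variable {N : ℕ} {R : Arrangement N} {x y : ℕ} {Z : Finset ℕ} {nx pv : ℕ → ℕ}

theorem mem_nodes_of_mem {z : ℕ} (hxN : x ≤ N) (hz : z ∈ (Finset.Icc 1 N).erase x) :
    z ∈ nodes (N + 1) ∅ x := by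
  rw [Finset.mem_erase, Finset.mem_Icc] at hz
  exact mem_nodes.2 (Or.inr ⟨hz.2.1, hz.1, Or.inl ⟨by omega, by omega⟩⟩)

theorem mem_of_mem_nodes {z : ℕ} (hx : 1 ≤ x) (hxN : x ≤ N) (hz : z ∈ nodes (N + 1) ∅ x)
    (h0 : z ≠ 0) : z ∈ (Finset.Icc 1 N).erase x := by
  rw [mem_nodes] at hz
  rw [Finset.mem_erase, Finset.mem_Icc]
  rcases hz with h | ⟨h1, h2, h | ⟨-, h⟩ | ⟨h3, h4⟩⟩
  · omega
  · omega
  · simp at h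
  · simp at h4

theorem Passed.start (hx : 1 ≤ x) (hxN : x ≤ N) (h : Linked (nodes (N + 1) ∅ x) (R.x x) nx pv) :
    R.Passed x ∅ (nx 0) := by
  have h0 : 0 ∈ nodes (N + 1) ∅ x := Or.inl rfl
  have hlt : ∀ z ∈ (Finset.Icc 1 N).erase x, R.x x 0 < R.x x z := by
    intro z hz
    rw [Finset.mem_erase, Finset.mem_Icc] at hz
    rw [R.x_zero]
    exact R.bot_lt _ _ hx hxN hz.2.1 hz.2.2 hz.1.symm
  refine ⟨by simp, fun hy => mem_of_mem_nodes hx hxN (h.nx_mem 0 h0) hy, fun hy z hz => ?_,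
    fun hy => ?_⟩
  · have := hlt z hz
    rcases h.gap 0 h0 hy z (mem_nodes_of_mem hxN hz) with h1 | h1
    · exact absurd this h1.not_gt
    · simp [h1.not_gt]
  · refine (Finset.eq_empty_of_forall_notMem fun z hz => ?_).symm
    exact (h.last 0 h0 hy z (mem_nodes_of_mem hxN hz)).not_gt (hlt z hz)

theorem Passed.x_ne {z : ℕ} (hx : 1 ≤ x) (hxN : x ≤ N) (hy : y ∈ (Finset.Icc 1 N).erase x)
    (hz : z ∈ (Finset.Icc 1 N).erase x) (hzy : z ≠ y) : R.x x z ≠ R.x x y := by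
  rw [Finset.mem_erase, Finset.mem_Icc] at hy hz
  exact fun he => hzy (R.x_inj hx hxN hz.2.2 hy.2.2 hz.1.symm hy.1.symm he)

theorem Passed.notMem (h : R.Passed x Z y) (hy : y ≠ 0) : y ∉ Z := by
  rw [h.iff hy y (h.mem hy)]
  exact lt_irrefl _

theorem Passed.step (hx : 1 ≤ x) (hxN : x ≤ N) (hl : Linked (nodes (N + 1) ∅ x) (R.x x) nx pv)
    (h : R.Passed x Z y) (hy : y ≠ 0) : R.Passed x (insert y Z) (nx y) := by
  have hym := h.mem hy
  have hyn := mem_nodes_of_mem hxN hym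
  refine ⟨Finset.insert_subset hym h.subset, fun h0 => mem_of_mem_nodes hx hxN (hl.nx_mem y hyn) h0,
    fun h0 z hz => ?_, fun h0 => ?_⟩
  · have h1 := hl.lt y hyn h0
    rw [Finset.mem_insert, h.iff hy z hz]
    refine ⟨?_, fun h2 => ?_⟩
    · rintro (rfl | h2)
      exacts [h1, h2.trans h1]
    · rcases hl.gap y hyn h0 z (mem_nodes_of_mem hxN hz) with h3 | h3
      · by_cases hzy : z = y
        · exact Or.inl hzy
        · exact Or.inr (lt_of_le_of_ne h3 (x_ne hx hxN hym hz hzy))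
      · exact absurd h2 h3.not_gt
  · refine Finset.Subset.antisymm (Finset.insert_subset hym h.subset) fun z hz => ?_
    rw [Finset.mem_insert, h.iff hy z hz]
    by_cases hzy : z = y
    · exact Or.inl hzy
    · exact Or.inr (lt_of_le_of_ne (hl.last y hyn h0 z (mem_nodes_of_mem hxN hz))
        (x_ne hx hxN hym hz hzy))

open Classical in
/-- The number of points below minus the number of points above, summed over the lines through `x`
and a point that is passed before `q`. -/
noncomputable def balance (R : Arrangement N) (T : Finset ℕ) (x q : ℕ) : ℝ :=
  ∑ z ∈ T.erase x, (if R.x x z < R.x x q then R.lower T x z else 0) -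
    ∑ z ∈ T.erase x, if R.x x z < R.x x q then R.upper T x z else 0

end Arrangement

namespace RealRAM

/-- Before the event the two counters include `y` on its old side. It is taken off, which leaves the
exact counts for the line through `x` and `y`; these are accumulated, and then `y` is put on its new
side. -/
theorem wp_passProgram {s : State} {x y : ℕ} {u l : ℝ} {Q : State → Prop} (h5 : s.natVar 5 = x)
    (h13 : s.natVar 13 = y) (h0 : s.realVar 0 = u + if x < y then 1 else 0)
    (h1 : s.realVar 1 = l + if x < y then 0 else 1)
    (h : ∀ s', s'.natVar = s.natVar → s'.natArr = s.natArr → s'.realArr = s.realArr →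
      s'.realVar 0 = (u + if x < y then 0 else 1) → s'.realVar 1 = (l + if x < y then 1 else 0) →
      s'.realVar 2 = s.realVar 2 + u * l → s'.realVar 3 = s.realVar 3 + u →
      s'.realVar 4 = s.realVar 4 + l → s'.realVar 5 = s.realVar 5 → Q s') :
    passProgram.wp Q s := by
  simp only [passProgram, addReal, Program.block, Program.wp, Cond.Holds, NatExpr.eval,
    RealExpr.eval, State.natVar_setReal, h5, h13]
  refine ⟨fun hxy => ⟨fun _ => h _ rfl rfl rfl ?_ ?_ ?_ ?_ ?_ ?_, fun hn => absurd hxy hn⟩,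
    fun hxy => ⟨fun hn => absurd hn hxy, fun _ => h _ rfl rfl rfl ?_ ?_ ?_ ?_ ?_ ?_⟩⟩
  all_goals simp [h0, h1, hxy]

/-- The contents of the memory while a line rotates about the point `x`. -/
structure Rotating {N : ℕ} (R : Arrangement N) (T : Finset ℕ) (x : ℕ) (Z : Finset ℕ) (s s' : State) :
    Prop where
  frame : Frame s s'
  passed : R.Passed x Z (s'.natVar 13)
  var0 : s'.realVar 0 = upperAfter T x Z
  var1 : s'.realVar 1 = lowerAfter T x Z
  var2 : s'.realVar 2 = ∑ z ∈ T.erase x, if z ∈ Z then R.upper T x z * R.lower T x z else 0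
  var3 : s'.realVar 3 = ∑ z ∈ T.erase x, if z ∈ Z then R.upper T x z else 0
  var4 : s'.realVar 4 = ∑ z ∈ T.erase x, if z ∈ Z then R.lower T x z else 0
  arr : ∀ j ∈ Z, s'.realArr 5 j = R.balance T x j

theorem wp_rotateBody {n m p : ℕ} {π : ℕ → ℕ} {nx : ℕ → ℕ → ℕ} {pv : ℕ → ℕ}
    {R : Arrangement (n + m)} {x : ℕ}
    {Z : Finset ℕ} {s s₁ : State} (hs : Listed n m p π nx s) (h5 : s.natVar 5 = x) (hx : 1 ≤ x)
    (hxN : x ≤ n + m) (hl : Linked (nodes (n + m + 1) ∅ x) (R.x x) (nx x) pv)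
    (h : Rotating R (keptLabels n m p π) x Z s s₁) (hy : s₁.natVar 13 ≠ 0) :
    rotateBody.wp (fun s' => Rotating R (keptLabels n m p π) x (insert (s₁.natVar 13) Z) s s') s₁ := by
  have hs₁ := hs.frame h.frame
  have h51 : s₁.natVar 5 = x := (h.frame.var 5 (by omega)).trans h5
  set T := keptLabels n m p π with hT
  generalize hye : s₁.natVar 13 = y at hy
  have hp := h.passed
  rw [hye] at hp
  have hym := hp.mem hy
  have hyZ := hp.notMem hy
  have hTE : ∀ z ∈ T.erase x, z ∈ (Finset.Icc 1 (n + m)).erase x := by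
    intro z hz
    rw [Finset.mem_erase, hT, mem_keptLabels] at hz
    rw [Finset.mem_erase, Finset.mem_Icc]
    exact ⟨hz.1, hz.2.1⟩
  have hy1 : 1 ≤ y ∧ y ≤ n + m := by
    rw [Finset.mem_erase, Finset.mem_Icc] at hym
    exact hym.2
  have hyx : y ≠ x := (Finset.mem_erase.1 hym).1
  have harr : ∀ j ∈ insert y Z, (s₁.storeReal 5 y (s₁.realVar 4 - s₁.realVar 3)).realArr 5 j =
      R.balance T x j := by
    intro j hj
    rw [State.realArr_storeReal]
    by_cases hjy : j = y
    · subst hjy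
      rw [if_pos ⟨rfl, rfl⟩, h.var3, h.var4, Arrangement.balance]
      congr 1
      all_goals exact Finset.sum_congr rfl fun z hz => if_congr (hp.iff hy z (hTE z hz)) rfl rfl
    · rw [if_neg fun hc => hjy hc.2]
      exact h.arr j ((Finset.mem_insert.1 hj).resolve_left hjy)
  have hgo : ∀ s₂ : State, s₂.natVar = s₁.natVar → s₂.natArr = s₁.natArr →
      s₂.realArr = (s₁.storeReal 5 y (s₁.realVar 4 - s₁.realVar 3)).realArr →
      s₂.realVar 5 = s₁.realVar 5 →
      s₂.realVar 0 = upperAfter T x (insert y Z) → s₂.realVar 1 = lowerAfter T x (insert y Z) →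
      s₂.realVar 2 = (∑ z ∈ T.erase x, if z ∈ insert y Z then R.upper T x z * R.lower T x z else 0) →
      s₂.realVar 3 = (∑ z ∈ T.erase x, if z ∈ insert y Z then R.upper T x z else 0) →
      s₂.realVar 4 = (∑ z ∈ T.erase x, if z ∈ insert y Z then R.lower T x z else 0) →
      (Program.setNat 13 (.get 2 (entry (.var 5) (.var 13)))).wp
        (fun s' => Rotating R T x (insert y Z) s s') s₂ := by
    intro s₂ k1 k2 k3 k4 k5 k6 k7 k8 k9
    refine Program.wp_setNat (v := nx x y) ?_ ⟨h.frame.trans ⟨fun i hi => ?_, k2, k4, ?_⟩, ?_, k5,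
      k6, k7, k8, k9, ?_⟩
    · have := congr_fun (congr_fun hs₁.nx x) y
      rw [table] at this
      simp only [NatExpr.eval, entry, k1, k2, h51, hye, hs₁.row x (by omega), this]
    · simp [show i ≠ 13 by omega, k1]
    · funext j
      simp [k3]
    · simpa using hp.step hx hxN hl hy
    · intro j hj
      rw [State.realArr_setNat, k3]
      exact harr j hj
  refine Program.wp_storeReal (x := y) (v := s₁.realVar 4 - s₁.realVar 3) (by simp [NatExpr.eval, hye])
    (by simp [RealExpr.eval]) ?_
  have hs₂ : Listed n m p π nx (s₁.storeReal 5 y (s₁.realVar 4 - s₁.realVar 3)) :=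
    hs₁.of_same (fun _ _ => rfl) rfl
  have hmem := holds_keptCond hs₂ (v := .var 13) (by simpa [NatExpr.eval, hye] using hy1.1)
    (by simpa [NatExpr.eval, hye] using hy1.2)
  rw [← hT] at hmem
  simp only [NatExpr.eval, State.natVar_storeReal, hye] at hmem
  refine ⟨fun hk => ?_, fun hk => ?_⟩
  · have hyT : y ∈ T.erase x := Finset.mem_erase.2 ⟨hyx, hmem.1 hk⟩
    obtain ⟨u1, u2, u3, u4⟩ := upperAfter_eq (R := R) hyT hyZ fun z hz hzy =>
      ⟨Arrangement.Passed.x_ne hx hxN hym (hTE z hz) hzy, hp.iff hy z (hTE z hz)⟩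
    refine wp_passProgram (x := x) (y := y) (u := R.upper T x y) (l := R.lower T x y)
      (by simpa using h51) (by simpa using hye) (by simp [h.var0, u1]) (by simp [h.var1, u2]) ?_
    intro s₃ k1 k2 k3 k4 k5 k6 k7 k8 k9
    refine hgo s₃ k1 k2 k3 k9 (k4.trans u3.symm) (k5.trans u4.symm) ?_ ?_ ?_
    · rw [k6, sum_ite_mem_insert hyT hyZ fun z => R.upper T x z * R.lower T x z]
      exact congr_arg (· + _) h.var2
    · rw [k7, sum_ite_mem_insert hyT hyZ fun z => R.upper T x z]
      exact congr_arg (· + _) h.var3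
    · rw [k8, sum_ite_mem_insert hyT hyZ fun z => R.lower T x z]
      exact congr_arg (· + _) h.var4
  · have hyT : y ∉ T.erase x := fun hyT => hk (hmem.2 (Finset.mem_of_mem_erase hyT))
    obtain ⟨u1, u2⟩ := after_insert_of_notMem (Z := Z) hyT
    refine hgo _ rfl rfl rfl rfl (h.var0.trans u1.symm) (h.var1.trans u2.symm) ?_ ?_ ?_
    · rw [sum_ite_mem_insert_of_notMem hyT fun z => R.upper T x z * R.lower T x z]
      exact h.var2
    · rw [sum_ite_mem_insert_of_notMem hyT fun z => R.upper T x z]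
      exact h.var3
    · rw [sum_ite_mem_insert_of_notMem hyT fun z => R.lower T x z]
      exact h.var4

theorem runs_rotate : ∃ K : ℕ, ∀ (n m p : ℕ) (π : ℕ → ℕ) (nx : ℕ → ℕ → ℕ) (pv : ℕ → ℕ)
    (R : Arrangement (n + m)) (x : ℕ) (s : State), Listed n m p π nx s → s.natVar 5 = x → 1 ≤ x →
    x ≤ n + m → Linked (nodes (n + m + 1) ∅ x) (R.x x) (nx x) pv →
    s.realVar 0 = upperAfter (keptLabels n m p π) x ∅ →
    s.realVar 1 = lowerAfter (keptLabels n m p π) x ∅ →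
    Runs rotate s (K * (n + m + 1)) (fun s' => Frame s s' ∧
      s'.realVar 2 = R.pencil (keptLabels n m p π) x ∧
      s'.realVar 3 = ∑ z ∈ (keptLabels n m p π).erase x, R.upper (keptLabels n m p π) x z ∧
      s'.realVar 4 = ∑ z ∈ (keptLabels n m p π).erase x, R.lower (keptLabels n m p π) x z ∧
      ∀ j ∈ (Finset.Icc 1 (n + m)).erase x, s'.realArr 5 j = R.balance (keptLabels n m p π) x j) := by
  refine ⟨rotateInit.maxCost + ((Cond.not (.natEq (.var 13) (.const 0))).cost + 1 +
    rotateBody.maxCost), ?_⟩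
  intro n m p π nx pv R x s hs h5 hx hxN hl h0 h1
  set T := keptLabels n m p π with hT
  refine (Runs.seq (Runs.of_wp (by simp [rotateInit, Program.Flat, Program.block])
    (Q := fun s' => Rotating R T x ∅ s s') ?_)
    (fun s₁ hs₁ => Runs.loop (T := rotateBody.maxCost)
      (fun r s' => ∃ Z, r = n + m - Z.card ∧ Rotating R T x Z s s') ?_ (n + m) s₁
        ⟨∅, by simp, hs₁⟩)).mono ?_ ?_
  · refine Program.wp_setReal (v := 0) (by simp [RealExpr.eval, NatExpr.eval])
      (Program.wp_setReal (v := 0) (by simp [RealExpr.eval, NatExpr.eval])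
      (Program.wp_setReal (v := 0) (by simp [RealExpr.eval, NatExpr.eval])
      (Program.wp_setNat (v := nx x 0) ?_ ⟨⟨fun i hi => ?_, rfl, by simp, rfl⟩, ?_, ?_, ?_, ?_, ?_, ?_,
        by simp⟩)))
    · have := congr_fun (congr_fun hs.nx x) 0
      rw [table] at this
      simp [NatExpr.eval, entry, h5, hs.row x (by omega), ← this]
    · simp [show i ≠ 13 by omega]
    · simpa using Arrangement.Passed.start hx hxN hl
    · simp [h0]
    · simp [h1]
    · simp
    · simp
    · simp
  · rintro r s₂ ⟨Z, rfl, hr⟩ hb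
    have hy : s₂.natVar 13 ≠ 0 := by simpa [Cond.Holds, NatExpr.eval] using hb
    refine (Runs.of_wp (by simp [rotateBody, passProgram, addReal, Program.Flat, Program.block])
      (wp_rotateBody hs h5 hx hxN hl hr hy)).mono le_rfl fun s₃ h₃ => ⟨_, ?_, _, rfl, h₃⟩
    -- The passed points form a growing subset of the other labels, so the number of turns of the
    -- loop is at most `n + m`.
    have hc := Finset.card_le_card h₃.passed.subset
    rw [Finset.card_insert_of_notMem (hr.passed.notMem hy)] at hc ⊢
    have := (Finset.card_erase_le (s := Finset.Icc 1 (n + m)) (a := x))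
    rw [Nat.card_Icc] at this
    omega
  · refine (Nat.add_le_add (Nat.le_mul_of_pos_right _ (Nat.succ_pos (n + m))) ?_).trans_eq
      (add_mul _ _ _).symm
    rw [Nat.mul_succ]
    omega
  · rintro s' ⟨hb, r, Z, -, h⟩
    have hy : s'.natVar 13 = 0 := by simpa [Cond.Holds, NatExpr.eval] using hb
    have hZ := h.passed.full hy
    have hTZ : ∀ f : ℕ → ℝ, (∑ z ∈ T.erase x, if z ∈ Z then f z else 0) = ∑ z ∈ T.erase x, f z := by
      intro f
      refine Finset.sum_congr rfl fun z hz => if_pos ?_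
      rw [Finset.mem_erase, hT, mem_keptLabels] at hz
      rw [hZ, Finset.mem_erase, Finset.mem_Icc]
      exact ⟨hz.1, hz.2.1⟩
    refine ⟨h.frame, h.var2.trans (hTZ _), h.var3.trans (hTZ _), h.var4.trans (hTZ _), ?_⟩
    rw [← hZ]
    exact h.arr

end RealRAM

namespace Arrangement

variable {N : ℕ} {R : Arrangement N} {T : Finset ℕ} {x q : ℕ}

/-- A point `q` to the right of `x` is above the lines whose slope is less than its own, and there
the points below count; on the remaining lines the points above count. Starting from the sum of all
upper counts, `balance` corrects the lines passed before `q`. -/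
theorem opposite_eq_of_lt (hxq : x < q) :
    R.opposite T x q = R.balance T x q + ∑ z ∈ T.erase x, R.upper T x z := by
  rw [opposite, balance, ← Finset.sum_sub_distrib, ← Finset.sum_add_distrib]
  refine Finset.sum_congr rfl fun y _ => ?_
  have : R.Above x y q ↔ R.x x y < R.x x q := by simp [Above, hxq, hxq.not_gt]
  simp only [this]
  split_ifs <;> ring

/-- Sides are interchanged for `q` to the left of `x`. General position excludes a tie of slopes,
which the non-strict comparison would otherwise assign to the wrong side. -/
theorem opposite_eq_of_gt (hqx : q < x) (hne : ∀ z ∈ T.erase x, R.x x z ≠ R.x x q) :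
    R.opposite T x q = (∑ z ∈ T.erase x, R.lower T x z) - R.balance T x q := by
  rw [opposite, balance, ← Finset.sum_sub_distrib, ← Finset.sum_sub_distrib]
  refine Finset.sum_congr rfl fun y hy => ?_
  have : R.Above x y q ↔ ¬ R.x x y < R.x x q := by
    simp only [Above, hqx, hqx.not_gt, false_and, true_and, false_or, not_lt]
    exact ⟨le_of_lt, fun h => lt_of_le_of_ne h (hne y hy).symm⟩
  simp only [this]
  split_ifs <;> ring

end Arrangement

namespace RealRAM

theorem runs_contribute : ∃ K : ℕ, ∀ (n m p : ℕ) (π : ℕ → ℕ) (nx : ℕ → ℕ → ℕ)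
    (R : Arrangement (n + m)) (x : ℕ) (s : State), Listed n m p π nx s → s.natVar 5 = x → 1 ≤ x →
    x ≤ n + m → s.realVar 2 = R.pencil (keptLabels n m p π) x →
    s.realVar 3 = ∑ z ∈ (keptLabels n m p π).erase x, R.upper (keptLabels n m p π) x z →
    s.realVar 4 = ∑ z ∈ (keptLabels n m p π).erase x, R.lower (keptLabels n m p π) x z →
    (∀ j ∈ (Finset.Icc 1 (n + m)).erase x, s.realArr 5 j = R.balance (keptLabels n m p π) x j) →
    Runs contribute s (K * (n + m + 1)) (fun s' => Listed n m p π nx s' ∧ s'.natVar 5 = x ∧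
      s'.realVar 5 = s.realVar 5 +
        (if x ∈ keptLabels n m p π then R.pencil (keptLabels n m p π) x else 0) ∧
      ∀ q, 1 ≤ q → q ≤ n + m → n ≤ π q → s'.realArr 6 q = s.realArr 6 q +
        ((if x ∈ keptLabels n m p π then R.opposite (keptLabels n m p π) x q else 0) +
        if q = x then 2 * R.pencil (keptLabels n m p π) q else 0)) := by
  refine ⟨(keptCond (.var 5)).cost + 1 + (addOwn.maxCost + (addInit.maxCost +
    ((Cond.natLt (.var 6) (.var 4)).cost + 1 + addBody.maxCost))), ?_⟩
  intro n m p π nx R x s hs h5 hx hxN h2 h3 h4 harr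
  set T := keptLabels n m p π with hT
  have hkept := holds_keptCond hs (v := .var 5) (by simpa [NatExpr.eval, h5] using hx)
    (by simpa [NatExpr.eval, h5] using hxN)
  have hcand := holds_candCond hs (v := .var 5) (by simpa [NatExpr.eval, h5] using hx)
    (by simpa [NatExpr.eval, h5] using hxN)
  simp only [NatExpr.eval, h5, ← hT] at hkept hcand
  have hTn : ∀ z ∈ T, π z < n := fun z hz => by
    rw [hT, mem_keptLabels] at hz
    exact hz.2.1
  refine (Runs.cond (T := addOwn.maxCost + (addInit.maxCost +
    ((Cond.natLt (.var 6) (.var 4)).cost + 1 + addBody.maxCost) * (n + m + 1))) (fun hk => ?_)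
    (fun hk => ?_)).mono ?_ fun _ => id
  · rw [hkept] at hk
    refine (Runs.seq (Runs.of_wp (by simp [addInit, addReal, Program.Flat, Program.block])
      (Q := fun s' => Listed n m p π nx s' ∧ s'.natVar 5 = x ∧ s'.natVar 6 = 1 ∧
        s'.realVar 5 = s.realVar 5 + R.pencil T x ∧ s'.realVar 3 = s.realVar 3 ∧
        s'.realVar 4 = s.realVar 4 ∧ s'.realArr = s.realArr) ?_)
      (fun s₁ hs₁ => Runs.forLoop (fun j s' => Listed n m p π nx s' ∧ s'.natVar 5 = x ∧
        s'.natVar 6 = j ∧ s'.realVar 5 = s.realVar 5 + R.pencil T x ∧ s'.realVar 3 = s.realVar 3 ∧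
        s'.realVar 4 = s.realVar 4 ∧ s'.realArr 5 = s.realArr 5 ∧
        (∀ q, 1 ≤ q → q < j → n ≤ π q →
          s'.realArr 6 q = s.realArr 6 q + R.opposite T x q) ∧
        ∀ q, j ≤ q → s'.realArr 6 q = s.realArr 6 q)
        (T := addBody.maxCost) (lo := 1) (hi := n + m + 1) (by omega) ?_ ?_ ?_)).mono ?_ ?_
    · refine Program.wp_setReal (v := s.realVar 5 + R.pencil T x) (by simp [RealExpr.eval, h2])
        (Program.wp_setNat (v := 1) rfl ⟨hs.of_same (fun i hi => ?_) rfl, ?_⟩)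
      · simp [show i ≠ 6 by omega]
      · simp [h5]
    · rintro j s' ⟨g1, g5, g6, -⟩
      simp [Cond.Holds, NatExpr.eval, g6, g1.var4]
    · rintro j s₂ hj1 hj ⟨g1, g5, g6, gb, g3, g4, gU, gl, gr⟩
      refine Runs.of_wp (by simp [addBody, incr, Program.Flat, Program.block]) ?_
      have hc := holds_candCond g1 (v := .var 6) (by simpa [NatExpr.eval, g6] using hj1)
        (by simp only [NatExpr.eval, g6]; omega)
      simp only [NatExpr.eval, g6] at hc
      have hstep : ∀ w : ℝ, n ≤ π j → w = s.realArr 6 j + R.opposite T x j →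
          (incr 6).wp (fun s' => Listed n m p π nx s' ∧ s'.natVar 5 = x ∧
            s'.natVar 6 = j + 1 ∧ s'.realVar 5 = s.realVar 5 + R.pencil T x ∧
            s'.realVar 3 = s.realVar 3 ∧ s'.realVar 4 = s.realVar 4 ∧ s'.realArr 5 = s.realArr 5 ∧
            (∀ q, 1 ≤ q → q < j + 1 → n ≤ π q →
              s'.realArr 6 q = s.realArr 6 q + R.opposite T x q) ∧
            ∀ q, j + 1 ≤ q → s'.realArr 6 q = s.realArr 6 q) (s₂.storeReal 6 j w) := by
        intro w hjn hw
        refine Program.wp_setNat (v := j + 1) (by simp [NatExpr.eval, g6])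
          ⟨g1.of_same (fun i hi => ?_) rfl, by simpa using g5, by simp, gb, g3, g4, ?_, ?_, ?_⟩
        · simp [show i ≠ 6 by omega]
        · funext i
          simp [gU]
        · intro q hq1 hq hqn
          by_cases hqj : q = j
          · simp [hqj, hw]
          · simp [hqj, gl q hq1 (by omega) hqn]
        · intro q hq
          simp [show q ≠ j by omega, gr q (by omega)]
      refine ⟨fun hcj => ?_, fun hcj => ?_⟩
      · rw [hc] at hcj
        have hjT : j ∉ T := fun h => absurd (hTn j h) (by omega)
        have hjx : j ≠ x := by rintro rfl; exact hjT hk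
        have hjm : j ∈ (Finset.Icc 1 (n + m)).erase x := by
          rw [Finset.mem_erase, Finset.mem_Icc]
          exact ⟨hjx, hj1, by omega⟩
        refine ⟨fun hlt => ?_, fun hlt => ?_⟩
        · have hlt : x < j := by simpa [Cond.Holds, NatExpr.eval, g5, g6] using hlt
          refine Program.wp_storeReal (x := j) (by simp [NatExpr.eval, g6]) rfl (hstep _ hcj ?_)
          simp only [RealExpr.eval, NatExpr.eval, g6, gr j le_rfl, gU, g3, h3, harr j hjm,
            Arrangement.opposite_eq_of_lt hlt]
        · have hlt : j < x := by
            have : ¬ x < j := by simpa [Cond.Holds, NatExpr.eval, g5, g6] using hlt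
            omega
          refine Program.wp_storeReal (x := j) (by simp [NatExpr.eval, g6]) rfl (hstep _ hcj ?_)
          rw [Arrangement.opposite_eq_of_gt hlt]
          · simp only [RealExpr.eval, NatExpr.eval, g6, gr j le_rfl, gU, g4, h4, harr j hjm]
          · intro z hz
            have hzj : z ≠ j := by rintro rfl; exact hjT (Finset.mem_of_mem_erase hz)
            rw [Finset.mem_erase, hT, mem_keptLabels] at hz
            exact Arrangement.Passed.x_ne hx hxN hjm
              (Finset.mem_erase.2 ⟨hz.1, Finset.mem_Icc.2 hz.2.1⟩) hzj
      · rw [hc] at hcj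
        simp only [Program.wp, Program.block, incr, NatExpr.eval, g6]
        refine ⟨g1.of_same (fun i hi => ?_) rfl, by simpa using g5, by simp, gb, g3, g4, gU,
            fun q hq1 hq hqn => ?_, fun q hq => gr q (by omega)⟩
        · simp [show i ≠ 6 by omega]
        · have : q ≠ j := by rintro rfl; exact hcj hqn
          exact gl q hq1 (by omega) hqn
    · obtain ⟨g1, g5, g6, gb, g3, g4, gr⟩ := hs₁
      exact ⟨g1, g5, g6, gb, g3, g4, by rw [gr], fun q h1 h2 => by omega, fun q _ => by rw [gr]⟩
    · refine le_trans ?_ (Nat.le_add_left _ _)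
      exact Nat.add_le_add_left (Nat.mul_le_mul_left _ (by omega)) _
    · rintro s' ⟨g1, g5, -, gb, -, -, -, gl, -⟩
      refine ⟨g1, g5, by rw [gb, if_pos hk], fun q hq1 hqN hqn => ?_⟩
      have hqx : q ≠ x := by rintro rfl; exact absurd (hTn q hk) (by omega)
      rw [gl q hq1 (by omega) hqn, if_pos hk, if_neg hqx, add_zero]
  · rw [hkept] at hk
    refine (Runs.of_wp (c := addOwn) (by simp [addOwn, Program.Flat]) ⟨fun hc => ?_,
      fun hc => ?_⟩).mono (Nat.le_add_right _ _) fun _ => id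
    · refine Program.wp_storeReal (x := x) (v := s.realArr 6 x + 2 * R.pencil T x)
        (by simp [NatExpr.eval, h5]) ?_ ⟨hs.of_same (fun _ _ => rfl) rfl, h5, ?_, ?_⟩
      · simp only [RealExpr.eval, NatExpr.eval, h5, h2]; ring
      · simp [hk]
      · intro q _ _ _
        by_cases hqx : q = x
        · simp [hqx, hk]
        · simp [hqx, hk]
    · refine ⟨hs, h5, by simp [hk], fun q _ _ hqn => ?_⟩
      have hqx : q ≠ x := by rintro rfl; exact hc (hcand.2 hqn)
      simp [hk, hqx]
  · generalize (keptCond (.var 5)).cost + 1 = a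
    generalize addOwn.maxCost = b
    generalize addInit.maxCost = c
    generalize (Cond.natLt (.var 6) (.var 4)).cost + 1 + addBody.maxCost = d
    nlinarith [Nat.zero_le (a * (n + m)), Nat.zero_le (b * (n + m)), Nat.zero_le (c * (n + m))]

theorem runs_sumProgram : ∃ K : ℕ, ∀ (n m p : ℕ) (π : ℕ → ℕ) (nx pv : ℕ → ℕ → ℕ)
    (R : Arrangement (n + m)) (s : State), Listed n m p π nx s → R.Stage (n + m + 1) ∅ nx pv →
    (∀ i, s.realArr 6 i = 0) →
    Runs sumProgram s (K * (n + m + 1) ^ 2) (fun s' => Listed n m p π nx s' ∧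
      s'.realVar 5 = ∑ x ∈ keptLabels n m p π, R.pencil (keptLabels n m p π) x ∧
      ∀ q, 1 ≤ q → q ≤ n + m → n ≤ π q → s'.realArr 6 q =
        ∑ x ∈ keptLabels n m p π, R.opposite (keptLabels n m p π) x q +
          2 * R.pencil (keptLabels n m p π) q) := by
  obtain ⟨K₁, hK₁⟩ := runs_initialCount
  obtain ⟨K₂, hK₂⟩ := runs_rotate
  obtain ⟨K₃, hK₃⟩ := runs_contribute
  refine ⟨sumInit.maxCost + ((Cond.natLt (.var 5) (.var 4)).cost + 1 +
    (K₁ + (K₂ + (K₃ + (incr 5).maxCost)))), ?_⟩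
  intro n m p π nx pv R s hs hst ho
  set T := keptLabels n m p π with hT
  refine (Runs.seq (Runs.of_wp (by simp [sumInit, Program.Flat, Program.block])
    (Q := fun s' => Listed n m p π nx s' ∧ s'.natVar 5 = 1 ∧ s'.realVar 5 = 0 ∧
      s'.realArr = s.realArr) ?_) (fun s₁ hs₁ => Runs.forLoop (fun x s' => Listed n m p π nx s' ∧
        s'.natVar 5 = x ∧
        s'.realVar 5 = ∑ z ∈ Finset.range x, (if z ∈ T then R.pencil T z else 0) ∧
        ∀ q, 1 ≤ q → q ≤ n + m → n ≤ π q → s'.realArr 6 q =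
          ∑ z ∈ Finset.range x, (if z ∈ T then R.opposite T z q else 0) +
            if q < x then 2 * R.pencil T q else 0) (lo := 1) (hi := n + m + 1)
        (T := K₁ * (n + m + 1) + (K₂ * (n + m + 1) + (K₃ * (n + m + 1) + (incr 5).maxCost)))
        (by omega) ?_ ?_ ?_)).mono ?_ ?_
  · refine Program.wp_setNat (v := 1) rfl (Program.wp_setReal (v := 0) (by simp [RealExpr.eval,
      NatExpr.eval]) ⟨hs.of_same (fun i hi => ?_) rfl, by simp, by simp, rfl⟩)
    simp [show i ≠ 5 by omega]
  · rintro x s' ⟨g1, g5, -⟩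
    simp [Cond.Holds, NatExpr.eval, g5, g1.var4]
  · rintro x s₂ hx hxN ⟨g1, g5, gb, go⟩
    -- All labels serve as centres: kept points for the base sum and the opposite counts, candidates
    -- for their own pencils. For the removed point `contribute` adds nothing.
    refine Runs.seq (hK₁ n m p π nx x s₂ g1 g5) fun s₃ ⟨f₃, u3, l3⟩ => ?_
    have f35 := (f₃.var 5 (by omega)).trans g5
    refine Runs.seq (hK₂ n m p π nx (pv x) R x s₃ (g1.frame f₃) f35 hx (by omega)
      (hst x hx (by omega)) u3 l3) fun s₄ ⟨f₄, p4, u4, l4, a4⟩ => ?_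
    refine Runs.seq (hK₃ n m p π nx R x s₄ ((g1.frame f₃).frame f₄)
      ((f₄.var 5 (by omega)).trans f35) hx (by omega) p4 u4 l4 a4) fun s₅ ⟨g5', k5, b5, o5⟩ => ?_
    refine Runs.of_wp (by simp [incr, Program.Flat]) (Program.wp_setNat (v := x + 1)
      (by simp [NatExpr.eval, k5]) ⟨g5'.of_same (fun i hi => ?_) rfl, by simp, ?_, ?_⟩)
    · simp [show i ≠ 5 by omega]
    · rw [Finset.sum_range_succ, ← gb, ← f₃.base, ← f₄.base]
      exact b5
    · intro q hq1 hqN hqn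
      have e := o5 q hq1 hqN hqn
      rw [f₄.out, f₃.out, go q hq1 hqN hqn] at e
      rw [Finset.sum_range_succ]
      refine e.trans ?_
      rcases lt_trichotomy q x with h | h | h
      · simp only [h, h.ne, Nat.lt_succ_of_lt h, if_true, if_false]; ring
      · simp only [h, lt_irrefl, Nat.lt_succ_self, if_true, if_false]; ring
      · simp only [h.not_gt, h.ne', show ¬ q < x + 1 by omega, if_false]; ring
  · obtain ⟨g1, g5, gb, gr⟩ := hs₁
    have h0 : 0 ∉ T := fun h => by rw [hT, mem_keptLabels] at h; omega
    refine ⟨g1, g5, by simp [gb, h0], fun q hq1 _ _ => ?_⟩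
    rw [gr, ho]
    simp [h0, show q ≠ 0 by omega]
  · have e1 := Nat.le_mul_of_pos_right sumInit.maxCost (show 0 < (n + m + 1) ^ 2 by positivity)
    have e2 : (Cond.natLt (.var 5) (.var 4)).cost + 1 +
        (K₁ * (n + m + 1) + (K₂ * (n + m + 1) + (K₃ * (n + m + 1) + (incr 5).maxCost))) ≤
        ((Cond.natLt (.var 5) (.var 4)).cost + 1 + (K₁ + (K₂ + (K₃ + (incr 5).maxCost)))) *
          (n + m + 1) := by
      generalize (Cond.natLt (.var 5) (.var 4)).cost + 1 = a
      generalize (incr 5).maxCost = c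
      nlinarith [Nat.zero_le (a * (n + m)), Nat.zero_le (c * (n + m))]
    have e3 := Nat.mul_le_mul_right (n + m + 1 - 1 + 1) e2
    refine (Nat.add_le_add e1 (e3.trans (le_of_eq ?_))).trans_eq (add_mul _ _ _).symm
    rw [Nat.add_sub_cancel, mul_assoc, sq]
  · rintro s' ⟨g1, -, gb, go⟩
    have hTN : ∀ z ∈ T, z ≤ n + m := fun z hz => by
      rw [hT, mem_keptLabels] at hz
      omega
    rw [sum_range_ite_mem hTN] at gb
    refine ⟨g1, gb, fun q hq1 hqN hqn => ?_⟩
    rw [go q hq1 hqN hqn, sum_range_ite_mem hTN, if_pos (by omega)]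

theorem runs_outProgram : ∃ K : ℕ, ∀ (n m p : ℕ) (P : ℕ → Point) (π : ℕ → ℕ) (nx : ℕ → ℕ → ℕ)
    (s : State), Sorting (n + m) P π → Listed n m p π nx s →
    Runs outProgram s (K * (n + m + 1)) (fun s' => ∀ q, 1 ≤ q → q ≤ n + m → n ≤ π q →
      s'.realArr 4 (π q - n) = (n : ℝ) * (n - 1) * (n - 2) * (n - 3) / 8 -
        (s.realVar 5 + s.realArr 6 q) / 2) := by
  refine ⟨(Program.setNat 6 (.const 1)).maxCost + ((Cond.natLt (.var 6) (.var 4)).cost + 1 +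
    outBody.maxCost), ?_⟩
  intro n m p P π nx s hπ hs
  refine (Runs.seq (Runs.of_wp (by simp [Program.Flat]) (Q := fun s' => Listed n m p π nx s' ∧
      s'.natVar 6 = 1 ∧ s'.realVar 5 = s.realVar 5 ∧ s'.realArr 6 = s.realArr 6) ?_)
    (fun s₁ hs₁ => Runs.forLoop (fun j s' => Listed n m p π nx s' ∧ s'.natVar 6 = j ∧
      s'.realVar 5 = s.realVar 5 ∧ s'.realArr 6 = s.realArr 6 ∧ ∀ q, 1 ≤ q → q < j → n ≤ π q →
        s'.realArr 4 (π q - n) = (n : ℝ) * (n - 1) * (n - 2) * (n - 3) / 8 -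
          (s.realVar 5 + s.realArr 6 q) / 2) (T := outBody.maxCost) (lo := 1) (hi := n + m + 1)
      (by omega) ?_ ?_ ?_)).mono ?_ ?_
  · refine Program.wp_setNat (v := 1) rfl ⟨hs.of_same (fun i hi => ?_) rfl, by simp, rfl, rfl⟩
    simp [show i ≠ 6 by omega]
  · rintro j s' ⟨g1, g6, -⟩
    simp [Cond.Holds, NatExpr.eval, g6, g1.var4]
  · rintro j s₂ hj1 hj ⟨g1, g6, gb, go, gq⟩
    refine Runs.of_wp (by simp [outBody, incr, Program.Flat, Program.block]) ?_
    have hc := holds_candCond g1 (v := .var 6) (by simpa [NatExpr.eval, g6] using hj1)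
      (by simp only [NatExpr.eval, g6]; omega)
    simp only [NatExpr.eval, g6] at hc
    refine ⟨fun hcj => ?_, fun hcj => ?_⟩
    · rw [hc] at hcj
      refine Program.wp_storeReal (x := π j - n) (v := (n : ℝ) * (n - 1) * (n - 2) * (n - 3) / 8 -
        (s.realVar 5 + s.realArr 6 j) / 2) ?_ ?_ (Program.wp_setNat (v := j + 1)
        (by simp [NatExpr.eval, g6]) ⟨g1.of_same (fun i hi => ?_) rfl, by simp, gb, ?_, ?_⟩)
      · simp [NatExpr.eval, label, g6, g1.var0, g1.pos j hj1 (by omega)]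
      · simp [RealExpr.eval, NatExpr.eval, sizeSub, g6, g1.var0, gb, go]
      · simp [show i ≠ 6 by omega]
      · funext i
        simp [go]
      · intro q hq1 hq hqn
        by_cases hqj : q = j
        · simp [hqj]
        · have : π q - n ≠ π j - n := fun he =>
            hqj (hπ.inj q j hq1 (by omega) hj1 (by omega) (by omega))
          simp [this, gq q hq1 (by omega) hqn]
    · rw [hc] at hcj
      simp only [Program.wp, Program.block, incr, NatExpr.eval, g6]
      refine ⟨g1.of_same (fun i hi => ?_) rfl, by simp, gb, go, fun q hq1 hq hqn => ?_⟩
      · simp [show i ≠ 6 by omega]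
      · have : q ≠ j := by rintro rfl; exact hcj hqn
        exact gq q hq1 (by omega) hqn
  · obtain ⟨g1, g6, gb, go⟩ := hs₁
    exact ⟨g1, g6, gb, go, fun q h1 h2 => by omega⟩
  · exact (Nat.add_le_add (Nat.le_mul_of_pos_right _ (Nat.succ_pos (n + m)))
      (Nat.mul_le_mul_left _ (show n + m + 1 - 1 + 1 ≤ n + m + 1 by omega))).trans_eq
        (add_mul _ _ _).symm
  · rintro s' ⟨-, -, -, -, gq⟩ q hq1 hqN hqn
    exact gq q hq1 (by omega) hqn

end RealRAM

/-! ### From labels back to points, and the complete program -/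

namespace RealRAM

variable {N : ℕ} {φ : ℕ → Point} {R : Arrangement N} {a : ℕ → ℝ} {T : Finset ℕ}

/-- The determinant is a product of three differences whose signs are known. Left of the directed
line `x y` means above it when `x < y`, and below it otherwise. -/
theorem Dual.sign_det (h : Dual N φ R a) {x y z : ℕ} (hx : x ∈ Finset.Icc 1 N)
    (hy : y ∈ Finset.Icc 1 N) (hz : z ∈ Finset.Icc 1 N) (hxy : x ≠ y) (hxz : x ≠ z) (hyz : y ≠ z) :
    (0 < det (φ x) (φ y) (φ z) ↔ (x < y ↔ R.Above x y z)) ∧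
    (det (φ x) (φ y) (φ z) < 0 ↔ ¬ (x < y ↔ R.Above x y z)) := by
  rw [Finset.mem_Icc] at hx hy hz
  have ha : ∀ {j}, 1 ≤ j → j ≤ N → x ≠ j → (x < j ∧ 0 < a j - a x) ∨ (j < x ∧ a j - a x < 0) := by
    intro j h1 h2 h3
    rcases lt_or_gt_of_ne h3 with h4 | h4
    · exact Or.inl ⟨h4, sub_pos.2 (h.lt x j hx.1 h4 h2)⟩
    · exact Or.inr ⟨h4, sub_neg.2 (h.lt j x h1 h4 hx.2)⟩
  have key : (0 < det (φ x) (φ y) (φ z) ∧ (x < y ↔ R.Above x y z)) ∨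
      (det (φ x) (φ y) (φ z) < 0 ∧ ¬ (x < y ↔ R.Above x y z)) := by
    rw [h.det_eq x y z hx.1 hx.2 hy.1 hy.2 hz.1 hz.2 hxy hxz]
    unfold Arrangement.Above
    rcases ha hy.1 hy.2 hxy with ⟨h1, h2⟩ | ⟨h1, h2⟩ <;>
    rcases ha hz.1 hz.2 hxz with ⟨h3, h4⟩ | ⟨h3, h4⟩ <;>
    rcases lt_or_gt_of_ne (R.x_ne x y z hx.1 hx.2 hy.1 hy.2 hz.1 hz.2 hxy hxz hyz) with h5 | h5
    · exact Or.inl ⟨mul_pos (mul_pos h2 h4) (sub_pos.2 h5), by simp [h1, h3, h5]⟩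
    · exact Or.inr ⟨mul_neg_of_pos_of_neg (mul_pos h2 h4) (sub_neg.2 h5),
        by simp [h1, h3, h5.not_gt, h3.not_gt]⟩
    · exact Or.inr ⟨mul_neg_of_neg_of_pos (mul_neg_of_pos_of_neg h2 h4) (sub_pos.2 h5),
        by simp [h1, h3.not_gt, h5.not_gt]⟩
    · exact Or.inl ⟨mul_pos_of_neg_of_neg (mul_neg_of_pos_of_neg h2 h4) (sub_neg.2 h5),
        by simp [h1, h3, h5]⟩
    · exact Or.inr ⟨mul_neg_of_neg_of_pos (mul_neg_of_neg_of_pos h2 h4) (sub_pos.2 h5),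
        by simp [h1.not_gt, h3, h5]⟩
    · exact Or.inl ⟨mul_pos_of_neg_of_neg (mul_neg_of_neg_of_pos h2 h4) (sub_neg.2 h5),
        by simp [h1.not_gt, h3.not_gt, h5.not_gt]⟩
    · exact Or.inl ⟨mul_pos (mul_pos_of_neg_of_neg h2 h4) (sub_pos.2 h5),
        by simp [h1.not_gt, h3.not_gt, h5.not_gt]⟩
    · exact Or.inr ⟨mul_neg_of_pos_of_neg (mul_pos_of_neg_of_neg h2 h4) (sub_neg.2 h5),
        by simp [h1.not_gt, h3, h5]⟩
  rcases key with ⟨h1, h2⟩ | ⟨h1, h2⟩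
  · simp [h1, h2, h1.not_gt]
  · simp [h1, h2, h1.not_gt]

theorem Dual.counts (h : Dual N φ R a) (hφ : Set.InjOn φ (Finset.Icc 1 N))
    (hT : T ⊆ Finset.Icc 1 N) {x y : ℕ} (hx : x ∈ Finset.Icc 1 N) (hy : y ∈ Finset.Icc 1 N)
    (hxy : x ≠ y) :
    leftCount (T.image φ) (φ x) (φ y) = (if x < y then R.upper T x y else R.lower T x y) ∧
    rightCount (T.image φ) (φ x) (φ y) = if x < y then R.lower T x y else R.upper T x y := by
  classical
  have hinj : Set.InjOn φ T := hφ.mono (by exact_mod_cast hT)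
  have hsum : ∀ f : ℕ → ℝ, f x = 0 → f y = 0 → ∑ z ∈ T, f z = ∑ z ∈ (T.erase x).erase y, f z := by
    intro f h1 h2
    rw [Finset.sum_erase _ h2, Finset.sum_erase _ h1]
  have hmem : ∀ z ∈ (T.erase x).erase y, z ∈ Finset.Icc 1 N ∧ x ≠ z ∧ y ≠ z := by
    intro z hz
    rw [Finset.mem_erase, Finset.mem_erase] at hz
    exact ⟨hT hz.2.2, hz.2.1.symm, hz.1.symm⟩
  unfold leftCount rightCount Arrangement.upper Arrangement.lower
  rw [Finset.sum_image hinj, Finset.sum_image hinj, hsum _ (by simp [det_self_left])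
    (by simp [det_self_right]), hsum (fun z => if det (φ x) (φ y) (φ z) < 0 then 1 else 0)
    (by simp [det_self_left]) (by simp [det_self_right])]
  constructor
  · split_ifs with hlt
    · refine Finset.sum_congr rfl fun z hz => if_congr ?_ rfl rfl
      obtain ⟨h1, h2, h3⟩ := hmem z hz
      rw [(h.sign_det hx hy h1 hxy h2 h3).1]; simp [hlt]
    · refine Finset.sum_congr rfl fun z hz => ?_
      obtain ⟨h1, h2, h3⟩ := hmem z hz
      simp only [(h.sign_det hx hy h1 hxy h2 h3).1, hlt, false_iff, ite_not]
  · split_ifs with hlt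
    · refine Finset.sum_congr rfl fun z hz => ?_
      obtain ⟨h1, h2, h3⟩ := hmem z hz
      simp only [(h.sign_det hx hy h1 hxy h2 h3).2, hlt, true_iff, ite_not]
    · refine Finset.sum_congr rfl fun z hz => if_congr ?_ rfl rfl
      obtain ⟨h1, h2, h3⟩ := hmem z hz
      rw [(h.sign_det hx hy h1 hxy h2 h3).2]; simp [hlt]

theorem Dual.pencil_eq (h : Dual N φ R a) (hφ : Set.InjOn φ (Finset.Icc 1 N))
    (hT : T ⊆ Finset.Icc 1 N) {x : ℕ} (hx : x ∈ Finset.Icc 1 N) :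
    R.pencil T x =
      ∑ b ∈ T.image φ, leftCount (T.image φ) (φ x) b * rightCount (T.image φ) (φ x) b := by
  rw [Finset.sum_image (hφ.mono (by exact_mod_cast hT)), Arrangement.pencil,
    ← Finset.sum_erase (a := x) T (by simp [leftCount, det_self])]
  refine Finset.sum_congr rfl fun y hy => ?_
  obtain ⟨hyx, hy⟩ := Finset.mem_erase.1 hy
  obtain ⟨h1, h2⟩ := h.counts hφ hT hx (hT hy) hyx.symm
  rw [h1, h2]
  split_ifs
  · rfl
  · exact mul_comm _ _

/-- Reversing the direction exchanges left with right and also the two counts, so the count on the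
side opposite to `q` does not depend on the orientation of the line. -/
theorem Dual.opposite_eq (h : Dual N φ R a) (hφ : Set.InjOn φ (Finset.Icc 1 N))
    (hT : T ⊆ Finset.Icc 1 N) {x q : ℕ} (hx : x ∈ T) (hq : q ∈ Finset.Icc 1 N) (hqT : q ∉ T) :
    R.opposite T x q = ∑ b ∈ T.image φ,
      ((if 0 < det (φ x) b (φ q) then rightCount (T.image φ) (φ x) b else 0) +
        if det (φ x) b (φ q) < 0 then leftCount (T.image φ) (φ x) b else 0) := by
  rw [Finset.sum_image (hφ.mono (by exact_mod_cast hT)), Arrangement.opposite,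
    ← Finset.sum_erase (a := x) T (by simp [det_self])]
  refine Finset.sum_congr rfl fun y hy => ?_
  obtain ⟨hyx, hy⟩ := Finset.mem_erase.1 hy
  have hxq : x ≠ q := by rintro rfl; exact hqT hx
  have hyq : y ≠ q := by rintro rfl; exact hqT hy
  obtain ⟨h1, h2⟩ := h.counts hφ hT (hT hx) (hT hy) hyx.symm
  obtain ⟨h3, h4⟩ := h.sign_det (hT hx) (hT hy) hq hyx.symm hxq hyq
  rw [h1, h2]
  by_cases hlt : x < y <;> by_cases hab : R.Above x y q <;> simp only [hlt, hab, iff_self,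
    iff_true, iff_false, not_true, not_false_iff] at h3 h4 <;> simp [hlt, hab, h3, h4]

/-- This is `crossingNumber_formula` for the set with `q` added, with its sum split by
`sum_counts_insert` and each piece replaced by the quantity the program accumulates. -/
theorem Dual.crossingNumber_eq (h : Dual N φ R a) (hφ : Set.InjOn φ (Finset.Icc 1 N))
    (hT : T ⊆ Finset.Icc 1 N) {q : ℕ} (hq : q ∈ Finset.Icc 1 N) (hqT : q ∉ T) {k : ℕ}
    (hgp : InGeneralPosition (insert (φ q) (T.image φ) : Finset Point))
    (hk : (insert (φ q) (T.image φ)).card = k) :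
    (crossingNumber (insert (φ q) (T.image φ)) : ℝ) = (k : ℝ) * (k - 1) * (k - 2) * (k - 3) / 8 -
      (∑ x ∈ T, R.pencil T x + (∑ x ∈ T, R.opposite T x q + 2 * R.pencil T q)) / 2 := by
  have hq' : φ q ∉ T.image φ := by
    intro hm
    obtain ⟨z, hz, he⟩ := Finset.mem_image.1 hm
    exact hqT (hφ (hT hz) hq he ▸ hz)
  have hinj : Set.InjOn φ T := hφ.mono (by exact_mod_cast hT)
  have h1 : ∑ x ∈ T, R.pencil T x = ∑ b ∈ T.image φ, ∑ c ∈ T.image φ,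
      leftCount (T.image φ) b c * rightCount (T.image φ) b c := by
    rw [Finset.sum_image hinj]
    exact Finset.sum_congr rfl fun x hx => h.pencil_eq hφ hT (hT hx)
  have h2 : ∑ x ∈ T, R.opposite T x q = oppositeCount (T.image φ) (φ q) := by
    rw [oppositeCount, Finset.sum_image hinj]
    exact Finset.sum_congr rfl fun x hx => h.opposite_eq hφ hT hx hq hqT
  have hf := crossingNumber_formula hgp
  rw [sum_counts_insert hq', hk] at hf
  rw [h1, h2, h.pencil_eq hφ hT hq]
  linarith

/-- The whole program. -/
def crossingProgram : Program := .seq copyProgram (.seq rankProgram (.seq listProgram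
  (.seq sumProgram outProgram)))

theorem runs_crossingProgram : ∃ K : ℕ, ∀ (n m p : ℕ) (P : ℕ → Point) (s : State),
    s.natVar 0 = n → s.natVar 1 = m → s.natVar 2 = p → (∀ i < n, s.realArr 0 i = (P i).1) →
    (∀ i < n, s.realArr 1 i = (P i).2) → (∀ i < m, s.realArr 2 i = (P (n + i)).1) →
    (∀ i < m, s.realArr 3 i = (P (n + i)).2) → (∀ i, s.realArr 6 i = 0) →
    (∀ a i, s.natArr a i = 0) → (∀ i < n + m, ∀ j < n + m, i ≠ j → P i ≠ P j) →
    (∀ i < n + m, ∀ j < n + m, ∀ k < n + m, i ≠ j → i ≠ k → j ≠ k → det (P i) (P j) (P k) ≠ 0) →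
    Runs crossingProgram s (K * (n + m + 1) ^ 2) (fun s' => ∃ (π : ℕ → ℕ) (R : Arrangement (n + m))
      (a : ℕ → ℝ), Sorting (n + m) P π ∧ Dual (n + m) (fun i => P (π i)) R a ∧
      ∀ q, 1 ≤ q → q ≤ n + m → n ≤ π q → s'.realArr 4 (π q - n) =
        (n : ℝ) * (n - 1) * (n - 2) * (n - 3) / 8 -
          (∑ x ∈ keptLabels n m p π, R.pencil (keptLabels n m p π) x +
            (∑ x ∈ keptLabels n m p π, R.opposite (keptLabels n m p π) x q +
              2 * R.pencil (keptLabels n m p π) q)) / 2) := by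
  obtain ⟨K₁, hK₁⟩ := runs_copyProgram
  obtain ⟨K₂, hK₂⟩ := runs_rankProgram
  obtain ⟨K₃, hK₃⟩ := runs_listProgram
  obtain ⟨K₄, hK₄⟩ := runs_sumProgram
  obtain ⟨K₅, hK₅⟩ := runs_outProgram
  refine ⟨K₁ + (K₂ + (K₃ + (K₄ + K₅))), ?_⟩
  intro n m p P s h0 h1 h2 hx hy hcx hcy ho hz hP hdet
  refine Runs.mono (T := K₁ * (n + m + 1) + (K₂ * (n + m + 1) ^ 2 + (K₃ * (n + m + 1) ^ 2 +
    (K₄ * (n + m + 1) ^ 2 + K₅ * (n + m + 1))))) (Runs.seq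
      (hK₁ n m p P s h0 h1 h2 hx hy hcx hcy ho hz) fun s₁ ⟨b₁, z₁⟩ => Runs.seq
      (hK₂ n m p P s₁ hP b₁ z₁) fun s₂ ⟨π, hπ, b₂, z₂⟩ => ?_) ?_ fun _ => id
  -- The arrangement is chosen after sorting and occurs only in the proof; the memory contains no
  -- abscissa of a crossing.
  · obtain ⟨R, a, ha, hR⟩ := exists_arrangement (N := n + m) (φ := fun i => P (π i))
      (fun i j h1 h2 h3 => hπ.lex i j h1 h2 h3) (fun i j k i1 i2 j1 j2 k1 k2 hij hik hjk =>
        hdet _ (hπ.lt i i1 i2) _ (hπ.lt j j1 j2) _ (hπ.lt k k1 k2)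
          (fun h => hij (hπ.inj i j i1 i2 j1 j2 h)) (fun h => hik (hπ.inj i k i1 i2 k1 k2 h))
          (fun h => hjk (hπ.inj j k j1 j2 k1 k2 h)))
    have hD : Dual (n + m) (fun i => P (π i)) R a := ⟨ha, hR⟩
    refine Runs.seq (hK₃ n m p P π R a s₂ hπ hD b₂ z₂) fun s₃ ⟨b₃, hst⟩ => ?_
    have hL : Listed n m p π (table (n + m + 1) 2 s₃) s₃ :=
      ⟨b₃.var0, b₃.var2, b₃.var4, b₃.row, b₃.pos, rfl⟩
    refine Runs.seq (hK₄ n m p π _ _ R s₃ hL hst b₃.out) fun s₄ ⟨hL₄, e₁, e₂⟩ => ?_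
    refine (hK₅ n m p P π _ s₄ hπ hL₄).mono le_rfl fun s₅ h₅ => ⟨π, R, a, hπ, hD, fun q q1 q2 q3 => ?_⟩
    rw [h₅ q q1 q2 q3, e₁, e₂ q q1 q2 q3]
  · have h1 : n + m + 1 ≤ (n + m + 1) ^ 2 := Nat.le_self_pow two_ne_zero _
    have h2 := Nat.mul_le_mul_left K₁ h1
    have h3 := Nat.mul_le_mul_left K₅ h1
    simp only [add_mul]
    omega

/-- The points with their indices; the candidates follow the other points. -/
noncomputable def pointAt {n m : ℕ} (s : Fin n → Point) (c : Fin m → Point) (i : ℕ) : Point :=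
  if h : i < n then s ⟨i, h⟩ else if h : i - n < m then c ⟨i - n, h⟩ else 0

theorem pointAt_of_lt {n m : ℕ} (s : Fin n → Point) (c : Fin m → Point) {i : ℕ} (h : i < n) :
    pointAt s c i = s ⟨i, h⟩ := dif_pos h

theorem pointAt_add {n m : ℕ} (s : Fin n → Point) (c : Fin m → Point) {j : ℕ} (h : j < m) :
    pointAt s c (n + j) = c ⟨j, h⟩ := by
  rw [pointAt, dif_neg (by omega), dif_pos (by omega)]
  congr 2
  omega

theorem exec_crossingProgram : ∃ K : ℕ, ∀ (n m : ℕ) (S C : Finset Point) (p : Point) (hp : p ∈ S)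
    (s : Fin n ≃ S) (c : Fin m ≃ C), InGeneralPosition ((S : Set Point) ∪ (C : Set Point)) →
    Disjoint C S → S.card = n →
    Runs crossingProgram (State.input (fun i => (s i : Point)) (fun j => (c j : Point))
      (s.symm ⟨p, hp⟩)) (K * (n + m + 1) ^ 2) (fun s' => ∀ j : Fin m,
        s'.realArr 4 j = (crossingNumber (insert (c j : Point) (S.erase p)) : ℝ)) := by
  classical
  obtain ⟨K, hK⟩ := runs_crossingProgram
  refine ⟨K, ?_⟩
  intro n m S C p hp s c hgp hCS hn
  set P := pointAt (fun i => (s i : Point)) (fun j => (c j : Point)) with hPdef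
  set k := s.symm ⟨p, hp⟩ with hk
  have hPs : ∀ i : Fin n, P i = s i := fun i => pointAt_of_lt _ _ i.2
  have hPc : ∀ j : Fin m, P (n + j) = c j := fun j => pointAt_add _ _ j.2
  have hcase : ∀ i < n + m, (∃ j : Fin n, i = j) ∨ ∃ j : Fin m, i = n + j := by
    intro i hi
    by_cases h : i < n
    · exact Or.inl ⟨⟨i, h⟩, rfl⟩
    · exact Or.inr ⟨⟨i - n, by omega⟩, by simp only; omega⟩
  have hmem : ∀ i < n + m, P i ∈ (S : Set Point) ∪ (C : Set Point) := by
    intro i hi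
    rcases hcase i hi with ⟨j, rfl⟩ | ⟨j, rfl⟩
    · rw [hPs]; exact Or.inl (s j).2
    · rw [hPc]; exact Or.inr (c j).2
  have hne : ∀ (i : Fin n) (j : Fin m), (s i : Point) ≠ c j := fun i j h =>
    Finset.disjoint_left.1 hCS (c j).2 (h ▸ (s i).2)
  have hinj : ∀ i < n + m, ∀ j < n + m, i ≠ j → P i ≠ P j := by
    intro i hi j hj hij he
    rcases hcase i hi with ⟨i, rfl⟩ | ⟨i, rfl⟩ <;> rcases hcase j hj with ⟨j, rfl⟩ | ⟨j, rfl⟩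
    · rw [hPs, hPs, Subtype.coe_inj, s.injective.eq_iff] at he
      exact hij (by rw [he])
    · rw [hPs, hPc] at he
      exact hne _ _ he
    · rw [hPs, hPc] at he
      exact hne _ _ he.symm
    · rw [hPc, hPc, Subtype.coe_inj, c.injective.eq_iff] at he
      exact hij (by rw [he])
  refine (hK n m k P
    (State.input (fun i => (s i : Point)) (fun j => (c j : Point)) k) rfl rfl rfl
    (fun i hi => by rw [hPs ⟨i, hi⟩]; exact dif_pos hi)
    (fun i hi => by rw [hPs ⟨i, hi⟩]; exact dif_pos hi)
    (fun i hi => by rw [hPc ⟨i, hi⟩]; exact dif_pos hi)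
    (fun i hi => by rw [hPc ⟨i, hi⟩]; exact dif_pos hi) (fun _ => rfl) (fun _ _ => rfl) hinj
    (fun i hi j hj l hl hij hil hjl => hgp.det_ne_zero (hmem i hi) (hmem j hj) (hmem l hl)
      (hinj i hi j hj hij) (hinj i hi l hl hil) (hinj j hj l hl hjl))).mono le_rfl ?_
  rintro final ⟨π, R, a, hπ, hD, hout⟩ j
  have hφ : Set.InjOn (fun i => P (π i)) (Finset.Icc 1 (n + m)) := by
    intro x hx y hy he
    have hx := Finset.mem_Icc.1 hx
    have hy := Finset.mem_Icc.1 hy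
    refine hπ.inj x y hx.1 hx.2 hy.1 hy.2 ?_
    by_contra hxy
    exact hinj _ (hπ.lt x hx.1 hx.2) _ (hπ.lt y hy.1 hy.2) hxy he
  set T := keptLabels n m k π with hT
  have himg : T.image (fun i => P (π i)) = S.erase p := by
    ext x
    rw [Finset.mem_image, Finset.mem_erase]
    constructor
    · rintro ⟨r, hr, rfl⟩
      rw [hT, mem_keptLabels] at hr
      obtain ⟨-, h1, h2⟩ := hr
      have e : P (π r) = s ⟨π r, h1⟩ := hPs ⟨π r, h1⟩
      simp only [e]
      refine ⟨fun he => h2 ?_, (s _).2⟩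
      have : s ⟨π r, h1⟩ = ⟨p, hp⟩ := Subtype.ext he
      rw [← Equiv.eq_symm_apply] at this
      exact congr_arg Fin.val this
    · rintro ⟨hxp, hxS⟩
      obtain ⟨r, h1, h2, h3⟩ := hπ.surj (s.symm ⟨x, hxS⟩) (by omega)
      refine ⟨r, ?_, ?_⟩
      · rw [hT, mem_keptLabels, h3]
        refine ⟨⟨h1, h2⟩, Fin.is_lt _, fun he => hxp ?_⟩
        have := s.symm.injective (Fin.val_injective he)
        exact congr_arg Subtype.val this
      · simp only [h3]
        rw [hPs, Equiv.apply_symm_apply]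
  -- Candidate `j` has index `n + j` in the joint list; `q` is its position in the sorted order, and
  -- the output is stored at `π q - n = j`.
  obtain ⟨q, q1, q2, q3⟩ := hπ.surj (n + j) (by omega)
  have hPq : P (π q) = c j := by rw [q3, hPc]
  have hqT : q ∉ T := by
    rw [hT, mem_keptLabels]
    omega
  have hcS : (c j : Point) ∉ S := Finset.disjoint_left.1 hCS (c j).2
  have hcr := hD.crossingNumber_eq (T := T) hφ (Finset.filter_subset _ _) (Finset.mem_Icc.2 ⟨q1, q2⟩) hqT
    (k := n) ?_ ?_
  · have := hout q q1 q2 (by omega)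
    rw [← hcr, q3, Nat.add_sub_cancel_left] at this
    rw [this, ← himg]
    simp only [hPc]
  · rw [himg, hPq]
    refine fun x hx y hy z hz => hgp x ?_ y ?_ z ?_
    all_goals
      simp only [Finset.coe_insert, Finset.coe_erase, Set.mem_insert_iff, Set.mem_sdiff,
        Finset.mem_coe] at hx hy hz
      simp only [Set.mem_union, Finset.mem_coe]
      grind
  · rw [himg, hPq, Finset.card_insert_of_notMem fun h => hcS (Finset.mem_of_mem_erase h),
      Finset.card_erase_add_one hp, hn]

end RealRAM

theorem theorem1 :
    ∃ prog : RealRAM.Program, ∀ α β : ℝ, 0 < α → 0 < β → ∃ K : ℕ,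
      ∀ (S C : Finset Point) (p : Point) (hp : p ∈ S),
        InGeneralPosition ((S : Set Point) ∪ (C : Set Point)) → Disjoint C S →
        α * (S.card : ℝ) ≤ (C.card : ℝ) → (C.card : ℝ) ≤ β * (S.card : ℝ) →
        ∀ (s : Fin S.card ≃ S) (c : Fin C.card ≃ C),
          ∃ (t : ℕ) (final : RealRAM.State),
            RealRAM.Exec prog
              (RealRAM.State.input (fun i => (s i : Point)) (fun j => (c j : Point))
                (s.symm ⟨p, hp⟩)) t final ∧
            t ≤ K * S.card ^ 2 ∧
            ∀ j : Fin C.card,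
              final.realArr 4 (j : ℕ) = (crossingNumber (insert (c j : Point) (S.erase p)) : ℝ) := by
  obtain ⟨K, hK⟩ := RealRAM.exec_crossingProgram
  refine ⟨RealRAM.crossingProgram, fun α β _ _ => ⟨K * (⌈β⌉₊ + 2) ^ 2, ?_⟩⟩
  intro S C p hp hgp hCS _ hβ s c
  obtain ⟨t, final, hex, ht, hout⟩ := hK _ _ S C p hp s c hgp hCS rfl
  refine ⟨t, final, hex, ht.trans ?_, hout⟩
  have h1 : 1 ≤ S.card := Finset.card_pos.2 ⟨p, hp⟩
  have h2 : C.card ≤ ⌈β⌉₊ * S.card := by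
    have : (C.card : ℝ) ≤ (⌈β⌉₊ : ℝ) * S.card :=
      hβ.trans (mul_le_mul_of_nonneg_right (Nat.le_ceil β) (Nat.cast_nonneg _))
    exact_mod_cast this
  -- As the set contains `p`, its size is at least 1 and absorbs the additive constant: `n + m + 1 ≤
  -- (⌈β⌉₊ + 2) * n`.
  rw [mul_assoc, ← mul_pow]
  refine Nat.mul_le_mul_left _ (Nat.pow_le_pow_left ?_ 2)
  rw [add_mul]
  omega
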